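/- **Setting.** Fix a cylindric constraint system $(\mathcal C,\le,\sqcup,\mathrm{true},\mathrm{false},\mathit{Var},\exists,D)$: a lattice with least element $\mathrm{true}$ and greatest element $\mathrm{false}$ ($c\le d$ means that $d$ entails $c$), a denumerable set of variables, cylindrification operators $\exists x$ that are decreasing, monotone, commuting, satisfy $\exists x(c\sqcup\exists x\,d)=\exists x\,c\sqcup\exists x\,d$ and preserve least upper bounds of increasing chains, and equalities $x=t$ between variables and terms obeying the usual laws of diagonal elements: $x=x$ is $\mathrm{true}$; $(x=t)=\exists z(x=z\sqcup z=t)$ for $z\notin\{x\}\cup vars(t)$; and for $x\notin vars(t)$, $c\le (x=t)\sqcup\exists x(c\sqcup x=t)$ and $\exists x(x=t)=\mathrm{true}$; moreover $x=y$ and $z=t$ together entail $z=t'$, where $t'$ is $t$ with the variable $x$ replaced by $y$. Write $c\cong d$ for equivalence of constraints, $fv(c)=\{x:\exists x\,c\not\cong c\}$, $c[\vec t/\vec x]=\exists\vec x(c\sqcup\vec x=\vec t)$; $\vec t$ is *admissible* for $\vec x$ if $|\vec t|=|\vec x|$ and no variable of $\vec x$ occurs in $\vec t$. Processes of universal timed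 CCP are $$P,Q::=\mathbf{skip}\mid\mathbf{tell}(c)\mid(\mathbf{abs}\ \vec x;c)P\mid P\parallel Q\mid(\mathbf{local}\ \vec x)P\mid\mathbf{next}\,P\mid\mathbf{unless}\ c\ \mathbf{next}\,P\mid p(\vec t)\mid{!P},$$ where the $\vec x$ in $\mathbf{abs}$ are pairwise distinct, $\mathbf{when}\ c\ \mathbf{do}\ P$ is $\mathbf{abs}$ with empty $\vec x$, and $!P$ abbreviates the recursion $!P=P\parallel\mathbf{next}\,!P$. A program $\mathcal D.P$ consists of a process $P$ and, for every procedure name $p$, one declaration $p(\vec x):=Q$ with $\vec x$ pairwise distinct and $fv(Q)\subseteq\vec x$, taken up to renaming of $\vec x$; finitely many variables occur in each of these processes. Put $P[\vec t/\vec x]=(\mathbf{local}\ \vec x)(!\mathbf{tell}(\vec x=\vec t)\parallel P)$. **Operational semantics.** Configurations are $\langle\vec x;P;d\rangle$ (local variables, process, store). Internal steps: $\mathbf{tell}(c)$ adds $c$ to the store and becomes $\mathbf{skip}$; $(\mathbf{local}\ \vec y)P$ becomes $P$ and $\vec y$ joins the local variables, if $\vec y$ is disjoint from $\vec x$ and $fv(d)$;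 $(\mathbf{abs}\ \vec y;c;E)P$ becomes $P[\vec t/\vec y]\parallel(\mathbf{abs}\ \vec y;c;E\cup\{\vec y=\vec t\})P$, if $\vec t$ is admissible for $\vec y$, the store entails $c[\vec t/\vec y]$, and no element of $E$ entails $\vec y=\vec t$ (initially $E=\emptyset$); $p(\vec t)$ becomes $Q[\vec t/\vec x]$ if $p(\vec x):=Q$ and $\vec t$ is admissible for $\vec x$; $\mathbf{unless}\ c\ \mathbf{next}\,P$ becomes $\mathbf{skip}$ if the store entails $c$; $!P$ becomes $P\parallel\mathbf{next}\,!P$; a component of $P\parallel Q$ may step, introducing only local variables not free in the other; existential quantifiers written in the store may be opened, their variables (at least one, fresh) becoming local; and processes are taken up to $\alpha$-conversion and the commutative monoid laws of $(\parallel,\mathbf{skip})$, also under all operators. If $\langle\emptyset;P;c\rangle$ reduces to a configuration $\langle\vec x;Q;d\rangle$ without further steps, then $P\xRightarrow{(c,\exists\vec x\,d)}(\mathbf{local}\ \vec x)F(Q)$, where $F(\mathbf{skip})=F(\mathbf{abs}\ldots)=\mathbf{skip}$, $F(P_1\parallel P_2)=F(P_1)\parallel F(P_2)$, $F(\mathbf{next}\,Q)=F(\mathbf{unless}\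 c\ \mathbf{next}\,Q)=Q$. For finite sequences $s,s'$ of equal length write $P\xRightarrow{(s,s')}$, and for infinite ones $P\xRightarrow{(w,w')}_\omega$, if $P$ has a succession of observable transitions with inputs $s$ (resp. $w$) and outputs $s'$ (resp. $w'$). The strongest postcondition $sp(P)$ is the set of finite and infinite sequences $s$ such that $P$ outputs $s$ on input $s$, up to $\cong$. **Denotational semantics.** Given an interpretation $I$ of calls by subsets of $\mathcal C^\omega$, $[\![\mathbf{skip}]\!]_I=\mathcal C^\omega$; $[\![\mathbf{tell}(c)]\!]_I=\{d.s: c\le d\}$; $[\![(\mathbf{abs}\ \vec x;c)P]\!]_I=\forall\!\!\!\forall\vec x\{d.s: c\le d\Rightarrow d.s\in[\![P]\!]_I\}$; $[\![P\parallel Q]\!]_I=[\![P]\!]_I\cap[\![Q]\!]_I$; $[\![(\mathbf{local}\ \vec x)P]\!]_I=\{s:\exists s'\in[\![P]\!]_I,\ \exists\vec x\,s\cong\exists\vec x\,s'\}$; $[\![\mathbf{next}\,P]\!]_I=\mathcal C.[\![P]\!]_I$; $[\![\mathbf{unless}\ c\ \mathbf{next}\,P]\!]_I=\{d.s: c\le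 d\ \text{or}\ s\in[\![P]\!]_I\}$; $[\![p(\vec t)]\!]_I=I(p(\vec t))$; and $[\![!P]\!]_I$ is the set of sequences all of whose suffixes are in $[\![P]\!]_I$. Here $\forall\!\!\!\forall\vec x(S)$ is the set of $\exists\vec y(s)\in S$ with $s\in S$, $\vec y$ a finite list of variables, such that every $s'$ with $\exists\vec x\,s\cong\exists\vec x\,s'$ and all of whose elements entail $\vec x=\vec t$ for some $\vec t$ admissible for $\vec x$ is in $S$. Let $[\![P]\!]=[\![P]\!]_I$ for the least fixpoint $I$, with respect to reverse inclusion, of $I\mapsto\big(p(\vec t)\mapsto[\![Q[\vec t/\vec x]]\!]_I\ \text{for } p(\vec x):=Q \text{ with } \vec t \text{ admissible for } \vec x\big)$. $\mathcal D.P$ is *locally independent* if for every subprocess $(\mathbf{local}\ \vec x)Q$ of $P$ or of a procedure body, neither $Q$ nor the body of any procedure that $Q$ calls, directly or indirectly, contains $\mathbf{unless}$. **Theorem (Completeness).** Let $\mathcal D.P$ be a locally independent program and $w\in[\![P]\!]$. 1. If $s$ is a finite prefix of $w$ (up to $\cong$) and $P\xRightarrow{(s,s')}$, then $s\cong s'$;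 in particular $s\in sp(P)$. 2. If $P\xRightarrow{(w,w')}_\omega$, then $w\cong w'$; in particular $w\in sp(P)$. -/

import Mathlib

universe u v w r

/-- Cylindric constraint systems over the set of variables `V`, with an equality theory for the
terms over the signature `L`.  The lattice order is `c ≤ d` iff `d` entails `c`; `⊔` is conjunction,
`⊥` is `true`, `⊤` is `false`; `ex x` is the cylindrification `∃x` and `eqn x t` is the constraint
`x = t`.  The diagonal element of `x` and `y` is `eqn x (var y)`. -/
class ConstraintSystem (L : outParam FirstOrder.Language.{u, v}) (V : outParam Type) [DecidableEq V]
    (C : Type w) extends Lattice C, BoundedOrder C where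
  ex : V → C → C
  eqn : V → L.Term V → C
  ex_le : ∀ x c, ex x c ≤ c
  ex_mono : ∀ x c d, c ≤ d → ex x c ≤ ex x d
  ex_sup_ex : ∀ x c d, ex x (c ⊔ ex x d) = ex x c ⊔ ex x d
  ex_comm : ∀ x y c, ex x (ex y c) = ex y (ex x c)
  ex_lub : ∀ (x : V) (c : ℕ → C) (a : C), StrictMono c → IsLUB (Set.range c) a →
    IsLUB (Set.range fun i => ex x (c i)) (ex x a)
  eqn_self : ∀ x, eqn x (FirstOrder.Language.Term.var x) = ⊥
  eqn_trans : ∀ (x z : V) (t : L.Term V), z ≠ x → z ∉ t.varFinset →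
    eqn x t = ex z (eqn x (FirstOrder.Language.Term.var z) ⊔ eqn z t)
  eqn_subst : ∀ (x : V) (t : L.Term V) (c : C), x ∉ t.varFinset →
    c ≤ eqn x t ⊔ ex x (c ⊔ eqn x t)
  ex_eqn : ∀ (x : V) (t : L.Term V), x ∉ t.varFinset → ex x (eqn x t) = ⊥
  eqn_congr : ∀ (x y z : V) (t : L.Term V),
    eqn z (t.relabel fun u => if u = x then y else u) ≤
      eqn x (FirstOrder.Language.Term.var y) ⊔ eqn z t

namespace UTCC

section Constraints

variable {L : FirstOrder.Language.{u, v}} {V : Type} {C : Type w} [DecidableEq V] [ConstraintSystem L V C]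

/-- `∃x₁ … ∃xₙ c`. -/
def exs (xs : List V) (c : C) : C := xs.foldr ConstraintSystem.ex c

/-- The free variables of a constraint. -/
def cfv (c : C) : Set V := {x | ConstraintSystem.ex x c ≠ c}

/-- `x₁ = t₁ ⊔ … ⊔ xₙ = tₙ`. -/
def eqns (xs : List V) (ts : List (L.Term V)) : C :=
  (List.zipWith (fun x t => (ConstraintSystem.eqn x t : C)) xs ts).foldr (· ⊔ ·) ⊥

/-- The variables occurring in a list of terms. -/
def termVars (ts : List (L.Term V)) : Set V := {x | ∃ t ∈ ts, x ∈ t.varFinset}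

/-- `ts` is admissible for `xs`. -/
def Adm (xs : List V) (ts : List (L.Term V)) : Prop :=
  xs.length = ts.length ∧ ∀ x ∈ xs, x ∉ termVars ts

/-- `c[ts/xs]`, i.e. `∃xs (c ⊔ xs = ts)`. -/
def csubst (c : C) (xs : List V) (ts : List (L.Term V)) : C := exs xs (c ⊔ eqns xs ts)

/-- `c[y/x]`; used for `y` fresh only. -/
def crename (x y : V) (c : C) : C := csubst c [x] [FirstOrder.Language.Term.var y]

/-- The renaming of `x` to `y` on variables. -/
def vrename (x y z : V) : V := if z = x then y else z

/-- The renaming of `x` to `y` in a list of terms. -/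
def trename (x y : V) (ts : List (L.Term V)) : List (L.Term V) :=
  ts.map (FirstOrder.Language.Term.relabel (vrename x y))

end Constraints

/-- Constraints as they are written: built from elements of the constraint system by conjunction
and explicit existential quantification.  Stores and told constraints are of this kind, because
the operational semantics may open the existential quantifiers that are written in the store,
which is not invariant under equivalence of constraints. -/
inductive Con (V : Type) (C : Type w) : Type w
  | base (c : C) : Con V C
  | join (a b : Con V C) : Con V C
  | ex (x : V) (a : Con V C) : Con V C

namespace Con

variable {L : FirstOrder.Language.{u, v}} {V : Type} {C : Type w} [DecidableEq V] [ConstraintSystem L V C]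

/-- The element of the constraint system denoted by a written constraint; two written constraints
are equivalent iff they have the same value. -/
def val : Con V C → C
  | base c => c
  | join a b => a.val ⊔ b.val
  | ex x a => ConstraintSystem.ex x a.val

/-- The variables that occur, free or bound. -/
def occ : Con V C → Set V
  | base c => cfv c
  | join a b => a.occ ∪ b.occ
  | ex x a => insert x a.occ

/-- Renaming of the free occurrences of `x` to `y`; used for `y` not occurring only. -/
def rename (x y : V) : Con V C → Con V C
  | base c => base (crename x y c)
  | join a b => join (a.rename x y) (b.rename x y)
  | ex z a => if z = x then ex z a else ex z (a.rename x y)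

/-- `∃x₁ … ∃xₙ a` as a written constraint. -/
def exs (xs : List V) (a : Con V C) : Con V C := xs.foldr Con.ex a

/-- `Opens a ys b`: after renaming apart its bound variables, `a` has the form
`∃y₁ c₁ ⊔ … ⊔ ∃yₙ cₙ` (where some `yᵢ` may be empty), `ys` lists `y₁, …, yₙ`, and `b` is
`c₁ ⊔ … ⊔ cₙ`.  The variables of `yᵢ` do not occur in `cⱼ` for `j ≠ i`. -/
inductive Opens : Con V C → List V → Con V C → Prop
  | base (c : C) : Opens (base c) [] (base c)
  | join {a b a' b' : Con V C} {ys zs : List V} : Opens a ys a' → Opens b zs b' →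
      ys.Disjoint zs → (∀ y ∈ ys, y ∉ b'.occ) → (∀ z ∈ zs, z ∉ a'.occ) →
      Opens (join a b) (ys ++ zs) (join a' b')
  | ex (x : V) (a : Con V C) : Opens (ex x a) [x] a
  | ex_rename {x y : V} {a : Con V C} : y ≠ x → y ∉ a.occ → Opens (ex x a) [y] (a.rename x y)

end Con

/-- Processes over the procedure names `N`.  `abs xs c E P` is the parametric ask
`(abs xs; c; E) P`, where `E` lists the tuples of terms with which it has been executed already in
the current time unit (so that `E` stands for the set of diagonal elements `xs = ts`, `ts ∈ E`);
in a program `E` is empty.  The ask `when c do P` is `abs [] c [] P`.  `unl c P` is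
`unless c next P`, `loc xs P` is `(local xs) P`, and `bang P` is the replication `! P`, the process
defined by `! P = P ∥ next ! P`. -/
inductive Proc (L : FirstOrder.Language.{u, v}) (V : Type) (C : Type w) (N : Type r) : Type (max u w r)
  | skip : Proc L V C N
  | tell (c : Con V C) : Proc L V C N
  | abs (xs : List V) (c : C) (E : List (List (L.Term V))) (P : Proc L V C N) : Proc L V C N
  | par (P Q : Proc L V C N) : Proc L V C N
  | loc (xs : List V) (P : Proc L V C N) : Proc L V C N
  | nxt (P : Proc L V C N) : Proc L V C N
  | unl (c : C) (P : Proc L V C N) : Proc L V C N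
  | call (p : N) (ts : List (L.Term V)) : Proc L V C N
  | bang (P : Proc L V C N) : Proc L V C N

namespace Proc

variable {L : FirstOrder.Language.{u, v}} {V : Type} {C : Type w} {N : Type r} [DecidableEq V] [ConstraintSystem L V C]

/-- The free variables of a process. -/
def fv : Proc L V C N → Set V
  | skip => ∅
  | tell c => cfv c.val
  | abs xs c E P => ((cfv c ∪ P.fv) \ {x | x ∈ xs}) ∪ {x | ∃ ts ∈ E, x ∈ termVars ts}
  | par P Q => P.fv ∪ Q.fv
  | loc xs P => P.fv \ {x | x ∈ xs}
  | nxt P => P.fv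
  | unl c P => cfv c ∪ P.fv
  | call _ ts => termVars ts
  | bang P => P.fv

/-- The variables that occur in a process, free or bound. -/
def occ : Proc L V C N → Set V
  | skip => ∅
  | tell c => c.occ
  | abs xs c E P => {x | x ∈ xs} ∪ cfv c ∪ {x | ∃ ts ∈ E, x ∈ termVars ts} ∪ P.occ
  | par P Q => P.occ ∪ Q.occ
  | loc xs P => {x | x ∈ xs} ∪ P.occ
  | nxt P => P.occ
  | unl c P => cfv c ∪ P.occ
  | call _ ts => termVars ts
  | bang P => P.occ

/-- Renaming of the free occurrences of `x` to `y`; used for `y` not occurring only. -/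
def rename (x y : V) : Proc L V C N → Proc L V C N
  | skip => skip
  | tell c => tell (c.rename x y)
  | abs xs c E P =>
      if x ∈ xs then abs xs c (E.map (trename x y)) P
      else abs xs (crename x y c) (E.map (trename x y)) (P.rename x y)
  | par P Q => par (P.rename x y) (Q.rename x y)
  | loc xs P => if x ∈ xs then loc xs P else loc xs (P.rename x y)
  | nxt P => nxt (P.rename x y)
  | unl c P => unl (crename x y c) (P.rename x y)
  | call p ts => call p (trename x y ts)
  | bang P => bang (P.rename x y)

/-- `P[ts/xs]`, i.e. `(local xs) (! tell(xs = ts) ∥ P)`. -/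
def subst (P : Proc L V C N) (xs : List V) (ts : List (L.Term V)) : Proc L V C N :=
  loc xs (par (bang (tell (Con.base (eqns xs ts)))) P)

/-- Structural congruence. -/
inductive Congr : Proc L V C N → Proc L V C N → Prop
  | refl (P) : Congr P P
  | symm {P Q} : Congr P Q → Congr Q P
  | trans {P Q R} : Congr P Q → Congr Q R → Congr P R
  | abs {xs c E P Q} : Congr P Q → Congr (abs xs c E P) (abs xs c E Q)
  | par {P P' Q Q'} : Congr P P' → Congr Q Q' → Congr (par P Q) (par P' Q')
  | loc {xs P Q} : Congr P Q → Congr (loc xs P) (loc xs Q)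
  | nxt {P Q} : Congr P Q → Congr (nxt P) (nxt Q)
  | unl {c P Q} : Congr P Q → Congr (unl c P) (unl c Q)
  | bang {P Q} : Congr P Q → Congr (bang P) (bang Q)
  | alpha_loc {xs : List V} {x y : V} {P : Proc L V C N} : x ∈ xs → y ∉ xs → y ∉ P.occ →
      Congr (loc xs P) (loc (xs.map (vrename x y)) (P.rename x y))
  | alpha_abs {xs : List V} {x y : V} {c : C} {E} {P : Proc L V C N} :
      x ∈ xs → y ∉ (abs xs c E P).occ →
      Congr (abs xs c E P) (abs (xs.map (vrename x y)) (crename x y c) E (P.rename x y))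
  | par_skip (P) : Congr (par P skip) P
  | par_comm (P Q) : Congr (par P Q) (par Q P)
  | par_assoc (P Q R) : Congr (par P (par Q R)) (par (par P Q) R)

/-- The process to be executed in the next time unit (undefined if some process at the top level
can never be part of a resting point). -/
def future : Proc L V C N → Option (Proc L V C N)
  | skip => some skip
  | abs _ _ _ _ => some skip
  | par P Q => P.future.bind fun P' => Q.future.map fun Q' => par P' Q'
  | nxt P => some P
  | unl _ P => some P
  | _ => none

/-- Conditions on processes written in a program: the parameters of a parametric ask are pairwise
distinct and no parametric ask has been executed yet. -/
def WellFormed : Proc L V C N → Prop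
  | abs xs _ E P => xs.Nodup ∧ E = [] ∧ P.WellFormed
  | par P Q => P.WellFormed ∧ Q.WellFormed
  | loc _ P => P.WellFormed
  | nxt P => P.WellFormed
  | unl _ P => P.WellFormed
  | bang P => P.WellFormed
  | _ => True

/-- There is no occurrence of `unless`. -/
def NoUnless : Proc L V C N → Prop
  | abs _ _ _ P => P.NoUnless
  | par P Q => P.NoUnless ∧ Q.NoUnless
  | loc _ P => P.NoUnless
  | nxt P => P.NoUnless
  | unl _ _ => False
  | bang P => P.NoUnless
  | _ => True

/-- The procedure names called in a process. -/
def calls : Proc L V C N → Set N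
  | abs _ _ _ P => P.calls
  | par P Q => P.calls ∪ Q.calls
  | loc _ P => P.calls
  | nxt P => P.calls
  | unl _ P => P.calls
  | call p _ => {p}
  | bang P => P.calls
  | _ => ∅

end Proc

/-- A procedure declaration: formal parameters and body. -/
structure Decl (L : FirstOrder.Language.{u, v}) (V : Type) (C : Type w) (N : Type r) : Type (max u w r) where
  formals : List V
  body : Proc L V C N

section Programs

variable {L : FirstOrder.Language.{u, v}} {V : Type} {C : Type w} {N : Type r} [DecidableEq V] [ConstraintSystem L V C]

/-- A declaration up to renaming of its formal parameters. -/
inductive Decl.Alpha (δ : Decl L V C N) : Decl L V C N → Prop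
  | refl : Decl.Alpha δ δ
  | step {ε : Decl L V C N} {x y : V} : Decl.Alpha δ ε → x ∈ ε.formals → y ∉ ε.formals →
      y ∉ ε.body.occ →
      Decl.Alpha δ ⟨ε.formals.map (vrename x y), ε.body.rename x y⟩

/-- `D.P` is a program: each procedure name has a declaration whose formal parameters are pairwise
distinct and comprise the free variables of the body; only finitely many variables occur in each
process. -/
def IsProgram (D : N → Decl L V C N) (P : Proc L V C N) : Prop :=
  (P.WellFormed ∧ P.occ.Finite) ∧
  ∀ p, (D p).formals.Nodup ∧ (D p).body.WellFormed ∧ (D p).body.occ.Finite ∧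
    (D p).body.fv ⊆ {x | x ∈ (D p).formals}

/-- `Reaches D Q p`: `p` is called in `Q`, or in the body of a procedure reached from `Q`. -/
inductive Reaches (D : N → Decl L V C N) (Q : Proc L V C N) : N → Prop
  | call {p : N} : p ∈ Q.calls → Reaches D Q p
  | step {p q : N} : Reaches D Q p → q ∈ (D p).body.calls → Reaches D Q q

/-- Neither `Q` nor any procedure that `Q` calls, directly or indirectly, contains `unless`. -/
def UnlessFree (D : N → Decl L V C N) (Q : Proc L V C N) : Prop :=
  Q.NoUnless ∧ ∀ p, Reaches D Q p → (D p).body.NoUnless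

/-- The body of each `local` process in the given process is free of `unless`. -/
def LocalsUnlessFree (D : N → Decl L V C N) : Proc L V C N → Prop
  | .abs _ _ _ P => LocalsUnlessFree D P
  | .par P Q => LocalsUnlessFree D P ∧ LocalsUnlessFree D Q
  | .loc _ P => UnlessFree D P ∧ LocalsUnlessFree D P
  | .nxt P => LocalsUnlessFree D P
  | .unl _ P => LocalsUnlessFree D P
  | .bang P => LocalsUnlessFree D P
  | _ => True

/-- `D.P` is locally independent. -/
def LocallyIndependent (D : N → Decl L V C N) (P : Proc L V C N) : Prop :=
  LocalsUnlessFree D P ∧ ∀ p, LocalsUnlessFree D (D p).body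

/-! ### Operational semantics -/

/-- Configurations: local variables, process, store. -/
structure Config (L : FirstOrder.Language.{u, v}) (V : Type) (C : Type w) (N : Type r) : Type (max u w r) where
  vars : List V
  proc : Proc L V C N
  store : Con V C

/-- The internal transition. -/
inductive Step (D : N → Decl L V C N) : Config L V C N → Config L V C N → Prop
  | tell (xs : List V) (c d : Con V C) : Step D ⟨xs, .tell c, d⟩ ⟨xs, .skip, .join d c⟩
  | par {xs ys : List V} {P P' Q : Proc L V C N} {c d : Con V C} :
      Step D ⟨xs, P, c⟩ ⟨xs ++ ys, P', d⟩ → (∀ y ∈ ys, y ∉ Q.fv) →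
      Step D ⟨xs, .par P Q, c⟩ ⟨xs ++ ys, .par P' Q, d⟩
  | loc {xs ys : List V} {P : Proc L V C N} {d : Con V C} :
      ys.Disjoint xs → (∀ y ∈ ys, y ∉ cfv d.val) →
      Step D ⟨xs, .loc ys P, d⟩ ⟨xs ++ ys, P, d⟩
  | abs {xs ys : List V} {c : C} {E : List (List (L.Term V))} {P : Proc L V C N} {d : Con V C}
      {ts : List (L.Term V)} :
      csubst c ys ts ≤ d.val → Adm ys ts → (∀ us ∈ E, ¬ (eqns ys ts : C) ≤ eqns ys us) →
      Step D ⟨xs, .abs ys c E P, d⟩ ⟨xs, .par (P.subst ys ts) (.abs ys c (ts :: E) P), d⟩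
  | structVar {xs ys : List V} {P : Proc L V C N} {c d : Con V C} :
      c.Opens ys d → ys ≠ [] → ys.Disjoint xs → (∀ y ∈ ys, y ∉ P.fv) →
      Step D ⟨xs, P, c⟩ ⟨xs ++ ys, P, d⟩
  | struct {xs ys : List V} {P Q P' Q' : Proc L V C N} {c d : Con V C} :
      P.Congr Q → Step D ⟨xs, Q, c⟩ ⟨ys, Q', d⟩ → Q'.Congr P' → Step D ⟨xs, P, c⟩ ⟨ys, P', d⟩
  | call {xs : List V} {p : N} {ts : List (L.Term V)} {d : Con V C} {ε : Decl L V C N} :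
      (D p).Alpha ε → Adm ε.formals ts →
      Step D ⟨xs, .call p ts, d⟩ ⟨xs, ε.body.subst ε.formals ts, d⟩
  | unl {xs : List V} {c : C} {P : Proc L V C N} {d : Con V C} :
      c ≤ d.val → Step D ⟨xs, .unl c P, d⟩ ⟨xs, .skip, d⟩
  | bang (xs : List V) (P : Proc L V C N) (d : Con V C) :
      Step D ⟨xs, .bang P, d⟩ ⟨xs, .par P (.nxt (.bang P)), d⟩

/-- The observable transition: `P` on input `c` outputs `c'` and becomes `R` in one time unit. -/
def Observable (D : N → Decl L V C N) (P : Proc L V C N) (c c' : Con V C) (R : Proc L V C N) :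
    Prop :=
  ∃ (xs : List V) (Q F : Proc L V C N) (d : Con V C),
    Relation.ReflTransGen (Step D) ⟨[], P, c⟩ ⟨xs, Q, d⟩ ∧ (¬ ∃ γ, Step D ⟨xs, Q, d⟩ γ) ∧
    Q.future = some F ∧ c' = d.exs xs ∧ R = .loc xs F

/-- `FinRun D P s s'`: `P` on the finite input `s` outputs `s'`. -/
inductive FinRun (D : N → Decl L V C N) :
    Proc L V C N → List (Con V C) → List (Con V C) → Prop
  | nil (P) : FinRun D P [] []
  | cons {P R c c' s s'} : Observable D P c c' R → FinRun D R s s' →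
      FinRun D P (c :: s) (c' :: s')

/-- `InfRun D P w w'`: `P` on the infinite input `w` outputs `w'`. -/
def InfRun (D : N → Decl L V C N) (P : Proc L V C N) (w w' : ℕ → Con V C) : Prop :=
  ∃ Q : ℕ → Proc L V C N, Q 0 = P ∧ ∀ n, Observable D (Q n) (w n) (w' n) (Q (n + 1))

/-- The finite sequences in the strongest postcondition of `P`, up to equivalence. -/
def spFin (D : N → Decl L V C N) (P : Proc L V C N) : Set (List C) :=
  {s | ∃ a b : List (Con V C), FinRun D P a b ∧ a.map Con.val = s ∧ b.map Con.val = s}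

/-- The infinite sequences in the strongest postcondition of `P`, up to equivalence. -/
def spInf (D : N → Decl L V C N) (P : Proc L V C N) : Set (ℕ → C) :=
  {s | ∃ a b : ℕ → Con V C, InfRun D P a b ∧ (∀ n, (a n).val = s n) ∧ ∀ n, (b n).val = s n}

/-! ### Denotational semantics -/

/-- Two sequences are `xs`-variants. -/
def Variant (xs : List V) (s s' : ℕ → C) : Prop := ∀ n, exs xs (s n) = exs xs (s' n)

/-- The operator `∃∃ xs` on sets of sequences. -/
def Exists' (xs : List V) (S : Set (ℕ → C)) : Set (ℕ → C) := {s | ∃ s' ∈ S, Variant xs s s'}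

/-- The operator `∀∀ xs` on sets of sequences. -/
def Forall' (xs : List V) (S : Set (ℕ → C)) : Set (ℕ → C) :=
  {e | e ∈ S ∧ ∃ (ys : List V) (s : ℕ → C), (e = fun n => exs ys (s n)) ∧ s ∈ S ∧
    ∀ (s' : ℕ → C) (ts : List (L.Term V)), Variant xs s s' → (∀ n, eqns xs ts ≤ s' n) →
      Adm xs ts → s' ∈ S}

/-- Interpretations of procedure calls. -/
abbrev Interp (L : FirstOrder.Language.{u, v}) (V : Type) (C : Type w) (N : Type r) :
    Type (max u w r) :=
  N → List (L.Term V) → Set (ℕ → C)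

/-- The denotation of a process under an interpretation of the procedure calls. -/
def den (I : Interp L V C N) : Proc L V C N → Set (ℕ → C)
  | .skip => Set.univ
  | .tell c => {s | c.val ≤ s 0}
  | .abs xs c _ P => Forall' xs {s | c ≤ s 0 → s ∈ den I P}
  | .par P Q => den I P ∩ den I Q
  | .loc xs P => Exists' xs (den I P)
  | .nxt P => {s | (fun n => s (n + 1)) ∈ den I P}
  | .unl c P => {s | (¬ c ≤ s 0 ∧ (fun n => s (n + 1)) ∈ den I P) ∨ c ≤ s 0}
  | .call p ts => I p ts
  | .bang P => {s | ∀ k, (fun n => s (n + k)) ∈ den I P}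

theorem Exists'.mono (xs : List V) {S T : Set (ℕ → C)} (h : S ⊆ T) :
    Exists' xs S ⊆ Exists' xs T := by
  rintro s ⟨s', hs', hv⟩
  exact ⟨s', h hs', hv⟩

theorem Forall'.mono (xs : List V) {S T : Set (ℕ → C)} (h : S ⊆ T) :
    Forall' xs S ⊆ Forall' xs T := by
  rintro e ⟨he, ys, s, hes, hs, hall⟩
  exact ⟨h he, ys, s, hes, h hs, fun s' ts h1 h2 h3 => h (hall s' ts h1 h2 h3)⟩

theorem den_mono {I J : Interp L V C N} (h : I ≤ J) (P : Proc L V C N) : den I P ⊆ den J P := by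
  induction P with
  | skip => exact subset_rfl
  | tell c => exact subset_rfl
  | abs xs c E P ih => exact Forall'.mono xs fun s hs hc => ih (hs hc)
  | par P Q ihP ihQ => exact Set.inter_subset_inter ihP ihQ
  | loc xs P ih => exact Exists'.mono xs ih
  | nxt P ih => exact fun s hs => ih hs
  | unl c P ih => exact fun s hs => hs.imp (fun h => ⟨h.1, ih h.2⟩) id
  | call p ts => exact h p ts
  | bang P ih => exact fun s hs k => ih (hs k)

/-- The immediate consequence operator: a call `p(ts)` is interpreted as the denotation of
`Q[ts/xs]`, where `p(xs) = Q` is the declaration of `p` with its formal parameters renamed so that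
the substitution is admissible. -/
def consequence (D : N → Decl L V C N) : Interp L V C N →o Interp L V C N where
  toFun I p ts := {s | ∃ ε, (D p).Alpha ε ∧ Adm ε.formals ts ∧
    s ∈ den I (ε.body.subst ε.formals ts)}
  monotone' := by
    rintro I J h p ts s ⟨ε, hε, ha, hs⟩
    exact ⟨ε, hε, ha, den_mono h _ hs⟩

/-- The denotation of the program `D.P`.  Interpretations are ordered by reverse inclusion, so that
the least fixpoint in this order is the greatest one for inclusion. -/
def semantics (D : N → Decl L V C N) (P : Proc L V C N) : Set (ℕ → C) :=
  den (OrderHom.gfp (consequence D)) P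

end Programs

end UTCC

namespace UTCC

open ConstraintSystem FirstOrder.Language

section Algebra

variable {L : FirstOrder.Language.{u, v}} {V : Type} {C : Type w} [DecidableEq V]

/-! ### Renaming of variables in terms -/

/-! Consider one time unit that comes to rest with local variables `xs` and store `d`. The execution
carries along a sequence `s` that is accepted by the current process, agrees with `w` outside the
local variables, and whose first element entails the store. Stores only grow, so at rest `w 0 ≤ ∃xs
d ≤ ∃xs (s 0) = ∃xs (w 0) ≤ w 0`, which says that output and input coincide. Moreover the tail of
`w` is accepted by the residual process, and induction over time units yields both parts. Three
obstacles shape the argument.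

Parametric asks. An ask with a nonempty list of parameters that has fired never comes to rest.
Firing leaves behind a local copy of the parameters for which the guard holds; once opened, these
local variables are a new admissible tuple. An earlier tuple can block it only if `ys = us` entails
`ys = zs` with `zs` foreign to `us`, and this forces all cylindrifications to be trivial
(`degenerate_of_eqns_le`). Hence in a terminating time unit only asks without parameters fire, and
`den` may be enlarged to `weakDen`, which constrains no others. If cylindrification is trivial, all
the equations involved are `true` and every ask is sound as if it had no parameters. This is carried
by `Step.restless` and `Proc.Restless.exists_step`.

Calls. The fixpoint is replaced by its approximations `approx D n`, in which formal and actual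
parameters are linked through fresh variables. They are tame, so that `weakDen` depends only on free
variables and respects structural congruence. Each internal transition spends one level; acceptance
is therefore required at all levels, with a sequence `s` that may depend on the level.

`unless`. Its denotation asks nothing of the future when the guard is entailed by `s 0`, while the
execution consults the store, which may know less than `s 0` about local variables. The locals are
therefore split into `us`, on which components with `unless` do not depend, and variables defined by
a triangular system of equations that is told for ever. Locals written in the program, and those
opened from the store, go into `us` or are split as prescribed by `Independent`; those created by a
call are defined by the parameter equations. The invariant is that `∃us (s 0)` is entailed by the
store together with what the process is still bound to tell now. At rest nothing is left to tell, so
`s 0` and the store agree on the guards of `unless` (`tail_mem_weakDen_future`). The splitting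
passes to the residual process `(local xs) F`; syntactic local independence would not, which is why
`Independent` is semantic. -/

theorem vrename_self (x y : V) : vrename x y x = y := if_pos rfl

theorem vrename_of_ne {x y z : V} (h : z ≠ x) : vrename x y z = z := if_neg h

theorem vrename_ne {x y : V} (h : x ≠ y) (z : V) : vrename x y z ≠ x := by
  unfold vrename; split_ifs with h1
  · exact h.symm
  · exact h1

theorem vrename_inj {x y a b : V} (ha : a ≠ y) (hb : b ≠ y)
    (h : vrename x y a = vrename x y b) : a = b := by
  unfold vrename at h; split_ifs at h <;> simp_all

theorem vrename_vrename {x y z : V} (h : z ≠ y) : vrename y x (vrename x y z) = z := by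
  unfold vrename; split_ifs <;> simp_all

theorem map_vrename_vrename {x y : V} {xs : List V} (h : y ∉ xs) :
    (xs.map (vrename x y)).map (vrename y x) = xs := by
  rw [List.map_map]
  conv_rhs => rw [← List.map_id xs]
  exact List.map_congr_left fun a ha => vrename_vrename fun e => h (e ▸ ha)

theorem notMem_map_vrename {x y : V} (h : x ≠ y) (xs : List V) : x ∉ xs.map (vrename x y) := by
  rw [List.mem_map]; rintro ⟨z, -, hz⟩; exact vrename_ne h z hz

theorem mem_map_vrename_of_ne {x y z : V} {xs : List V} (hz : z ∈ xs) (h : z ≠ x) :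
    z ∈ xs.map (vrename x y) := List.mem_map.2 ⟨z, hz, vrename_of_ne h⟩

theorem mem_map_vrename {x y : V} {xs : List V} (hx : x ∈ xs) :
    y ∈ xs.map (vrename x y) := List.mem_map.2 ⟨x, hx, vrename_self x y⟩

theorem mem_of_mem_map_vrename {x y z : V} {xs : List V} (h : z ∈ xs.map (vrename x y)) :
    z = y ∨ z ∈ xs := by
  obtain ⟨a, ha, rfl⟩ := List.mem_map.1 h
  unfold vrename; split_ifs
  · exact Or.inl rfl
  · exact Or.inr ha

theorem map_vrename_of_notMem {x y : V} {xs : List V} (h : x ∉ xs) :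
    xs.map (vrename x y) = xs := by
  conv_rhs => rw [← List.map_id xs]
  exact List.map_congr_left fun a ha => vrename_of_ne fun e => h (e ▸ ha)

theorem mem_varFinset_relabel {f : V → V} {t : L.Term V} {z : V} :
    z ∈ (t.relabel f).varFinset ↔ ∃ a ∈ t.varFinset, f a = z := by
  induction t with
  | var a => simp [Term.relabel, Term.varFinset, eq_comm]
  | func g ts ih => simp only [Term.relabel, Term.varFinset, Finset.mem_biUnion, ih]; aesop

theorem relabel_eq_self {f : V → V} {t : L.Term V} (h : ∀ a ∈ t.varFinset, f a = a) :
    t.relabel f = t := by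
  induction t with
  | var a => simp_all [Term.relabel, Term.varFinset]
  | func g ts ih =>
    simp only [Term.relabel]
    congr 1
    funext i
    exact ih i fun a ha => h a (Finset.mem_biUnion.2 ⟨i, Finset.mem_univ _, ha⟩)

theorem relabel_vrename_vrename {x y : V} {t : L.Term V} (h : y ∉ t.varFinset) :
    (t.relabel (vrename x y)).relabel (vrename y x) = t := by
  rw [Term.relabel_relabel]
  exact relabel_eq_self fun a ha => vrename_vrename fun e => h (e ▸ ha)

theorem notMem_relabel_vrename {x y : V} (h : x ≠ y) (t : L.Term V) :
    x ∉ (t.relabel (vrename x y)).varFinset := by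
  rw [mem_varFinset_relabel]; rintro ⟨a, -, ha⟩; exact vrename_ne h a ha

theorem notMem_termVars_cons {z : V} {t : L.Term V} {ts : List (L.Term V)} :
    z ∉ termVars (t :: ts) ↔ z ∉ t.varFinset ∧ z ∉ termVars ts := by
  simp [termVars]

theorem mem_termVars_map_var {z : V} {zs : List V} :
    z ∈ termVars (zs.map (Term.var : V → L.Term V)) ↔ z ∈ zs := by
  simp [termVars, Term.varFinset]

theorem mem_termVars_trename {x y z : V} {ts : List (L.Term V)} :
    z ∈ termVars (trename x y ts) ↔ ∃ a ∈ termVars ts, vrename x y a = z := by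
  simp only [termVars, trename, List.mem_map, Set.mem_ofPred_eq, exists_exists_and_eq_and,
    mem_varFinset_relabel]
  aesop

theorem trename_of_notMem {x y : V} {ts : List (L.Term V)} (h : x ∉ termVars ts) :
    trename x y ts = ts := by
  induction ts with
  | nil => rfl
  | cons t ts ih =>
    rw [notMem_termVars_cons] at h
    simp only [trename, List.map_cons, List.cons.injEq] at ih ⊢
    exact ⟨relabel_eq_self fun a ha => vrename_of_ne fun e => h.1 (e ▸ ha), ih h.2⟩

theorem termVars_finite (ts : List (L.Term V)) : (termVars ts).Finite := by
  have : termVars ts = ⋃ t ∈ {t | t ∈ ts}, (t.varFinset : Set V) := by ext; simp [termVars]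
  rw [this]
  exact (List.finite_toSet ts).biUnion fun t _ => Finset.finite_toSet _

variable [ConstraintSystem L V C]

/-! ### Cylindrification -/

theorem notMem_cfv {x : V} {c : C} : x ∉ cfv c ↔ ex x c = c := by simp [cfv]

theorem ex_bot (x : V) : ex x (⊥ : C) = ⊥ := le_bot_iff.1 (ex_le x ⊥)

theorem ex_ex_self (x : V) (c : C) : ex x (ex x c) = ex x c := by
  simpa [ex_bot] using ex_sup_ex x (⊥ : C) c

theorem notMem_cfv_ex_self (x : V) (c : C) : x ∉ cfv (ex x c) := notMem_cfv.2 (ex_ex_self x c)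

theorem notMem_cfv_ex {z : V} (x : V) {c : C} (h : z ∉ cfv c) : z ∉ cfv (ex x c) := by
  rw [notMem_cfv] at *; rw [ex_comm, h]

theorem ex_sup_of_notMem {x : V} (c : C) {d : C} (h : x ∉ cfv d) :
    ex x (c ⊔ d) = ex x c ⊔ d := by
  rw [notMem_cfv] at h
  conv_lhs => rw [← h]
  rw [ex_sup_ex, h]

theorem notMem_cfv_sup {x : V} {c d : C} (hc : x ∉ cfv c) (hd : x ∉ cfv d) :
    x ∉ cfv (c ⊔ d) := by
  rw [notMem_cfv, ex_sup_of_notMem c hd, notMem_cfv.1 hc]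

theorem notMem_cfv_bot (x : V) : x ∉ cfv (⊥ : C) := notMem_cfv.2 (ex_bot x)

theorem exs_nil (c : C) : exs [] c = c := rfl

theorem exs_cons (x : V) (xs : List V) (c : C) : exs (x :: xs) c = ex x (exs xs c) := rfl

theorem exs_append (xs ys : List V) (c : C) : exs (xs ++ ys) c = exs xs (exs ys c) := by
  simp [exs, List.foldr_append]

theorem exs_le (xs : List V) (c : C) : exs xs c ≤ c := by
  induction xs with
  | nil => exact le_rfl
  | cons x xs ih => exact (ex_le _ _).trans ih

theorem exs_mono (xs : List V) {c d : C} (h : c ≤ d) : exs xs c ≤ exs xs d := by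
  induction xs with
  | nil => exact h
  | cons x xs ih => exact ex_mono _ _ _ ih

theorem ex_exs_comm (x : V) (xs : List V) (c : C) : ex x (exs xs c) = exs xs (ex x c) := by
  induction xs with
  | nil => rfl
  | cons y xs ih => rw [exs_cons, exs_cons, ex_comm, ih]

theorem exs_comm (xs ys : List V) (c : C) : exs xs (exs ys c) = exs ys (exs xs c) := by
  induction xs with
  | nil => rfl
  | cons y xs ih => rw [exs_cons, exs_cons, ih, ex_exs_comm]

theorem notMem_cfv_exs {z : V} (xs : List V) {c : C} (h : z ∉ cfv c) : z ∉ cfv (exs xs c) := by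
  induction xs with
  | nil => exact h
  | cons y xs ih => exact notMem_cfv_ex _ ih

theorem notMem_cfv_exs_of_mem {z : V} {xs : List V} (c : C) (h : z ∈ xs) :
    z ∉ cfv (exs xs c) := by
  induction xs with
  | nil => simp at h
  | cons y xs ih =>
    rcases List.mem_cons.1 h with rfl | h
    · exact notMem_cfv_ex_self _ _
    · exact notMem_cfv_ex _ (ih h)

theorem exs_of_notMem {xs : List V} {c : C} (h : ∀ x ∈ xs, x ∉ cfv c) : exs xs c = c := by
  induction xs with
  | nil => rfl
  | cons y xs ih =>
    rw [exs_cons, ih fun x hx => h x (List.mem_cons_of_mem _ hx),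
      notMem_cfv.1 (h y List.mem_cons_self)]

theorem exs_bot (xs : List V) : exs xs (⊥ : C) = ⊥ := exs_of_notMem fun x _ => notMem_cfv_bot x

theorem exs_exs_of_subset {xs ys : List V} (h : xs ⊆ ys) (c : C) :
    exs xs (exs ys c) = exs ys c :=
  exs_of_notMem fun _ hx => notMem_cfv_exs_of_mem _ (h hx)

theorem exs_exs_of_subset' {xs ys : List V} (h : xs ⊆ ys) (c : C) :
    exs ys (exs xs c) = exs ys c := by rw [exs_comm, exs_exs_of_subset h]

theorem exs_exs_self (xs : List V) (c : C) : exs xs (exs xs c) = exs xs c :=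
  exs_exs_of_subset (List.Subset.refl _) c

theorem exs_le_exs_of_subset {xs ys : List V} (h : xs ⊆ ys) (c : C) : exs ys c ≤ exs xs c := by
  rw [← exs_exs_of_subset' h]; exact exs_le _ _

theorem exs_eq_exs {xs ys : List V} (h : xs ⊆ ys) (h' : ys ⊆ xs) (c : C) :
    exs xs c = exs ys c :=
  le_antisymm (exs_le_exs_of_subset h' c) (exs_le_exs_of_subset h c)

theorem exs_sup_of_notMem {xs : List V} (c : C) {d : C} (h : ∀ x ∈ xs, x ∉ cfv d) :
    exs xs (c ⊔ d) = exs xs c ⊔ d := by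
  induction xs with
  | nil => rfl
  | cons y xs ih =>
    rw [exs_cons, ih fun x hx => h x (List.mem_cons_of_mem _ hx),
      ex_sup_of_notMem _ (h y List.mem_cons_self), exs_cons]

theorem exs_sup_of_notMem' {xs : List V} {c : C} (d : C) (h : ∀ x ∈ xs, x ∉ cfv c) :
    exs xs (c ⊔ d) = c ⊔ exs xs d := by
  rw [sup_comm, exs_sup_of_notMem d h, sup_comm]

/-! ### Equations -/

/-- By transitivity through `z`, the equation is itself of the form `∃z …`. -/
theorem notMem_cfv_eqn {x z : V} {t : L.Term V} (hx : z ≠ x) (ht : z ∉ t.varFinset) :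
    z ∉ cfv (eqn x t : C) := by
  rw [eqn_trans x z t hx ht]; exact notMem_cfv_ex_self _ _

theorem eqn_trans_le {x z : V} {t : L.Term V} (hx : z ≠ x) (ht : z ∉ t.varFinset) :
    (eqn x t : C) ≤ eqn x (Term.var z) ⊔ eqn z t := by
  rw [eqn_trans x z t hx ht]; exact ex_le _ _

theorem eqn_euclid_le {x z : V} {t : L.Term V} (hx : z ≠ x) (ht : z ∉ t.varFinset) :
    (eqn x (Term.var z) : C) ≤ eqn z t ⊔ eqn x t := by
  conv_rhs => rw [eqn_trans x z t hx ht]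
  exact eqn_subst z t _ ht

/-- Symmetry is not an axiom. `eqn_subst` is applied to the constraint `b = a`; the quantified
remainder `∃a (b = a ⊔ a = b)` is `b = b` by transitivity, hence trivial. -/
theorem eqn_symm (x y : V) : (eqn x (Term.var y) : C) = eqn y (Term.var x) := by
  by_cases h : x = y
  · rw [h]
  have key : ∀ a b : V, a ≠ b → (eqn b (Term.var a) : C) ≤ eqn a (Term.var b) := by
    intro a b hab
    have h1 : a ∉ (Term.var b : L.Term V).varFinset := by simpa [Term.varFinset] using hab
    have := eqn_subst a (Term.var b) (eqn b (Term.var a) : C) h1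
    rwa [← eqn_trans b a _ hab h1, eqn_self, sup_bot_eq] at this
  exact le_antisymm (key y x (Ne.symm h)) (key x y h)

theorem eqns_nil_right (xs : List V) : (eqns xs ([] : List (L.Term V)) : C) = ⊥ := by
  cases xs <;> rfl

theorem eqns_cons (x : V) (xs : List V) (t : L.Term V) (ts : List (L.Term V)) :
    (eqns (x :: xs) (t :: ts) : C) = eqn x t ⊔ eqns xs ts := rfl

theorem notMem_cfv_eqns {z : V} {xs : List V} {ts : List (L.Term V)} (hx : z ∉ xs)
    (ht : z ∉ termVars ts) : z ∉ cfv (eqns xs ts : C) := by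
  induction xs generalizing ts with
  | nil => exact notMem_cfv_bot z
  | cons x xs ih =>
    cases ts with
    | nil => exact notMem_cfv_bot z
    | cons t ts =>
      rw [notMem_termVars_cons] at ht
      rw [List.mem_cons, not_or] at hx
      exact notMem_cfv_sup (notMem_cfv_eqn hx.1 ht.1) (ih hx.2 ht.2)

theorem cfv_eqns_subset (xs : List V) (ts : List (L.Term V)) :
    cfv (eqns xs ts : C) ⊆ {x | x ∈ xs} ∪ termVars ts := by
  intro z hz
  by_contra h
  simp only [Set.mem_union, Set.mem_ofPred_eq, not_or] at h
  exact notMem_cfv_eqns h.1 h.2 hz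

theorem exs_eqns {xs : List V} {ts : List (L.Term V)} (hn : xs.Nodup)
    (h : ∀ x ∈ xs, x ∉ termVars ts) : exs xs (eqns xs ts : C) = ⊥ := by
  induction xs generalizing ts with
  | nil => rfl
  | cons x xs ih =>
    cases ts with
    | nil => exact exs_bot _
    | cons t ts =>
      rw [List.nodup_cons] at hn
      have h1 := notMem_termVars_cons.1 (h x List.mem_cons_self)
      have h2 : ∀ y ∈ xs, y ∉ t.varFinset ∧ y ∉ termVars ts := fun y hy =>
        notMem_termVars_cons.1 (h y (List.mem_cons_of_mem _ hy))
      rw [eqns_cons, exs_cons, exs_sup_of_notMem' _ fun y hy => notMem_cfv_eqn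
        (ne_of_mem_of_not_mem hy hn.1) (h2 y hy).1, ih hn.2 fun y hy => (h2 y hy).2, sup_bot_eq,
        ex_eqn _ _ h1.1]

/-- A system of equations in triangular form determines its left-hand sides. -/
theorem le_sup_exs_of_triangular {E : List (V × L.Term V)} {a e : C}
    (h1 : ∀ p ∈ E, p.1 ∉ p.2.varFinset ∧ (eqn p.1 p.2 : C) ≤ e ∧ (eqn p.1 p.2 : C) ≤ a)
    (h2 : E.Pairwise fun p q => q.1 ∉ p.2.varFinset) : a ≤ e ⊔ exs (E.map Prod.fst) a := by
  induction E with
  | nil => exact le_sup_right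
  | cons p E ih =>
    rw [List.pairwise_cons] at h2
    have h3 := ih (fun q hq => h1 q (List.mem_cons_of_mem _ hq)) h2.2
    obtain ⟨hp, hpe, hpa⟩ := h1 p List.mem_cons_self
    refine h3.trans (sup_le le_sup_left ?_)
    rw [List.map_cons, exs_cons]
    by_cases hm : p.1 ∈ E.map Prod.fst
    · rw [notMem_cfv.1 (notMem_cfv_exs_of_mem _ hm)]; exact le_sup_right
    -- The head equation survives quantification over the remaining left-hand sides, none of which
    -- occurs in it, so `eqn_subst` can undo `∃ p.1`.
    · have h4 : (eqn p.1 p.2 : C) ≤ exs (E.map Prod.fst) a := by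
        rw [← exs_of_notMem (xs := E.map Prod.fst) (c := (eqn p.1 p.2 : C))]
        · exact exs_mono _ hpa
        · intro z hz
          obtain ⟨q, hq, rfl⟩ := List.mem_map.1 hz
          exact notMem_cfv_eqn (fun e => hm (e ▸ hz)) (h2.1 q hq)
      have := eqn_subst p.1 p.2 (exs (E.map Prod.fst) a) hp
      rw [sup_eq_left.2 h4] at this
      exact this.trans (sup_le_sup_right hpe _)

theorem eqn_le_eqns {xs : List V} {ts : List (L.Term V)} {p : V × L.Term V}
    (hp : p ∈ xs.zip ts) : (eqn p.1 p.2 : C) ≤ eqns xs ts := by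
  induction xs generalizing ts with
  | nil => simp at hp
  | cons x xs ih =>
    cases ts with
    | nil => simp at hp
    | cons t ts =>
      rw [List.zip_cons_cons, List.mem_cons] at hp
      rcases hp with rfl | hp
      · exact le_sup_left
      · exact (ih hp).trans le_sup_right

theorem notMem_of_mem_zip {xs : List V} {ts : List (L.Term V)} (h : Adm xs ts)
    {p : V × L.Term V} (hp : p ∈ xs.zip ts) {x : V} (hx : x ∈ xs) : x ∉ p.2.varFinset :=
  fun hm => h.2 x hx ⟨p.2, (List.of_mem_zip (a := p.1) (b := p.2) hp).2, hm⟩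

/-- For admissible terms every ordering is triangular, because no left-hand side occurs in any of
the terms; `xs` need not be distinct. -/
theorem le_eqns_sup_exs {xs : List V} {ts : List (L.Term V)} (h : Adm xs ts) {a : C}
    (ha : eqns xs ts ≤ a) : a ≤ eqns xs ts ⊔ exs xs a := by
  have := le_sup_exs_of_triangular (E := xs.zip ts) (a := a) (e := eqns xs ts)
    (fun p hp => ⟨notMem_of_mem_zip h hp (List.of_mem_zip (a := p.1) (b := p.2) hp).1, eqn_le_eqns hp,
      (eqn_le_eqns hp).trans ha⟩)
    (List.Pairwise.imp_of_mem (R := fun _ _ => True)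
      (fun {p q} hp hq _ => notMem_of_mem_zip h hp (List.of_mem_zip (a := q.1) (b := q.2) hq).1)
      (List.pairwise_of_forall fun _ _ => trivial))
  rwa [List.map_fst_zip h.1.le] at this

theorem eq_eqns_sup_exs {xs : List V} {ts : List (L.Term V)} (h : Adm xs ts) {a : C}
    (ha : eqns xs ts ≤ a) : a = exs xs a ⊔ eqns xs ts :=
  le_antisymm ((le_eqns_sup_exs h ha).trans_eq (sup_comm _ _)) (sup_le (exs_le _ _) ha)

theorem exs_sup_eqns {xs : List V} {ts : List (L.Term V)} (hn : xs.Nodup) (h : Adm xs ts) (a : C) :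
    exs xs (exs xs a ⊔ eqns xs ts) = exs xs a := by
  rw [exs_sup_of_notMem' _ fun x hx => notMem_cfv_exs_of_mem _ hx, exs_eqns hn h.2, sup_bot_eq]

/-! ### Renaming of constraints -/

theorem crename_def (x y : V) (c : C) : crename x y c = ex x (c ⊔ eqn x (Term.var y)) := by
  simp [crename, csubst, eqns, exs]

theorem ex_eqn_var {x y : V} (h : x ≠ y) : ex x (eqn x (Term.var y) : C) = ⊥ :=
  ex_eqn _ _ (by simpa [Term.varFinset] using h)

theorem ex_eqn_var' {x y : V} (h : x ≠ y) : ex y (eqn x (Term.var y) : C) = ⊥ := by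
  rw [eqn_symm]; exact ex_eqn_var h.symm

theorem notMem_cfv_eqn_var {x y z : V} (hx : z ≠ x) (hy : z ≠ y) :
    z ∉ cfv (eqn x (Term.var y) : C) :=
  notMem_cfv_eqn hx (by simpa [Term.varFinset] using hy)

theorem crename_of_notMem {x y : V} (h : x ≠ y) {c : C} (hc : x ∉ cfv c) :
    crename x y c = c := by
  rw [crename_def, sup_comm, ex_sup_of_notMem _ hc, ex_eqn_var h, bot_sup_eq]

theorem notMem_cfv_crename (x y : V) (c : C) : x ∉ cfv (crename x y c) := by
  rw [crename_def]; exact notMem_cfv_ex_self _ _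

theorem crename_mono (x y : V) {c d : C} (h : c ≤ d) : crename x y c ≤ crename x y d := by
  rw [crename_def, crename_def]; exact ex_mono _ _ _ (sup_le_sup_right h _)

theorem crename_bot {x y : V} (h : x ≠ y) : crename x y (⊥ : C) = ⊥ :=
  crename_of_notMem h (notMem_cfv_bot x)

theorem le_crename_sup {x y : V} (h : x ≠ y) (c : C) :
    c ≤ crename x y c ⊔ eqn x (Term.var y) := by
  rw [crename_def, sup_comm]
  exact eqn_subst _ _ _ (by simpa [Term.varFinset] using h)

theorem crename_le_sup (x y : V) (c : C) : crename x y c ≤ c ⊔ eqn x (Term.var y) := by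
  rw [crename_def]; exact ex_le _ _

/-- Quantification alone does not distribute over joins. Given `x = y`, however, a constraint and
its renaming entail each other, and `x` is not free in the renamed constraints. -/
theorem crename_sup {x y : V} (h : x ≠ y) (c d : C) :
    crename x y (c ⊔ d) = crename x y c ⊔ crename x y d := by
  refine le_antisymm ?_ (sup_le (crename_mono _ _ le_sup_left) (crename_mono _ _ le_sup_right))
  have h1 : c ⊔ d ⊔ eqn x (Term.var y) ≤
      eqn x (Term.var y) ⊔ (crename x y c ⊔ crename x y d) := by
    refine sup_le (sup_le ?_ ?_) le_sup_left
    · exact (le_crename_sup h c).trans (sup_le (le_sup_left.trans le_sup_right) le_sup_left)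
    · exact (le_crename_sup h d).trans (sup_le (le_sup_right.trans le_sup_right) le_sup_left)
  have h2 := ex_mono x _ _ h1
  rw [ex_sup_of_notMem _ (notMem_cfv_sup (notMem_cfv_crename x y c) (notMem_cfv_crename x y d)),
    ex_eqn_var h, bot_sup_eq] at h2
  rwa [crename_def]

theorem crename_crename {x y : V} (h : x ≠ y) {c : C} (hc : y ∉ cfv c) :
    crename y x (crename x y c) = c := by
  apply le_antisymm
  · have h1 : crename x y c ⊔ eqn y (Term.var x) ≤ eqn y (Term.var x) ⊔ c := by
      refine sup_le ?_ le_sup_left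
      rw [eqn_symm y x, sup_comm]
      exact crename_le_sup x y c
    have h2 := ex_mono y _ _ h1
    rwa [ex_sup_of_notMem _ hc, ex_eqn_var h.symm, bot_sup_eq, ← crename_def] at h2
  · have h1 := ex_mono y _ _ (le_crename_sup h c)
    rwa [notMem_cfv.1 hc, eqn_symm, ← crename_def] at h1

theorem crename_ex {x y z : V} (hx : z ≠ x) (hy : z ≠ y) (c : C) :
    crename x y (ex z c) = ex z (crename x y c) := by
  rw [crename_def, crename_def, ex_comm, ex_sup_of_notMem _ (notMem_cfv_eqn_var hx hy)]

theorem crename_exs {x y : V} {zs : List V} (hx : x ∉ zs) (hy : y ∉ zs) (c : C) :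
    crename x y (exs zs c) = exs zs (crename x y c) := by
  induction zs with
  | nil => rfl
  | cons z zs ih =>
    simp only [List.mem_cons, not_or] at hx hy
    rw [exs_cons, crename_ex (Ne.symm hx.1) (Ne.symm hy.1), ih hx.2 hy.2, exs_cons]

theorem notMem_cfv_crename_of_ne {x y z : V} (hy : z ≠ y) {c : C} (h : z ∉ cfv c) :
    z ∉ cfv (crename x y c) := by
  by_cases hx : z = x
  · rw [hx]; exact notMem_cfv_crename x y c
  · rw [crename_def]; exact notMem_cfv_ex _ (notMem_cfv_sup h (notMem_cfv_eqn_var hx hy))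

/-- Conversion of bound variables: both sides arise from `c ⊔ x = y` by quantifying the same set of
variables, namely `xs` together with `y`. -/
theorem exs_map_crename {x y : V} {xs : List V} (hx : x ∈ xs) (hy : y ∉ xs) {c : C}
    (hc : y ∉ cfv c) : exs (xs.map (vrename x y)) (crename x y c) = exs xs c := by
  have hxy : x ≠ y := fun e => hy (e ▸ hx)
  have h1 : exs (xs.map (vrename x y) ++ [x]) (c ⊔ eqn x (Term.var y)) =
      exs (xs ++ [y]) (c ⊔ eqn x (Term.var y)) := by
    apply exs_eq_exs
    · intro z hz
      rw [List.mem_append, List.mem_singleton] at hz ⊢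
      rcases hz with hz | rfl
      · exact (mem_of_mem_map_vrename hz).symm
      · exact Or.inl hx
    · intro z hz
      rw [List.mem_append, List.mem_singleton] at hz ⊢
      rcases hz with hz | rfl
      · by_cases e : z = x
        · exact Or.inr e
        · exact Or.inl (mem_map_vrename_of_ne hz e)
      · exact Or.inl (mem_map_vrename hx)
  rw [exs_append, exs_append, exs_cons, exs_cons, exs_nil, ← crename_def,
    sup_comm c, ex_sup_of_notMem _ hc, ex_eqn_var' hxy, bot_sup_eq] at h1
  exact h1

theorem cfv_crename_subset {x y : V} (h : x ≠ y) {c : C} (hc : y ∉ cfv c) :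
    cfv (crename x y c) ⊆ vrename x y '' cfv c := by
  intro z hz
  by_cases hzy : z = y
  · subst hzy
    refine ⟨x, by_contra fun hx => ?_, vrename_self _ _⟩
    rw [crename_of_notMem h hx] at hz
    exact hc hz
  · exact ⟨z, by_contra fun hx => notMem_cfv_crename_of_ne hzy hx hz,
      vrename_of_ne fun e => notMem_cfv_crename x y c (e ▸ hz)⟩

theorem image_vrename_image_vrename {x y : V} {s : Set V} (h : y ∉ s) :
    vrename y x '' (vrename x y '' s) = s := by
  ext z
  simp only [Set.mem_image, exists_exists_and_eq_and]
  constructor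
  · rintro ⟨a, ha, rfl⟩; rwa [vrename_vrename (ne_of_mem_of_not_mem ha h)]
  · exact fun hz => ⟨z, hz, vrename_vrename (ne_of_mem_of_not_mem hz h)⟩

theorem cfv_crename {x y : V} (h : x ≠ y) {c : C} (hc : y ∉ cfv c) :
    cfv (crename x y c) = vrename x y '' cfv c := by
  refine (cfv_crename_subset h hc).antisymm ?_
  have h1 := cfv_crename_subset h.symm (notMem_cfv_crename x y c)
  rw [crename_crename h hc] at h1
  rw [← image_vrename_image_vrename (notMem_cfv_crename x y c)]
  exact Set.image_mono h1

/-- If `x` is the left-hand side, this is transitivity through `x`. Otherwise the two equations are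
equivalent given `x = y`, by `eqn_congr` in both directions, and quantifying `x` removes `x = y`. -/
theorem crename_eqn {x y z : V} {t : L.Term V} (h : x ≠ y) (ht : y ∉ t.varFinset)
    (hzx : z = x → x ∉ t.varFinset) :
    crename x y (eqn z t : C) = eqn (vrename x y z) (t.relabel (vrename x y)) := by
  by_cases e : z = x
  · subst e
    have hx := hzx rfl
    rw [vrename_self, relabel_eq_self fun a ha => vrename_of_ne (ne_of_mem_of_not_mem ha hx),
      eqn_trans y z t h hx, crename_def, sup_comm, eqn_symm]
  · rw [vrename_of_ne e, crename_def]
    have h1 : (eqn z (t.relabel (vrename x y)) : C) ≤ eqn x (Term.var y) ⊔ eqn z t :=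
      eqn_congr x y z t
    have h2 : (eqn z t : C) ≤ eqn x (Term.var y) ⊔ eqn z (t.relabel (vrename x y)) := by
      have := eqn_congr (C := C) y x z (t.relabel (vrename x y))
      change eqn z ((t.relabel (vrename x y)).relabel (vrename y x)) ≤ _ at this
      rwa [relabel_vrename_vrename ht, eqn_symm y x] at this
    have h3 : x ∉ cfv (eqn z (t.relabel (vrename x y)) : C) :=
      notMem_cfv_eqn (Ne.symm e) (notMem_relabel_vrename h t)
    apply le_antisymm
    · have := ex_mono x _ _ (sup_le h2 le_sup_left)
      rwa [ex_sup_of_notMem _ h3, ex_eqn_var h, bot_sup_eq] at this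
    · have := ex_mono x _ _ h1
      rwa [notMem_cfv.1 h3, sup_comm] at this

theorem crename_eqns {x y : V} {xs : List V} {ts : List (L.Term V)} (h : x ≠ y) (hy : y ∉ xs)
    (ht : y ∉ termVars ts) (hx : x ∈ xs → x ∉ termVars ts) :
    crename x y (eqns xs ts : C) = eqns (xs.map (vrename x y)) (trename x y ts) := by
  induction xs generalizing ts with
  | nil => exact crename_bot h
  | cons z xs ih =>
    cases ts with
    | nil => exact crename_bot h
    | cons t ts =>
      rw [notMem_termVars_cons] at ht
      simp only [List.mem_cons, not_or] at hy
      rw [eqns_cons, crename_sup h, crename_eqn h ht.1, ih hy.2 ht.2]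
      · rfl
      · exact fun hm => (notMem_termVars_cons.1 (hx (List.mem_cons_of_mem _ hm))).2
      · exact fun e => (notMem_termVars_cons.1 (hx (e ▸ List.mem_cons_self))).1

theorem trename_map_var_of_notMem {x y : V} {zs : List V} (h : x ∉ zs) :
    trename x y (zs.map (Term.var : V → L.Term V)) = zs.map Term.var :=
  trename_of_notMem fun hx => h (mem_termVars_map_var.1 hx)

/-- For `y` not free in the result: `c` with `x` forgotten and then `y` renamed to `x`. -/
def swapTo (x y : V) (c : C) : C := crename y x (ex x c)

theorem notMem_cfv_swapTo (x y : V) (c : C) : y ∉ cfv (swapTo x y c) := notMem_cfv_crename _ _ _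

theorem crename_swapTo {x y : V} (h : x ≠ y) (c : C) : crename x y (swapTo x y c) = ex x c :=
  crename_crename h.symm (notMem_cfv_ex_self x c)

/-- An adjunction: it moves a renaming from the guards and told constraints of a process to the
sequence that is tested against them. -/
theorem crename_le_iff {x y : V} (h : x ≠ y) {c : C} (hc : y ∉ cfv c) (d : C) :
    crename x y c ≤ d ↔ c ≤ swapTo x y d := by
  constructor
  · intro hd
    have := crename_mono y x (ex_mono x _ _ hd)
    rwa [notMem_cfv.1 (notMem_cfv_crename x y c), crename_crename h hc] at this
  · intro hd
    have := crename_mono x y hd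
    rw [crename_swapTo h] at this
    exact this.trans (ex_le _ _)

theorem swapTo_exs {x y : V} {zs : List V} (hx : x ∉ zs) (hy : y ∉ zs) (c : C) :
    swapTo x y (exs zs c) = exs zs (swapTo x y c) := by
  rw [swapTo, ex_exs_comm, crename_exs hy hx, swapTo]

theorem ex_sup_eqn_var {x y : V} (h : x ≠ y) (c : C) :
    ex x (ex x c ⊔ eqn x (Term.var y)) = ex x (c : C) := by
  rw [sup_comm, ex_sup_ex, ex_eqn_var h, bot_sup_eq]

theorem ex_sup_eqn_var' (x y : V) (c : C) :
    ex y (ex x c ⊔ eqn x (Term.var y)) = swapTo x y (c : C) := by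
  rw [swapTo, crename_def, eqn_symm]

end Algebra

section Written

variable {L : FirstOrder.Language.{u, v}} {V : Type} {C : Type w} [DecidableEq V]
  [ConstraintSystem L V C]

/-! ### Written constraints -/

theorem Con.cfv_val_subset (a : Con V C) : cfv a.val ⊆ a.occ := by
  induction a with
  | base c => exact subset_rfl
  | join a b iha ihb =>
    intro z hz
    by_contra h
    simp only [Con.occ, Set.mem_union, not_or] at h
    exact notMem_cfv_sup (fun h' => h.1 (iha h')) (fun h' => h.2 (ihb h')) hz
  | ex x a ih =>
    intro z hz
    by_contra h
    simp only [Con.occ, Set.mem_insert_iff, not_or] at h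
    exact notMem_cfv_ex x (fun h' => h.2 (ih h')) hz

theorem Con.val_rename {x y : V} (h : x ≠ y) {a : Con V C} (hy : y ∉ a.occ) :
    (a.rename x y).val = crename x y a.val := by
  induction a with
  | base c => rfl
  | join a b iha ihb =>
    simp only [Con.occ, Set.mem_union, not_or] at hy
    simp only [Con.rename, Con.val, iha hy.1, ihb hy.2, crename_sup h]
  | ex z a ih =>
    simp only [Con.occ, Set.mem_insert_iff, not_or] at hy
    simp only [Con.rename]
    split_ifs with hz
    · subst hz
      exact (crename_of_notMem h (notMem_cfv_ex_self _ _)).symm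
    · simp only [Con.val, ih hy.2, crename_ex hz (Ne.symm hy.1)]

theorem Con.Opens.val_eq {a b : Con V C} {ys : List V} (h : a.Opens ys b) :
    a.val = UTCC.exs ys b.val := by
  induction h with
  | base c => rfl
  | @join a b a' b' ys zs ha hb hd h1 h2 iha ihb =>
    have h3 : ∀ y ∈ ys, y ∉ cfv (UTCC.exs zs b'.val) := fun y hy =>
      notMem_cfv_exs _ fun h => h1 y hy (b'.cfv_val_subset h)
    simp only [Con.val]
    rw [exs_append, exs_sup_of_notMem' _ fun z hz h => h2 z hz (a'.cfv_val_subset h),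
      exs_sup_of_notMem _ h3, iha, ihb]
  | ex x a => rfl
  | @ex_rename x y a hyx hy =>
    have hya : y ∉ cfv a.val := fun h => hy (a.cfv_val_subset h)
    rw [Con.val_rename (Ne.symm hyx) hy]
    have := exs_map_crename (x := x) (y := y) (xs := [x]) (c := a.val) (by simp)
      (by simpa using hyx) hya
    simpa [vrename, UTCC.exs, Con.val] using this.symm

theorem Con.val_exs (xs : List V) (a : Con V C) : (a.exs xs).val = UTCC.exs xs a.val := by
  induction xs with
  | nil => rfl
  | cons x xs ih => exact congrArg (ConstraintSystem.ex x) ih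

theorem Con.occ_rename_subset {x y : V} (h : x ≠ y) (a : Con V C) (hy : y ∉ a.occ) :
    (a.rename x y).occ ⊆ a.occ ∪ {y} ∧ a.occ ⊆ (a.rename x y).occ ∪ {x} := by
  induction a with
  | base c =>
    simp only [Con.rename, Con.occ] at hy ⊢
    rw [cfv_crename h hy]
    constructor
    · rintro _ ⟨z, hz, rfl⟩
      unfold vrename; split_ifs
      · exact Or.inr rfl
      · exact Or.inl hz
    · intro z hz
      by_cases e : z = x
      · exact Or.inr e
      · exact Or.inl ⟨z, hz, vrename_of_ne e⟩
  | join a b iha ihb =>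
    simp only [Con.rename, Con.occ, Set.mem_union, not_or] at hy ⊢
    obtain ⟨h1, h2⟩ := iha hy.1
    obtain ⟨h3, h4⟩ := ihb hy.2
    constructor
    · rintro z (hz | hz)
      · exact (h1 hz).imp_left Or.inl
      · exact (h3 hz).imp_left Or.inr
    · rintro z (hz | hz)
      · exact (h2 hz).imp_left Or.inl
      · exact (h4 hz).imp_left Or.inr
  | ex z a ih =>
    simp only [Con.occ, Set.mem_insert_iff, not_or] at hy
    obtain ⟨h1, h2⟩ := ih hy.2
    simp only [Con.rename]
    split_ifs
    · exact ⟨Set.subset_union_left, Set.subset_union_left⟩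
    · constructor
      · rintro b (rfl | hb)
        · exact Or.inl (Or.inl rfl)
        · exact (h1 hb).imp_left Or.inr
      · rintro b (rfl | hb)
        · exact Or.inl (Or.inl rfl)
        · exact (h2 hb).imp_left Or.inr

variable (C) in
/-- The cylindrifications are trivial. -/
def Degenerate : Prop := ∀ (x : V) (c : C), ConstraintSystem.ex x c = c

theorem Degenerate.exs_eq (h : Degenerate C) (xs : List V) (c : C) : exs xs c = c :=
  exs_of_notMem fun x _ => notMem_cfv.2 (h x c)

theorem Degenerate.crename_eq (h : Degenerate C) {x y : V} (hxy : x ≠ y) (c : C) :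
    crename x y c = c := crename_of_notMem hxy (notMem_cfv.2 (h x c))

theorem Degenerate.swapTo_eq (h : Degenerate C) {x y : V} (hxy : x ≠ y) (c : C) :
    swapTo x y c = c := by rw [swapTo, h.crename_eq hxy.symm, h]

end Written

/-! ### Free variables of processes, told constraints, and the weak denotation under renaming -/

section Processes

variable {L : FirstOrder.Language.{u, v}} {V : Type} {C : Type w} {N : Type r} [DecidableEq V]
  [ConstraintSystem L V C]

namespace Proc

/-- The free variables of a process, apart from those of the tuples with which a parametric ask has
been executed already. -/
def pfv : Proc L V C N → Set V
  | skip => ∅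
  | tell c => cfv c.val
  | abs xs c _ P => (cfv c ∪ P.pfv) \ {x | x ∈ xs}
  | par P Q => P.pfv ∪ Q.pfv
  | loc xs P => P.pfv \ {x | x ∈ xs}
  | nxt P => P.pfv
  | unl c P => cfv c ∪ P.pfv
  | call _ ts => termVars ts
  | bang P => P.pfv

theorem pfv_subset_fv (P : Proc L V C N) : P.pfv ⊆ P.fv := by
  induction P with
  | skip => exact subset_rfl
  | tell c => exact subset_rfl
  | abs xs c E P ih =>
    exact (Set.sdiff_subset_sdiff_left (Set.union_subset_union_right _ ih)).trans
      Set.subset_union_left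
  | par P Q ihP ihQ => exact Set.union_subset_union ihP ihQ
  | loc xs P ih => exact Set.sdiff_subset_sdiff_left ih
  | nxt P ih => exact ih
  | unl c P ih => exact Set.union_subset_union_right _ ih
  | call p ts => exact subset_rfl
  | bang P ih => exact ih

theorem pfv_subset_occ (P : Proc L V C N) : P.pfv ⊆ P.occ := by
  induction P with
  | skip => exact subset_rfl
  | tell c => exact c.cfv_val_subset
  | abs xs c E P ih =>
    rintro z ⟨hz | hz, -⟩
    · exact Or.inl (Or.inl (Or.inr hz))
    · exact Or.inr (ih hz)
  | par P Q ihP ihQ => exact Set.union_subset_union ihP ihQ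
  | loc xs P ih => rintro z ⟨hz, -⟩; exact Or.inr (ih hz)
  | nxt P ih => exact ih
  | unl c P ih => exact Set.union_subset_union_right _ ih
  | call p ts => exact subset_rfl
  | bang P ih => exact ih

theorem image_vrename_diff {x y : V} {s : Set V} {xs : List V} (hx : x ∉ xs) (hy : y ∉ xs) :
    vrename x y '' (s \ {z | z ∈ xs}) = (vrename x y '' s) \ {z | z ∈ xs} := by
  ext z
  constructor
  · rintro ⟨a, ⟨ha, ha'⟩, rfl⟩
    refine ⟨⟨a, ha, rfl⟩, fun h => ?_⟩
    unfold vrename at h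
    split_ifs at h
    · exact hy h
    · exact ha' h
  · rintro ⟨⟨a, ha, rfl⟩, h⟩
    refine ⟨a, ⟨ha, fun h' => h ?_⟩, rfl⟩
    rw [vrename_of_ne (ne_of_mem_of_not_mem h' hx)]
    exact h'

theorem image_vrename_of_notMem {x y : V} {s : Set V} (hx : x ∉ s) : vrename x y '' s = s := by
  ext z
  constructor
  · rintro ⟨a, ha, rfl⟩; rwa [vrename_of_ne (ne_of_mem_of_not_mem ha hx)]
  · exact fun hz => ⟨z, hz, vrename_of_ne (ne_of_mem_of_not_mem hz hx)⟩

theorem pfv_rename {x y : V} (h : x ≠ y) {P : Proc L V C N} (hy : y ∉ P.occ) :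
    (P.rename x y).pfv = vrename x y '' P.pfv := by
  induction P with
  | skip => simp [rename, pfv]
  | tell c =>
    simp only [rename, pfv, Con.val_rename h hy]
    exact cfv_crename h fun h' => hy (c.cfv_val_subset h')
  | abs xs c E P ih =>
    simp only [occ, Set.mem_union, not_or] at hy
    simp only [rename]
    split_ifs with hx
    · exact (image_vrename_of_notMem fun h' => h'.2 hx).symm
    · simp only [pfv]
      rw [ih hy.2, cfv_crename h hy.1.1.2, ← Set.image_union, image_vrename_diff hx hy.1.1.1]
  | par P Q ihP ihQ =>
    simp only [occ, Set.mem_union, not_or] at hy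
    simp only [rename, pfv, ihP hy.1, ihQ hy.2, Set.image_union]
  | loc xs P ih =>
    simp only [occ, Set.mem_union, not_or] at hy
    simp only [rename]
    split_ifs with hx
    · exact (image_vrename_of_notMem fun h' => h'.2 hx).symm
    · simp only [pfv]
      rw [ih hy.2, image_vrename_diff hx hy.1]
  | nxt P ih => exact ih hy
  | unl c P ih =>
    simp only [occ, Set.mem_union, not_or] at hy
    simp only [rename, pfv, ih hy.2, cfv_crename h hy.1, Set.image_union]
  | call p ts => ext z; simp only [rename, pfv, mem_termVars_trename, Set.mem_image]
  | bang P ih => exact ih hy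

theorem occ_rename_subset {x y : V} (h : x ≠ y) (P : Proc L V C N) (hy : y ∉ P.occ) :
    (P.rename x y).occ ⊆ P.occ ∪ {y} ∧ P.occ ⊆ (P.rename x y).occ ∪ {x} := by
  have hts : ∀ ts : List (L.Term V), termVars (trename x y ts) ⊆ termVars ts ∪ {y} ∧
      termVars ts ⊆ termVars (trename x y ts) ∪ {x} := by
    intro ts
    constructor
    · intro z hz
      obtain ⟨a, ha, rfl⟩ := mem_termVars_trename.1 hz
      unfold vrename; split_ifs
      · exact Or.inr rfl
      · exact Or.inl ha
    · intro z hz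
      by_cases e : z = x
      · exact Or.inr e
      · exact Or.inl (mem_termVars_trename.2 ⟨z, hz, vrename_of_ne e⟩)
  have hc : ∀ c : C, y ∉ cfv c → cfv (crename x y c) ⊆ cfv c ∪ {y} ∧
      cfv c ⊆ cfv (crename x y c) ∪ {x} := fun c hc =>
    Con.occ_rename_subset h (Con.base c) hc
  have hE : ∀ E : List (List (L.Term V)),
      {z | ∃ ts ∈ E.map (trename x y), z ∈ termVars ts} ⊆ {z | ∃ ts ∈ E, z ∈ termVars ts} ∪ {y} ∧
      {z | ∃ ts ∈ E, z ∈ termVars ts} ⊆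
        {z | ∃ ts ∈ E.map (trename x y), z ∈ termVars ts} ∪ {x} := by
    intro E
    constructor
    · rintro z ⟨ts, hts', hz⟩
      obtain ⟨us, hus, rfl⟩ := List.mem_map.1 hts'
      exact ((hts us).1 hz).imp_left fun h' => ⟨us, hus, h'⟩
    · rintro z ⟨ts, hts', hz⟩
      exact ((hts ts).2 hz).imp_left fun h' => ⟨_, List.mem_map.2 ⟨ts, hts', rfl⟩, h'⟩
  induction P with
  | skip => exact ⟨fun z hz => hz.elim, fun z hz => hz.elim⟩
  | tell c => exact c.occ_rename_subset h hy
  | abs xs c E P ih =>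
    simp only [occ, Set.mem_union, not_or] at hy
    obtain ⟨i1, i2⟩ := ih hy.2
    obtain ⟨c1, c2⟩ := hc c hy.1.1.2
    obtain ⟨e1, e2⟩ := hE E
    simp only [rename]
    split_ifs with hx
    · constructor
      · rintro z (((hz | hz) | hz) | hz)
        · exact Or.inl (Or.inl (Or.inl (Or.inl hz)))
        · exact Or.inl (Or.inl (Or.inl (Or.inr hz)))
        · exact (e1 hz).imp_left fun h => Or.inl (Or.inr h)
        · exact Or.inl (Or.inr hz)
      · rintro z (((hz | hz) | hz) | hz)
        · exact Or.inl (Or.inl (Or.inl (Or.inl hz)))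
        · exact Or.inl (Or.inl (Or.inl (Or.inr hz)))
        · exact (e2 hz).imp_left fun h => Or.inl (Or.inr h)
        · exact Or.inl (Or.inr hz)
    · constructor
      · rintro z (((hz | hz) | hz) | hz)
        · exact Or.inl (Or.inl (Or.inl (Or.inl hz)))
        · exact (c1 hz).imp_left fun h => Or.inl (Or.inl (Or.inr h))
        · exact (e1 hz).imp_left fun h => Or.inl (Or.inr h)
        · exact (i1 hz).imp_left Or.inr
      · rintro z (((hz | hz) | hz) | hz)
        · exact Or.inl (Or.inl (Or.inl (Or.inl hz)))
        · exact (c2 hz).imp_left fun h => Or.inl (Or.inl (Or.inr h))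
        · exact (e2 hz).imp_left fun h => Or.inl (Or.inr h)
        · exact (i2 hz).imp_left Or.inr
  | par P Q ihP ihQ =>
    simp only [occ, Set.mem_union, not_or] at hy
    obtain ⟨h1, h2⟩ := ihP hy.1
    obtain ⟨h3, h4⟩ := ihQ hy.2
    constructor
    · rintro z (hz | hz)
      · exact (h1 hz).imp_left Or.inl
      · exact (h3 hz).imp_left Or.inr
    · rintro z (hz | hz)
      · exact (h2 hz).imp_left Or.inl
      · exact (h4 hz).imp_left Or.inr
  | loc xs P ih =>
    simp only [occ, Set.mem_union, not_or] at hy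
    obtain ⟨h1, h2⟩ := ih hy.2
    simp only [rename]
    split_ifs
    · exact ⟨Set.subset_union_left, Set.subset_union_left⟩
    · constructor
      · rintro b (hb | hb)
        · exact Or.inl (Or.inl hb)
        · exact (h1 hb).imp_left Or.inr
      · rintro b (hb | hb)
        · exact Or.inl (Or.inl hb)
        · exact (h2 hb).imp_left Or.inr
  | nxt P ih => exact ih hy
  | unl c P ih =>
    simp only [occ, Set.mem_union, not_or] at hy
    obtain ⟨h1, h2⟩ := ih hy.2
    obtain ⟨c1, c2⟩ := hc c hy.1
    constructor
    · rintro z (hz | hz)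
      · exact (c1 hz).imp_left Or.inl
      · exact (h1 hz).imp_left Or.inr
    · rintro z (hz | hz)
      · exact (c2 hz).imp_left Or.inl
      · exact (h2 hz).imp_left Or.inr
  | call p ts => exact hts ts
  | bang P ih => exact ih hy

/-- The conjunction of the constraints told at the top level. -/
def now : Proc L V C N → C
  | tell c => c.val
  | par P Q => P.now ⊔ Q.now
  | _ => ⊥

/-- The conjunction of the constraints told by replications at the top level. -/
def always : Proc L V C N → C
  | bang P => P.now
  | par P Q => P.always ⊔ Q.always
  | _ => ⊥

/-- The conjunction of the constraints told by replications from the next time unit on. -/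
def later : Proc L V C N → C
  | nxt P => P.always
  | par P Q => P.later ⊔ Q.later
  | _ => ⊥

theorem cfv_now_subset (P : Proc L V C N) : cfv P.now ⊆ P.pfv := by
  induction P with
  | tell c => exact subset_rfl
  | par P Q ihP ihQ =>
    intro z hz
    by_contra h
    simp only [pfv, Set.mem_union, not_or] at h
    exact notMem_cfv_sup (fun h' => h.1 (ihP h')) (fun h' => h.2 (ihQ h')) hz
  | _ => exact fun z hz => (notMem_cfv_bot z hz).elim

theorem cfv_always_subset (P : Proc L V C N) : cfv P.always ⊆ P.pfv := by
  induction P with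
  | bang P => exact P.cfv_now_subset
  | par P Q ihP ihQ =>
    intro z hz
    by_contra h
    simp only [pfv, Set.mem_union, not_or] at h
    exact notMem_cfv_sup (fun h' => h.1 (ihP h')) (fun h' => h.2 (ihQ h')) hz
  | _ => exact fun z hz => (notMem_cfv_bot z hz).elim

theorem cfv_later_subset (P : Proc L V C N) : cfv P.later ⊆ P.pfv := by
  induction P with
  | nxt P => exact P.cfv_always_subset
  | par P Q ihP ihQ =>
    intro z hz
    by_contra h
    simp only [pfv, Set.mem_union, not_or] at h
    exact notMem_cfv_sup (fun h' => h.1 (ihP h')) (fun h' => h.2 (ihQ h')) hz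
  | _ => exact fun z hz => (notMem_cfv_bot z hz).elim

theorem now_rename {x y : V} (h : x ≠ y) {P : Proc L V C N} (hy : y ∉ P.occ) :
    (P.rename x y).now = crename x y P.now := by
  induction P with
  | tell c => exact Con.val_rename h hy
  | par P Q ihP ihQ =>
    simp only [occ, Set.mem_union, not_or] at hy
    simp only [rename, now, ihP hy.1, ihQ hy.2, crename_sup h]
  | abs xs c E P => simp only [rename]; split_ifs <;> exact (crename_bot h).symm
  | loc xs P => simp only [rename]; split_ifs <;> exact (crename_bot h).symm
  | _ => exact (crename_bot h).symm

theorem always_rename {x y : V} (h : x ≠ y) {P : Proc L V C N} (hy : y ∉ P.occ) :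
    (P.rename x y).always = crename x y P.always := by
  induction P with
  | bang P => exact now_rename h hy
  | par P Q ihP ihQ =>
    simp only [occ, Set.mem_union, not_or] at hy
    simp only [rename, always, ihP hy.1, ihQ hy.2, crename_sup h]
  | abs xs c E P => simp only [rename]; split_ifs <;> exact (crename_bot h).symm
  | loc xs P => simp only [rename]; split_ifs <;> exact (crename_bot h).symm
  | _ => exact (crename_bot h).symm

end Proc

/-! ### A weaker denotation -/

/-- The denotation which ignores parametric asks with a nonempty list of parameters, unless
cylindrification is trivial. -/
def weakDen (I : Interp L V C N) : Proc L V C N → Set (ℕ → C)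
  | .skip => Set.univ
  | .tell c => {s | c.val ≤ s 0}
  | .abs xs c _ P => {s | (xs = [] ∨ Degenerate C) → c ≤ s 0 → s ∈ weakDen I P}
  | .par P Q => weakDen I P ∩ weakDen I Q
  | .loc xs P => Exists' xs (weakDen I P)
  | .nxt P => {s | (fun n => s (n + 1)) ∈ weakDen I P}
  | .unl c P => {s | (¬ c ≤ s 0 ∧ (fun n => s (n + 1)) ∈ weakDen I P) ∨ c ≤ s 0}
  | .call p ts => I p ts
  | .bang P => {s | ∀ k, (fun n => s (n + k)) ∈ weakDen I P}

theorem den_subset_weakDen {I J : Interp L V C N} (h : I ≤ J) (P : Proc L V C N) :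
    den I P ⊆ weakDen J P := by
  induction P with
  | skip => exact subset_rfl
  | tell c => exact subset_rfl
  -- Of `Forall'` only the first component is kept: the sequence itself satisfies the implication.
  | abs xs c E P ih => exact fun s hs _ hc => ih (hs.1 hc)
  | par P Q ihP ihQ => exact Set.inter_subset_inter ihP ihQ
  | loc xs P ih => exact Exists'.mono xs ih
  | nxt P ih => exact fun s hs => ih hs
  | unl c P ih => exact fun s hs => hs.imp (fun h => ⟨h.1, ih h.2⟩) id
  | call p ts => exact h p ts
  | bang P ih => exact fun s hs k => ih (hs k)

theorem weakDen_mono {I J : Interp L V C N} (h : I ≤ J) (P : Proc L V C N) :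
    weakDen I P ⊆ weakDen J P := by
  induction P with
  | skip => exact subset_rfl
  | tell c => exact subset_rfl
  | abs xs c E P ih => exact fun s hs h1 hc => ih (hs h1 hc)
  | par P Q ihP ihQ => exact Set.inter_subset_inter ihP ihQ
  | loc xs P ih => exact Exists'.mono xs ih
  | nxt P ih => exact fun s hs => ih hs
  | unl c P ih => exact fun s hs => hs.imp (fun h => ⟨h.1, ih h.2⟩) id
  | call p ts => exact h p ts
  | bang P ih => exact fun s hs k => ih (hs k)

/-- Interpretations that depend only on the variables of the actual parameters and are invariant
under renaming. -/
structure Interp.Tame (I : Interp L V C N) : Prop where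
  closed : ∀ (p : N) (ts : List (L.Term V)) (y : V) (s s' : ℕ → C), y ∉ termVars ts →
    (∀ n, ex y (s n) = ex y (s' n)) → s ∈ I p ts → s' ∈ I p ts
  ren : ∀ (p : N) (ts : List (L.Term V)) (x y : V) (s : ℕ → C), x ≠ y → y ∉ termVars ts →
    (s ∈ I p (trename x y ts) ↔ (fun n => swapTo x y (s n)) ∈ I p ts)

theorem le_iff_of_ex_eq {y : V} {c a b : C} (hc : y ∉ cfv c) (h : ex y a = ex y b) :
    c ≤ a ↔ c ≤ b := by
  constructor <;> intro h'
  · have := ex_mono y _ _ h'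
    rw [notMem_cfv.1 hc, h] at this
    exact this.trans (ex_le _ _)
  · have := ex_mono y _ _ h'
    rw [notMem_cfv.1 hc, ← h] at this
    exact this.trans (ex_le _ _)

theorem mem_weakDen_of_ex_eq {I : Interp L V C N} (hI : I.Tame) {P : Proc L V C N} {y : V}
    (hy : y ∉ P.pfv) {s s' : ℕ → C} (h : ∀ n, ex y (s n) = ex y (s' n)) (hs : s ∈ weakDen I P) :
    s' ∈ weakDen I P := by
  induction P generalizing s s' with
  | skip => trivial
  | tell c => exact (le_iff_of_ex_eq hy (h 0)).1 hs
  | abs xs c E P ih =>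
    rintro (rfl | hd) hc
    · simp only [Proc.pfv, Set.mem_sdiff, Set.mem_union, not_and_or, not_or] at hy
      have hy := hy.resolve_right (by simp)
      exact ih hy.2 h (hs (Or.inl rfl) ((le_iff_of_ex_eq hy.1 (h 0)).2 hc))
    · have : s = s' := funext fun n => by have := h n; rwa [hd, hd] at this
      exact this ▸ hs (Or.inr hd) (this ▸ hc)
  | par P Q ihP ihQ =>
    simp only [Proc.pfv, Set.mem_union, not_or] at hy
    exact ⟨ihP hy.1 h hs.1, ihQ hy.2 h hs.2⟩
  | loc xs P ih =>
    obtain ⟨r, hr, hv⟩ := hs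
    by_cases hx : y ∈ xs
    · refine ⟨r, hr, fun n => ?_⟩
      have h1 : exs xs (exs [y] (s n)) = exs xs (exs [y] (s' n)) := congrArg (exs xs) (h n)
      rw [exs_exs_of_subset' (by simpa using hx), exs_exs_of_subset' (by simpa using hx)] at h1
      rw [← h1]; exact hv n
    · have hyP : y ∉ P.pfv := fun h' => hy ⟨h', hx⟩
      -- The witness `r` for `s` is adapted to `s'` by forgetting `y` and adding what `s'` says
      -- outside `xs`.
      refine ⟨fun n => exs xs (s' n) ⊔ ex y (r n), ih hyP (fun n => ?_) hr, fun n => ?_⟩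
      · have h1 : ex y (exs xs (s' n)) ≤ ex y (r n) := by
          rw [ex_exs_comm, ← h n, ← ex_exs_comm, hv n, ex_exs_comm]
          exact exs_le _ _
        rw [ex_sup_ex, sup_eq_right.2 h1]
      · have h1 : exs xs (ex y (r n)) ≤ exs xs (s' n) := by
          rw [← ex_exs_comm, ← hv n, ex_exs_comm, h n]
          exact exs_mono _ (ex_le _ _)
        rw [exs_sup_of_notMem' _ fun x hx => notMem_cfv_exs_of_mem _ hx, sup_eq_left.2 h1]
  | nxt P ih => exact ih hy (fun n => h (n + 1)) hs
  | unl c P ih =>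
    simp only [Proc.pfv, Set.mem_union, not_or] at hy
    have h0 := le_iff_of_ex_eq hy.1 (h 0)
    exact hs.imp (fun h' => ⟨fun h'' => h'.1 (h0.2 h''), ih hy.2 (fun n => h (n + 1)) h'.2⟩) h0.1
  | call p ts => exact hI.closed p ts y s s' hy h hs
  | bang P ih => exact fun k => ih hy (fun n => h (n + k)) (hs k)

theorem mem_weakDen_exs_iff {I : Interp L V C N} (hI : I.Tame) {P : Proc L V C N} {ys : List V}
    (hy : ∀ y ∈ ys, y ∉ P.pfv) (s : ℕ → C) :
    (fun n => exs ys (s n)) ∈ weakDen I P ↔ s ∈ weakDen I P := by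
  induction ys with
  | nil => rfl
  | cons y ys ih =>
    rw [← ih fun z hz => hy z (List.mem_cons_of_mem _ hz)]
    have hy' := hy y List.mem_cons_self
    constructor
    · exact mem_weakDen_of_ex_eq hI hy' fun n => by rw [exs_cons, ex_ex_self]
    · exact mem_weakDen_of_ex_eq hI hy' fun n => by rw [exs_cons, ex_ex_self]

theorem mem_weakDen_of_variant {I : Interp L V C N} (hI : I.Tame) {P : Proc L V C N} {ys : List V}
    (hy : ∀ y ∈ ys, y ∉ P.pfv) {s s' : ℕ → C} (h : Variant ys s s') :
    s ∈ weakDen I P ↔ s' ∈ weakDen I P := by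
  rw [← mem_weakDen_exs_iff hI hy s, ← mem_weakDen_exs_iff hI hy s', funext h]

/-- Both sequences are compared with `∃x s ⊔ x = y`, which differs from `s` only in `x` and from its
swap only in `y`. -/
theorem mem_weakDen_swapTo_iff {I : Interp L V C N} (hI : I.Tame) {P : Proc L V C N} {x y : V}
    (h : x ≠ y) (hx : x ∉ P.pfv) (hy : y ∉ P.pfv) (s : ℕ → C) :
    (fun n => swapTo x y (s n)) ∈ weakDen I P ↔ s ∈ weakDen I P := by
  have h1 := mem_weakDen_of_variant hI (P := P) (ys := [x]) (by simpa using hx)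
    (s := s) (s' := fun n => ex x (s n) ⊔ eqn x (Term.var y))
    (fun n => (ex_sup_eqn_var h (s n)).symm)
  have h2 := mem_weakDen_of_variant hI (P := P) (ys := [y]) (by simpa using hy)
    (s := fun n => swapTo x y (s n)) (s' := fun n => ex x (s n) ⊔ eqn x (Term.var y))
    (fun n => by
      change ex y (swapTo x y (s n)) = ex y (ex x (s n) ⊔ eqn x (Term.var y))
      rw [ex_sup_eqn_var', notMem_cfv.1 (notMem_cfv_swapTo x y (s n))])
  rw [h1, h2]

theorem mem_weakDen_rename_iff {I : Interp L V C N} (hI : I.Tame) {P : Proc L V C N} {x y : V}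
    (h : x ≠ y) (hy : y ∉ P.occ) (s : ℕ → C) :
    s ∈ weakDen I (P.rename x y) ↔ (fun n => swapTo x y (s n)) ∈ weakDen I P := by
  induction P generalizing s with
  | skip => exact Iff.rfl
  | tell c =>
    change (c.rename x y).val ≤ s 0 ↔ c.val ≤ swapTo x y (s 0)
    rw [Con.val_rename h hy, crename_le_iff h fun h' => hy (c.cfv_val_subset h')]
  | abs xs c E P ih =>
    simp only [Proc.occ, Set.mem_union, not_or] at hy
    simp only [Proc.rename]
    split_ifs with hx
    · have hne : xs ≠ [] := List.ne_nil_of_mem hx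
      constructor
      · rintro hs (hd | hd)
        · exact (hne hd).elim
        · simp only [hd.swapTo_eq h]; exact hs (Or.inr hd)
      · rintro hs (hd | hd)
        · exact (hne hd).elim
        · have := hs (Or.inr hd); simpa only [hd.swapTo_eq h] using this
    · change (_ → _ → _) ↔ (_ → _ → _)
      rw [ih hy.2, crename_le_iff h hy.1.1.2]
  | par P Q ihP ihQ =>
    simp only [Proc.occ, Set.mem_union, not_or] at hy
    exact and_congr (ihP hy.1 s) (ihQ hy.2 s)
  | loc zs P ih =>
    have hy0 : y ∉ (Proc.loc zs P).pfv := fun h' => hy (Proc.pfv_subset_occ _ h')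
    simp only [Proc.occ, Set.mem_union, not_or] at hy
    have hyP : y ∉ P.pfv := fun h' => hy.2 (P.pfv_subset_occ h')
    simp only [Proc.rename]
    split_ifs with hx
    · exact (mem_weakDen_swapTo_iff hI h (P := .loc zs P) (fun h' => h'.2 hx) hy0 s).symm
    · constructor
      · rintro ⟨r, hr, hv⟩
        refine ⟨_, (ih hy.2 r).1 hr, fun n => ?_⟩
        rw [← swapTo_exs hx hy.1, ← swapTo_exs hx hy.1, hv n]
      · rintro ⟨r0, hr0, hv0⟩
        -- The variable `y` can be removed from the witness, as it is free neither in `P` nor in the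
        -- swapped sequence; afterwards renaming `x` to `y` in it is invertible.
        obtain ⟨r, hr, hv, hry⟩ : ∃ r : ℕ → C, r ∈ weakDen I P ∧
            (∀ n, exs zs (r n) = exs zs (swapTo x y (s n))) ∧ ∀ n, y ∉ cfv (r n) := by
          refine ⟨fun n => ex y (r0 n), mem_weakDen_of_ex_eq hI hyP
            (fun n => (ex_ex_self _ _).symm) hr0, fun n => ?_, fun n => notMem_cfv_ex_self _ _⟩
          rw [← ex_exs_comm, ← hv0 n]
          exact notMem_cfv.1 (notMem_cfv_exs _ (notMem_cfv_swapTo x y (s n)))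
        -- Swapping forgets `x`, so the information of `s` outside `zs` has to be put back by hand.
        refine ⟨fun n => exs zs (s n) ⊔ crename x y (r n), ?_, fun n => ?_⟩
        · rw [ih hy.2]
          convert hr using 2 with n
          have h1 : exs zs (swapTo x y (s n)) ≤ r n := hv n ▸ exs_le _ _
          rw [swapTo, ex_sup_of_notMem _ (notMem_cfv_crename x y _), crename_sup h.symm,
            crename_crename h (hry n)]
          change swapTo x y (exs zs (s n)) ⊔ r n = r n
          rw [swapTo_exs hx hy.1, sup_eq_right.2 h1]
        · have h1 : exs zs (crename x y (r n)) ≤ exs zs (s n) := by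
            rw [← crename_exs hx hy.1, hv n, crename_exs hx hy.1, crename_swapTo h]
            exact exs_mono _ (ex_le _ _)
          rw [exs_sup_of_notMem' _ fun z hz => notMem_cfv_exs_of_mem _ hz, sup_eq_left.2 h1]
  | nxt P ih => exact ih hy _
  | unl c P ih =>
    simp only [Proc.occ, Set.mem_union, not_or] at hy
    have h0 := crename_le_iff h hy.1 (s 0)
    exact or_congr (and_congr (not_congr h0) (ih hy.2 _)) h0
  | call p ts => exact hI.ren p ts x y s h hy
  | bang P ih => exact forall_congr' fun k => ih hy _

/-- Neither process has `x` or `y` free, as far as needed: the original may forget `y` in the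
sequence, the renamed one `x`. After that the two quantifier blocks range over the same set of
variables. -/
theorem weakDen_loc_rename {I : Interp L V C N} (hI : I.Tame) {P : Proc L V C N} {xs : List V}
    {x y : V} (hx : x ∈ xs) (hyx : y ∉ xs) (hy : y ∉ P.occ) :
    weakDen I (.loc (xs.map (vrename x y)) (P.rename x y)) = weakDen I (.loc xs P) := by
  have h : x ≠ y := fun e => hyx (e ▸ hx)
  have hyP : y ∉ P.pfv := fun h' => hy (P.pfv_subset_occ h')
  have hx' := notMem_map_vrename h xs
  have hset : ∀ c : C, exs [y] (exs xs c) = exs [x] (exs (xs.map (vrename x y)) c) := by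
    intro c
    rw [← exs_append, ← exs_append]
    apply exs_eq_exs
    · intro z hz
      simp only [List.singleton_append, List.mem_cons] at hz ⊢
      rcases hz with rfl | hz
      · exact Or.inr (mem_map_vrename hx)
      · by_cases e : z = x
        · exact Or.inl e
        · exact Or.inr (mem_map_vrename_of_ne hz e)
    · intro z hz
      simp only [List.singleton_append, List.mem_cons] at hz ⊢
      rcases hz with rfl | hz
      · exact Or.inr hx
      · exact mem_of_mem_map_vrename hz
  have hx0 : x ∉ (Proc.loc (xs.map (vrename x y)) (P.rename x y)).pfv := by
    rintro ⟨hm, -⟩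
    rw [Proc.pfv_rename h hy] at hm
    obtain ⟨z, -, hz⟩ := hm
    exact vrename_ne h z hz
  ext s
  constructor
  · rintro ⟨r, hr, hv⟩
    rw [mem_weakDen_rename_iff hI h hy] at hr
    refine mem_weakDen_of_ex_eq hI (P := .loc xs P) (y := y) (fun h' => hyP h'.1)
      (s := fun n => ex y (s n)) (fun n => ex_ex_self _ _) ⟨_, hr, fun n => ?_⟩
    rw [← exs_map_crename hx hyx (notMem_cfv_swapTo x y (r n)), crename_swapTo h, ← ex_exs_comm,
      ← ex_exs_comm, ← hv n]
    exact hset (s n)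
  · rintro ⟨q, hq, hv⟩
    have hq' := mem_weakDen_of_ex_eq hI hyP (s' := fun n => ex y (q n))
      (fun n => (ex_ex_self _ _).symm) hq
    refine mem_weakDen_of_ex_eq hI hx0 (s := fun n => ex x (s n)) (fun n => ex_ex_self _ _)
      ⟨fun n => crename x y (ex y (q n)), ?_, fun n => ?_⟩
    · rw [mem_weakDen_rename_iff hI h hy]
      convert hq' using 2 with n
      rw [swapTo, notMem_cfv.1 (notMem_cfv_crename _ _ _),
        crename_crename h (notMem_cfv_ex_self y _)]
    · rw [exs_map_crename hx hyx (notMem_cfv_ex_self y _), ← ex_exs_comm, ← ex_exs_comm, ← hv n]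
      exact (hset (s n)).symm

end Processes

/-! ### Statements about all sufficiently fresh lists of variables -/

section FreshLists

variable {V : Type}

/-- `g` lists `m` distinct variables outside `G`. -/
def Fresh (G : Set V) (m : ℕ) (g : List V) : Prop :=
  g.Nodup ∧ g.length = m ∧ ∀ x ∈ g, x ∉ G

theorem Fresh.mono {G H : Set V} {m : ℕ} {g : List V} (h : Fresh H m g) (hGH : G ⊆ H) :
    Fresh G m g := ⟨h.1, h.2.1, fun x hx hG => h.2.2 x hx (hGH hG)⟩

theorem exists_fresh [Infinite V] {G : Set V} (hG : G.Finite) (m : ℕ) : ∃ g, Fresh G m g := by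
  obtain ⟨t, ht, hc⟩ := hG.infinite_compl.exists_subset_card_eq m
  exact ⟨t.toList, t.nodup_toList, by simpa using hc, fun x hx => ht (by simpa using hx)⟩

/-- The pattern `∃ G` finite, `∀ g` fresh for `G`, reads "for all sufficiently fresh `g`", so
avoiding finitely many further variables costs nothing. -/
theorem exists_fresh_imp_iff {m : ℕ} {p q : List V → Prop} {F : Set V} (hF : F.Finite)
    (h : ∀ g, Fresh F m g → (p g ↔ q g)) :
    (∃ G : Set V, G.Finite ∧ ∀ g, Fresh G m g → p g) ↔
      ∃ G : Set V, G.Finite ∧ ∀ g, Fresh G m g → q g := by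
  constructor <;> rintro ⟨G, hG, hp⟩ <;> refine ⟨G ∪ F, hG.union hF, fun g hg => ?_⟩
  · exact (h g (hg.mono Set.subset_union_right)).1 (hp g (hg.mono Set.subset_union_left))
  · exact (h g (hg.mono Set.subset_union_right)).2 (hp g (hg.mono Set.subset_union_left))

end FreshLists

/-! ### Procedure calls, tameness of the approximations, and invariance under structural congruence
-/

section Calls

variable {L : FirstOrder.Language.{u, v}} {V : Type} {C : Type w} {N : Type r} [DecidableEq V]
  [ConstraintSystem L V C]

/-- This allows a fresh tuple `g` to stand between the formal parameters `f` and the actual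
parameters `ts`. -/
theorem eqns_sup_eqns_le {f g : List V} {ts : List (L.Term V)} (hf : g.length = f.length)
    (ht : f.length = ts.length) (hgf : ∀ x ∈ g, x ∉ f) (hgt : ∀ x ∈ g, x ∉ termVars ts) :
    (eqns f (g.map Term.var) : C) ≤ eqns g ts ⊔ eqns f ts ∧
      (eqns f ts : C) ≤ eqns g ts ⊔ eqns f (g.map Term.var) := by
  induction f generalizing g ts with
  | nil => exact ⟨bot_le, bot_le⟩
  | cons a f ih =>
    obtain _ | ⟨b, g⟩ := g
    · simp at hf
    obtain _ | ⟨t, ts⟩ := ts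
    · simp at ht
    have h1 : ∀ x ∈ g, x ∉ f := fun x hx h =>
      hgf x (List.mem_cons_of_mem _ hx) (List.mem_cons_of_mem _ h)
    have h2 : ∀ x ∈ g, x ∉ termVars ts := fun x hx =>
      (notMem_termVars_cons.1 (hgt x (List.mem_cons_of_mem _ hx))).2
    obtain ⟨i1, i2⟩ := ih (by simpa using hf) (by simpa using ht) h1 h2
    have hb : b ∉ t.varFinset := (notMem_termVars_cons.1 (hgt b List.mem_cons_self)).1
    have hba : b ≠ a := fun e => hgf b List.mem_cons_self (e ▸ List.mem_cons_self)
    simp only [List.map_cons, eqns_cons]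
    constructor
    · exact sup_le ((eqn_euclid_le hba hb).trans (sup_le_sup le_sup_left le_sup_left))
        (i1.trans (sup_le_sup le_sup_right le_sup_right))
    · refine sup_le ((eqn_trans_le hba hb).trans ?_)
        (i2.trans (sup_le_sup le_sup_right le_sup_right))
      rw [sup_comm]
      exact sup_le_sup le_sup_left le_sup_left

theorem adm_map_var {f g : List V} (hl : g.length = f.length) (h : ∀ x ∈ g, x ∉ f) :
    Adm f (g.map (Term.var : V → L.Term V)) :=
  ⟨by simp [hl], fun x hx hm => h x (mem_termVars_map_var.1 hm) hx⟩

/-- The replicated tell puts `f = ts` into every element of the hidden sequence, and this determines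
it from its part outside `f`; the existential witness is therefore unique. -/
theorem mem_weakDen_subst_iff (I : Interp L V C N) (P : Proc L V C N) {f : List V}
    {ts : List (L.Term V)} (hn : f.Nodup) (h : Adm f ts) (s : ℕ → C) :
    s ∈ weakDen I (P.subst f ts) ↔
      (fun n => exs f (s n) ⊔ eqns f ts) ∈ weakDen I P := by
  constructor
  · rintro ⟨r, ⟨hb, hr⟩, hv⟩
    convert hr using 2 with n
    rw [hv n]
    have : eqns f ts ≤ r n := by have := hb n; simpa [weakDen, Con.val] using this
    exact (eq_eqns_sup_exs h this).symm
  · intro hs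
    refine ⟨_, ⟨fun k => ?_, hs⟩, fun n => ?_⟩
    · change (Con.base _).val ≤ _
      exact le_sup_right
    · exact (exs_sup_eqns hn h _).symm

/-- The sequences `s` such that `P` accepts the sequence obtained from `s` by letting the
parameters `f` be equal to `g`. -/
def paramDen (I : Interp L V C N) (f : List V) (P : Proc L V C N) (g : List V) : Set (ℕ → C) :=
  {s | (fun n => exs f (s n) ⊔ eqns f (g.map Term.var)) ∈ weakDen I P}

theorem paramDen_of_ex_eq {I : Interp L V C N} (hI : I.Tame) {f : List V} {P : Proc L V C N}
    (hP : P.pfv ⊆ {x | x ∈ f}) {g : List V} {z : V} (hz : z ∉ g) {s s' : ℕ → C}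
    (h : ∀ n, ex z (s n) = ex z (s' n)) (hs : s ∈ paramDen I f P g) : s' ∈ paramDen I f P g := by
  by_cases hzf : z ∈ f
  · have : ∀ n, exs f (s n) = exs f (s' n) := by
      intro n
      have h1 : exs f (exs [z] (s n)) = exs f (exs [z] (s' n)) := congrArg (exs f) (h n)
      rwa [exs_exs_of_subset' (by simpa using hzf), exs_exs_of_subset' (by simpa using hzf)] at h1
    change (fun n => exs f (s' n) ⊔ eqns f (g.map Term.var)) ∈ weakDen I P
    simp only [← this]
    exact hs
  · refine mem_weakDen_of_ex_eq hI (fun h' => hzf (hP h')) (fun n => ?_) hs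
    have hz' : z ∉ cfv (eqns f (g.map Term.var) : C) :=
      notMem_cfv_eqns hzf fun h' => hz (mem_termVars_map_var.1 h')
    rw [ex_sup_of_notMem _ hz', ex_sup_of_notMem _ hz', ex_exs_comm, ex_exs_comm, h n]

/-- The two sequences differ only in `g`, on which the body does not depend: its free variables are
formal parameters. -/
theorem mem_paramDen_sup_eqns_iff {I : Interp L V C N} (hI : I.Tame) {f : List V}
    {P : Proc L V C N} (hP : P.pfv ⊆ {x | x ∈ f}) {ts : List (L.Term V)} (h : Adm f ts)
    {g : List V} (hg : Fresh ({x | x ∈ f} ∪ termVars ts) f.length g) (s : ℕ → C) :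
    (fun n => exs g (s n) ⊔ eqns g ts) ∈ paramDen I f P g ↔
      (fun n => exs f (s n) ⊔ eqns f ts) ∈ weakDen I P := by
  have hgf : ∀ x ∈ g, x ∉ f := fun x hx h' => hg.2.2 x hx (Or.inl h')
  have hgt : ∀ x ∈ g, x ∉ termVars ts := fun x hx h' => hg.2.2 x hx (Or.inr h')
  obtain ⟨h1, h2⟩ := eqns_sup_eqns_le (C := C) hg.2.1 h.1 hgf hgt
  refine mem_weakDen_of_variant hI (ys := g) (fun y hy h' => hgf y hy (hP h')) fun n => ?_
  have e1 : exs f (exs g (s n) ⊔ eqns g ts) ⊔ eqns f (g.map Term.var) =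
      exs f (exs g (s n)) ⊔ eqns f ts ⊔ eqns g ts := by
    rw [exs_sup_of_notMem _ fun x hx => notMem_cfv_eqns (fun h' => hgf x h' hx) (h.2 x hx),
      sup_assoc, sup_assoc]
    congr 1
    refine le_antisymm (sup_le le_sup_right (h1.trans (sup_comm _ _).le))
      (sup_le h2 le_sup_left)
  have e2 : ∀ x ∈ g, x ∉ cfv (eqns f ts : C) := fun x hx => notMem_cfv_eqns (hgf x hx) (hgt x hx)
  change exs g (exs f (exs g (s n) ⊔ eqns g ts) ⊔ eqns f (g.map Term.var)) = _
  rw [e1, exs_sup_of_notMem' _, exs_eqns hg.1 hgt, sup_bot_eq, exs_sup_of_notMem _ e2, exs_comm f g]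
  exact fun x hx => notMem_cfv_sup
    (by rw [exs_comm]; exact notMem_cfv_exs_of_mem _ hx) (e2 x hx)

/-- Linking the formals to variables `g` removes their names from the meaning of the body.
Consequently all renamings of a declaration have the same meaning for sufficiently fresh `g`. -/
theorem paramDen_rename {I : Interp L V C N} (hI : I.Tame) {f : List V} {P : Proc L V C N}
    {x y : V} (hx : x ∈ f) (hyf : y ∉ f) (hy : y ∉ P.occ) {g : List V}
    (hgx : x ∉ g) (hgy : y ∉ g) :
    paramDen I (f.map (vrename x y)) (P.rename x y) g = paramDen I f P g := by
  have h : x ≠ y := fun e => hyf (e ▸ hx)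
  have hyP : y ∉ P.pfv := fun h' => hy (P.pfv_subset_occ h')
  have hyf' := mem_map_vrename (y := y) hx
  ext s
  change (_ ∈ weakDen I (P.rename x y)) ↔ (_ ∈ weakDen I P)
  rw [mem_weakDen_rename_iff hI h hy]
  have hyg : y ∉ termVars (g.map (Term.var : V → L.Term V)) := fun h' =>
    hgy (mem_termVars_map_var.1 h')
  have hxg : x ∉ termVars (g.map (Term.var : V → L.Term V)) := fun h' =>
    hgx (mem_termVars_map_var.1 h')
  have e : ∀ n, swapTo x y (exs (f.map (vrename x y)) (s n) ⊔
      eqns (f.map (vrename x y)) (g.map Term.var)) =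
      ex y (exs f (s n)) ⊔ eqns f (g.map Term.var) := by
    intro n
    rw [swapTo, ex_sup_of_notMem _ (notMem_cfv_eqns (notMem_map_vrename h f) hxg),
      crename_sup h.symm, crename_eqns h.symm (notMem_map_vrename h f) hxg fun _ => hyg,
      map_vrename_vrename hyf, trename_map_var_of_notMem hgy,
      crename_of_notMem h.symm (notMem_cfv_ex _ (notMem_cfv_exs_of_mem _ hyf')),
      ← exs_cons, ← exs_cons]
    congr 1
    apply exs_eq_exs
    · intro z hz
      rcases List.mem_cons.1 hz with rfl | hz
      · exact List.mem_cons_of_mem _ hx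
      · exact (mem_of_mem_map_vrename hz).elim (fun e => e ▸ List.mem_cons_self)
          (List.mem_cons_of_mem _)
    · intro z hz
      rcases List.mem_cons.1 hz with rfl | hz
      · exact List.mem_cons_of_mem _ hyf'
      · by_cases e : z = x
        · exact e ▸ List.mem_cons_self
        · exact List.mem_cons_of_mem _ (mem_map_vrename_of_ne hz e)
  simp only [e]
  have hcl : ∀ n, ex y (ex y (exs f (s n)) ⊔ (eqns f (g.map Term.var) : C)) =
      ex y (exs f (s n) ⊔ eqns f (g.map Term.var)) := by
    intro n
    rw [ex_sup_of_notMem _ (notMem_cfv_eqns hyf hyg), ex_ex_self,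
      ex_sup_of_notMem _ (notMem_cfv_eqns hyf hyg)]
  exact ⟨mem_weakDen_of_ex_eq hI hyP hcl, mem_weakDen_of_ex_eq hI hyP fun n => (hcl n).symm⟩

/-- The properties of the declarations of a program that are preserved by renaming of the formal
parameters. -/
structure Decl.Closed (δ : Decl L V C N) : Prop where
  nodup : δ.formals.Nodup
  pfv_subset : δ.body.pfv ⊆ {x | x ∈ δ.formals}

theorem nodup_map_vrename_iff {x y : V} {xs : List V} (hy : y ∉ xs) :
    (xs.map (vrename x y)).Nodup ↔ xs.Nodup :=
  ⟨List.Nodup.of_map _, fun h => h.map_on fun _ ha _ hb e =>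
    vrename_inj (ne_of_mem_of_not_mem ha hy) (ne_of_mem_of_not_mem hb hy) e⟩

theorem Decl.Alpha.closed {δ ε : Decl L V C N} (hε : δ.Alpha ε) (h : δ.Closed) : ε.Closed := by
  induction hε with
  | refl => exact h
  | @step ε x y hε hx hyf hy ih =>
    have hxy : x ≠ y := fun e => hyf (e ▸ hx)
    refine ⟨(nodup_map_vrename_iff hyf).2 ih.nodup, ?_⟩
    change (ε.body.rename x y).pfv ⊆ _
    rw [Proc.pfv_rename hxy hy]
    rintro _ ⟨z, hz, rfl⟩
    exact List.mem_map.2 ⟨z, ih.pfv_subset hz, rfl⟩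

theorem Decl.Alpha.length_eq {δ ε : Decl L V C N} (hε : δ.Alpha ε) :
    ε.formals.length = δ.formals.length := by
  induction hε with
  | refl => rfl
  | step hε hx hyf hy ih => simpa using ih

theorem Decl.Alpha.paramDen_eq {I : Interp L V C N} (hI : I.Tame) {δ ε : Decl L V C N}
    (hε : δ.Alpha ε) : ∃ G : Set V, G.Finite ∧ ∀ g m, Fresh G m g →
      paramDen I ε.formals ε.body g = paramDen I δ.formals δ.body g := by
  induction hε with
  | refl => exact ⟨∅, Set.finite_empty, fun g m _ => rfl⟩
  | @step ε x y hε hx hyf hy ih =>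
    obtain ⟨G, hG, h⟩ := ih
    refine ⟨G ∪ {x, y}, hG.union (by simp), fun g m hg => ?_⟩
    rw [← h g m (hg.mono Set.subset_union_left)]
    exact paramDen_rename hI hx hyf hy (fun h' => hg.2.2 x h' (by simp))
      fun h' => hg.2.2 y h' (by simp)

/-- The denotation of a call under an interpretation of the calls in the procedure body. -/
def callDen (I : Interp L V C N) (δ : Decl L V C N) (ts : List (L.Term V)) : Set (ℕ → C) :=
  {s | ∃ G : Set V, G.Finite ∧ ∀ g, Fresh G δ.formals.length g →
    (fun n => exs g (s n) ⊔ eqns g ts) ∈ paramDen I δ.formals δ.body g}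

theorem callDen_mono {I J : Interp L V C N} (h : I ≤ J) (δ : Decl L V C N) (ts : List (L.Term V)) :
    callDen I δ ts ⊆ callDen J δ ts := by
  rintro s ⟨G, hG, hs⟩
  exact ⟨G, hG, fun g hg => weakDen_mono h _ (hs g hg)⟩

/-- `callDen` is defined for arbitrary actual parameters, without choosing a renaming that makes
them admissible. Here it is seen to agree with every admissible choice, so it serves the operational
and the denotational side alike. -/
theorem Decl.Alpha.mem_callDen_iff [Infinite V] {I : Interp L V C N} (hI : I.Tame)
    {δ ε : Decl L V C N} (hε : δ.Alpha ε) (hδ : δ.Closed) {ts : List (L.Term V)}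
    (h : Adm ε.formals ts) (s : ℕ → C) :
    s ∈ callDen I δ ts ↔ s ∈ weakDen I (ε.body.subst ε.formals ts) := by
  have hε' := hε.closed hδ
  obtain ⟨H, hH, he⟩ := hε.paramDen_eq hI
  have hF : ({x | x ∈ ε.formals} ∪ termVars ts).Finite :=
    (List.finite_toSet _).union (termVars_finite ts)
  rw [mem_weakDen_subst_iff I _ hε'.nodup h]
  constructor
  · rintro ⟨G, hG, hs⟩
    obtain ⟨g, hg⟩ := exists_fresh (hG.union (hH.union hF)) ε.formals.length
    rw [← mem_paramDen_sup_eqns_iff hI hε'.pfv_subset h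
      (hg.mono (Set.subset_union_right.trans Set.subset_union_right)),
      he g _ (hg.mono (Set.subset_union_left.trans Set.subset_union_right))]
    exact hs g (hε.length_eq ▸ hg.mono Set.subset_union_left)
  · intro hs
    refine ⟨H ∪ ({x | x ∈ ε.formals} ∪ termVars ts), hH.union hF, fun g hg => ?_⟩
    rw [← hε.length_eq] at hg
    rw [← he g _ (hg.mono Set.subset_union_left), mem_paramDen_sup_eqns_iff hI hε'.pfv_subset h
      (hg.mono Set.subset_union_right)]
    exact hs

theorem callDen_tame {I : Interp L V C N} (hI : I.Tame) {D : N → Decl L V C N}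
    (hD : ∀ p, (D p).Closed) : Interp.Tame fun p ts => callDen I (D p) ts where
  closed := by
    rintro p ts y s s' hy h ⟨G, hG, hs⟩
    refine ⟨G ∪ {y}, hG.union (Set.finite_singleton _), fun g hg => ?_⟩
    have hyg : y ∉ g := fun h' => hg.2.2 y h' (Or.inr rfl)
    refine paramDen_of_ex_eq hI (hD p).pfv_subset hyg (fun n => ?_)
      (hs g (hg.mono Set.subset_union_left))
    rw [ex_sup_of_notMem _ (notMem_cfv_eqns hyg hy), ex_sup_of_notMem _ (notMem_cfv_eqns hyg hy),
      ex_exs_comm, ex_exs_comm, h n]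
  ren := by
    intro p ts x y s h hy
    have key : ∀ g : List V, x ∉ g → y ∉ g →
        ((fun n => exs g (s n) ⊔ eqns g (trename x y ts)) ∈
          paramDen I (D p).formals (D p).body g ↔
        (fun n => exs g (swapTo x y (s n)) ⊔ eqns g ts) ∈
          paramDen I (D p).formals (D p).body g) := by
      intro g hx hyg
      have hxt : x ∉ termVars (trename x y ts) := fun h' => by
        obtain ⟨a, -, ha⟩ := mem_termVars_trename.1 h'; exact vrename_ne h a ha
      have he : crename x y (eqns g ts : C) = eqns g (trename x y ts) := by
        rw [crename_eqns h hyg hy fun h' => (hx h').elim, map_vrename_of_notMem hx]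
      -- The intermediate sequence contains `x = y`; given this, `g = ts` and its renaming are
      -- equivalent. It differs from one side only in `x` and from the other only in `y`.
      have h1 : ∀ n, ex x (exs g (s n) ⊔ eqns g (trename x y ts)) =
          ex x (ex x (exs g (s n)) ⊔ eqn x (Term.var y) ⊔ eqns g (trename x y ts)) := by
        intro n
        rw [ex_sup_of_notMem _ (notMem_cfv_eqns hx hxt), ex_sup_of_notMem _
          (notMem_cfv_eqns hx hxt), ex_sup_eqn_var h]
      have h2 : ∀ n, ex y (exs g (swapTo x y (s n)) ⊔ eqns g ts) =
          ex y (ex x (exs g (s n)) ⊔ eqn x (Term.var y) ⊔ eqns g (trename x y ts)) := by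
        intro n
        have h3 : (eqn x (Term.var y) ⊔ eqns g (trename x y ts) : C) =
            eqn x (Term.var y) ⊔ eqns g ts := by
          rw [← he]
          exact le_antisymm (sup_le le_sup_left ((crename_le_sup x y _).trans_eq (sup_comm _ _)))
            (sup_le le_sup_left ((le_crename_sup h _).trans_eq (sup_comm _ _)))
        rw [sup_assoc, h3, ← sup_assoc, ex_sup_of_notMem _ (notMem_cfv_eqns hyg hy),
          ex_sup_of_notMem _ (notMem_cfv_eqns hyg hy), ex_sup_eqn_var', swapTo_exs hx hyg,
          notMem_cfv.1 (notMem_cfv_exs g (notMem_cfv_swapTo x y (s n)))]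
      constructor
      · intro hs
        exact paramDen_of_ex_eq hI (hD p).pfv_subset hyg (fun n => (h2 n).symm)
          (paramDen_of_ex_eq hI (hD p).pfv_subset hx h1 hs)
      · intro hs
        exact paramDen_of_ex_eq hI (hD p).pfv_subset hx (fun n => (h1 n).symm)
          (paramDen_of_ex_eq hI (hD p).pfv_subset hyg h2 hs)
    constructor <;> rintro ⟨G, hG, hs⟩ <;>
      refine ⟨G ∪ {x, y}, hG.union (by simp), fun g hg => ?_⟩
    · exact (key g (fun h' => hg.2.2 x h' (by simp)) fun h' => hg.2.2 y h' (by simp)).1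
        (hs g (hg.mono Set.subset_union_left))
    · exact (key g (fun h' => hg.2.2 x h' (by simp)) fun h' => hg.2.2 y h' (by simp)).2
        (hs g (hg.mono Set.subset_union_left))

/-- Finite approximations from above of the weaker denotation of the calls. -/
def approx (D : N → Decl L V C N) : ℕ → Interp L V C N
  | 0 => fun _ _ => Set.univ
  | n + 1 => fun p ts => callDen (approx D n) (D p) ts

theorem approx_tame {D : N → Decl L V C N} (hD : ∀ p, (D p).Closed) (n : ℕ) :
    (approx D n).Tame := by
  induction n with
  | zero => exact ⟨fun _ _ _ _ _ _ _ _ => trivial, fun _ _ _ _ _ _ _ => Iff.rfl⟩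
  | succ n ih => exact callDen_tame ih hD

theorem approx_succ_le (D : N → Decl L V C N) (n : ℕ) : approx D (n + 1) ≤ approx D n := by
  induction n with
  | zero => exact fun _ _ _ _ => trivial
  | succ n ih => exact fun p ts => callDen_mono ih (D p) ts

theorem gfp_consequence_le_approx [Infinite V] {D : N → Decl L V C N} (hD : ∀ p, (D p).Closed)
    (n : ℕ) : OrderHom.gfp (consequence D) ≤ approx D n := by
  induction n with
  | zero => exact fun _ _ _ _ => trivial
  | succ n ih =>
    intro p ts s hs
    rw [← OrderHom.map_gfp] at hs
    obtain ⟨ε, hε, ha, hs⟩ := hs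
    exact (hε.mem_callDen_iff (approx_tame hD n) (hD p) ha s).2 (den_subset_weakDen ih _ hs)

theorem semantics_subset_weakDen [Infinite V] {D : N → Decl L V C N} (hD : ∀ p, (D p).Closed)
    (n : ℕ) (P : Proc L V C N) : semantics D P ⊆ weakDen (approx D n) P :=
  den_subset_weakDen (gfp_consequence_le_approx hD n) P

theorem Proc.Congr.weakDen_eq {I : Interp L V C N} (hI : I.Tame) {P Q : Proc L V C N}
    (h : P.Congr Q) : weakDen I P = weakDen I Q := by
  induction h with
  | refl P => rfl
  | symm _ ih => exact ih.symm
  | trans _ _ ih1 ih2 => exact ih1.trans ih2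
  | abs _ ih => simp only [weakDen, ih]
  | par _ _ ih1 ih2 => simp only [weakDen, ih1, ih2]
  | loc _ ih => simp only [weakDen, ih]
  | nxt _ ih => simp only [weakDen, ih]
  | unl _ ih => simp only [weakDen, ih]
  | bang _ ih => simp only [weakDen, ih]
  | alpha_loc hx hyx hy => exact (weakDen_loc_rename hI hx hyx hy).symm
  -- The parameters are nonempty, so the clause matters only if cylindrification is trivial, and
  -- then renaming and swapping do nothing.
  | @alpha_abs xs x y c E P hx hy =>
    simp only [Proc.occ, Set.mem_union, not_or] at hy
    have h : x ≠ y := fun e => hy.1.1.1 (e ▸ hx)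
    have hne : xs ≠ [] := List.ne_nil_of_mem hx
    ext s
    change (_ → _ → _) ↔ (_ → _ → _)
    simp only [hne, List.map_eq_nil_iff, false_or]
    refine forall_congr' fun hd => ?_
    rw [mem_weakDen_rename_iff hI h hy.2, hd.crename_eq h]
    simp only [hd.swapTo_eq h]
  | par_skip P => simp [weakDen]
  | par_comm P Q => exact Set.inter_comm _ _
  | par_assoc P Q R => exact (Set.inter_assoc _ _ _).symm

end Calls

section Triangular

variable {L : FirstOrder.Language.{u, v}} {V : Type} {C : Type w} [DecidableEq V]
  [ConstraintSystem L V C]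

/-! ### Systems of equations in triangular form -/

/-- `e` entails the equations `E`, which define their left-hand sides without using `us`. -/
structure Defines (e : C) (us : List V) (E : List (V × L.Term V)) : Prop where
  mem : ∀ p ∈ E, p.1 ∉ p.2.varFinset ∧ p.1 ∉ us ∧ (∀ z ∈ us, z ∉ p.2.varFinset) ∧
    (eqn p.1 p.2 : C) ≤ e
  tri : E.Pairwise fun p q => q.1 ∉ p.2.varFinset

theorem Defines.nil (e : C) (us : List V) : Defines e us ([] : List (V × L.Term V)) :=
  ⟨by simp, List.Pairwise.nil⟩

theorem Defines.mono {e e' : C} {us : List V} {E : List (V × L.Term V)} (h : Defines e us E)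
    (he : e ≤ e') : Defines e' us E :=
  ⟨fun p hp => ⟨(h.mem p hp).1, (h.mem p hp).2.1, (h.mem p hp).2.2.1,
    (h.mem p hp).2.2.2.trans he⟩, h.tri⟩

theorem Defines.subset {e : C} {us vs : List V} {E : List (V × L.Term V)} (h : Defines e us E)
    (hv : vs ⊆ us) : Defines e vs E :=
  ⟨fun p hp => ⟨(h.mem p hp).1, fun h' => (h.mem p hp).2.1 (hv h'),
    fun z hz => (h.mem p hp).2.2.1 z (hv hz), (h.mem p hp).2.2.2⟩, h.tri⟩

/-- The equations do not mention `us`, so they are still entailed by `∃us a`, to which the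
triangular elimination applies. -/
theorem Defines.exs_le {e : C} {us : List V} {E : List (V × L.Term V)} (h : Defines e us E)
    {a : C} (ha : e ≤ a) : exs us a ≤ e ⊔ exs (us ++ E.map Prod.fst) a := by
  rw [exs_append, exs_comm]
  refine le_sup_exs_of_triangular (fun p hp => ?_) h.tri
  obtain ⟨h1, h2, h3, h4⟩ := h.mem p hp
  refine ⟨h1, h4, ?_⟩
  rw [← exs_of_notMem (xs := us) (c := (eqn p.1 p.2 : C)) fun z hz => notMem_cfv_eqn
    (ne_of_mem_of_not_mem hz h2) (h3 z hz)]
  exact exs_mono _ (h4.trans ha)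

theorem Defines.append {e : C} {us : List V} {E F : List (V × L.Term V)}
    (hE : Defines e (us ++ F.map Prod.fst) E) (hF : Defines e us F) : Defines e us (E ++ F) := by
  refine ⟨fun p hp => ?_, List.pairwise_append.2 ⟨hE.tri, hF.tri, fun p hp q hq => ?_⟩⟩
  · rcases List.mem_append.1 hp with hp | hp
    · exact (hE.subset (List.subset_append_left _ _)).mem p hp
    · exact hF.mem p hp
  · exact (hE.mem p hp).2.2.1 q.1 (List.mem_append_right _ (List.mem_map_of_mem hq))

/-- A term may mention `z` although `e` does not depend on it. Replacing `z` by a fresh `y` gives an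
equation entailed by `e ⊔ z = y`; quantifying `z` then shows that `e` alone entails it. -/
theorem Defines.avoid [Infinite V] {e : C} {us : List V} {E : List (V × L.Term V)}
    (h : Defines e us E) {z : V} (hz : z ∉ cfv e) (hzE : z ∉ E.map Prod.fst) :
    ∃ F : List (V × L.Term V), F.map Prod.fst = E.map Prod.fst ∧ Defines e (z :: us) F := by
  obtain ⟨y, hy⟩ := Infinite.exists_notMem_finset
    (insert z (us.toFinset ∪ (E.map Prod.fst).toFinset))
  simp only [Finset.mem_insert, Finset.mem_union, List.mem_toFinset, not_or] at hy
  obtain ⟨hyz, hyus, hyE⟩ := hy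
  have hrel : ∀ (t : L.Term V) (a : V), a ≠ y → a ∉ t.varFinset →
      a ∉ (t.relabel (vrename z y)).varFinset := by
    intro t a ha ht hm
    obtain ⟨b, hb, rfl⟩ := mem_varFinset_relabel.1 hm
    by_cases hbz : b = z
    · rw [hbz, vrename_self] at ha; exact ha rfl
    · rw [vrename_of_ne hbz] at ht; exact ht hb
  refine ⟨E.map fun p => (p.1, p.2.relabel (vrename z y)), by simp, fun p hp => ?_, ?_⟩
  · obtain ⟨q, hq, rfl⟩ := List.mem_map.1 hp
    obtain ⟨h1, h2, h3, h4⟩ := h.mem q hq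
    have hqE : q.1 ∈ E.map Prod.fst := List.mem_map_of_mem hq
    have hqz : q.1 ≠ z := ne_of_mem_of_not_mem hqE hzE
    have hzt := notMem_relabel_vrename (Ne.symm hyz) q.2
    refine ⟨hrel _ _ (ne_of_mem_of_not_mem hqE hyE) h1, ?_, ?_, ?_⟩
    · rw [List.mem_cons, not_or]; exact ⟨hqz, h2⟩
    · intro a ha
      rcases List.mem_cons.1 ha with rfl | ha
      · exact hzt
      · exact hrel _ _ (ne_of_mem_of_not_mem ha hyus) (h3 a ha)
    · have h5 : (eqn q.1 (q.2.relabel (vrename z y)) : C) ≤ eqn z (Term.var y) ⊔ e :=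
        (eqn_congr z y q.1 q.2).trans (sup_le_sup_left h4 _)
      have h6 := ex_mono z _ _ h5
      rwa [ex_sup_of_notMem _ hz, ex_eqn_var (Ne.symm hyz), bot_sup_eq,
        notMem_cfv.1 (notMem_cfv_eqn (Ne.symm hqz) hzt)] at h6
  · rw [List.pairwise_map]
    exact h.tri.imp_of_mem fun {p q} _ hq hpq =>
      hrel _ _ (ne_of_mem_of_not_mem (List.mem_map.2 ⟨q, hq, rfl⟩) hyE) hpq

theorem Defines.avoid_list [Infinite V] {e : C} {us : List V} {E : List (V × L.Term V)}
    (h : Defines e us E) {zs : List V} (hz : ∀ z ∈ zs, z ∉ cfv e)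
    (hzE : ∀ z ∈ zs, z ∉ E.map Prod.fst) :
    ∃ F : List (V × L.Term V), F.map Prod.fst = E.map Prod.fst ∧ Defines e (zs ++ us) F := by
  induction zs with
  | nil => exact ⟨E, rfl, h⟩
  | cons z zs ih =>
    obtain ⟨F, hF, hd⟩ := ih (fun y hy => hz y (List.mem_cons_of_mem _ hy))
      fun y hy => hzE y (List.mem_cons_of_mem _ hy)
    obtain ⟨F', hF', hd'⟩ := hd.avoid (hz z List.mem_cons_self)
      (hF ▸ hzE z List.mem_cons_self)
    exact ⟨F', hF'.trans hF, hd'⟩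

theorem Defines.rename [Infinite V] {e : C} {us : List V} {E : List (V × L.Term V)}
    (h : Defines e us E) {x y : V} (hxy : x ≠ y) (hy : y ∉ cfv e) (hyus : y ∉ us)
    (hyE : y ∉ E.map Prod.fst) :
    ∃ F : List (V × L.Term V), F.map Prod.fst = (E.map Prod.fst).map (vrename x y) ∧
      Defines (crename x y e) (us.map (vrename x y)) F := by
  -- With `y` absent from the terms, the renaming is injective on all variables that remain.
  obtain ⟨F, hF, hd⟩ := h.avoid hy hyE
  have hF1 : ∀ p ∈ F, p.1 ≠ y := fun p hp =>
    ne_of_mem_of_not_mem (List.mem_map_of_mem hp) (hF ▸ hyE)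
  have hF2 : ∀ p ∈ F, y ∉ p.2.varFinset := fun p hp => (hd.mem p hp).2.2.1 y List.mem_cons_self
  have hrel : ∀ p ∈ F, ∀ a, a ≠ y → a ∉ p.2.varFinset →
      vrename x y a ∉ (p.2.relabel (vrename x y)).varFinset := by
    intro p hp a ha ht hm
    obtain ⟨b, hb, hba⟩ := mem_varFinset_relabel.1 hm
    exact ht (vrename_inj (ne_of_mem_of_not_mem hb (hF2 p hp)) ha hba ▸ hb)
  refine ⟨F.map fun p => (vrename x y p.1, p.2.relabel (vrename x y)), ?_, fun p hp => ?_, ?_⟩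
  · rw [← hF]; simp
  · obtain ⟨q, hq, rfl⟩ := List.mem_map.1 hp
    obtain ⟨h1, h2, h3, h4⟩ := hd.mem q hq
    refine ⟨hrel q hq _ (hF1 q hq) h1, fun hm => ?_, fun a ha => ?_, ?_⟩
    · obtain ⟨b, hb, hbq⟩ := List.mem_map.1 hm
      exact h2 (List.mem_cons_of_mem _
        (vrename_inj (ne_of_mem_of_not_mem hb hyus) (hF1 q hq) hbq ▸ hb))
    · obtain ⟨b, hb, rfl⟩ := List.mem_map.1 ha
      exact hrel q hq b (ne_of_mem_of_not_mem hb hyus) (h3 b (List.mem_cons_of_mem _ hb))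
    · rw [← crename_eqn hxy (hF2 q hq) fun e => e ▸ h1]
      exact crename_mono _ _ h4
  · rw [List.pairwise_map]
    exact hd.tri.imp_of_mem fun {p q} hp hq hpq => hrel p hp _ (hF1 q hq) hpq

theorem Adm.defines {xs : List V} {ts : List (L.Term V)} (h : Adm xs ts) {e : C}
    (he : eqns xs ts ≤ e) : Defines e [] (xs.zip ts) where
  mem p hp := ⟨notMem_of_mem_zip h hp (List.of_mem_zip (a := p.1) (b := p.2) hp).1, by simp,
    by simp, (eqn_le_eqns hp).trans he⟩
  tri := List.Pairwise.imp_of_mem (R := fun _ _ => True)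
    (fun {p q} hp hq _ => notMem_of_mem_zip h hp (List.of_mem_zip (a := q.1) (b := q.2) hq).1)
    (List.pairwise_of_forall fun _ _ => trivial)

/-- `e` determines the variables `xs` except for `us`. -/
def Determined (e : C) (xs us : List V) : Prop :=
  ∃ E : List (V × L.Term V), E.map Prod.fst ⊆ xs ∧ xs ⊆ us ++ E.map Prod.fst ∧ Defines e us E

theorem Determined.rename [Infinite V] {e : C} {xs us : List V} (h : Determined e xs us)
    (hus : us ⊆ xs) {x y : V} (hxy : x ≠ y) (hy : y ∉ cfv e) (hyxs : y ∉ xs) :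
    Determined (crename x y e) (xs.map (vrename x y)) (us.map (vrename x y)) := by
  obtain ⟨E, h1, h2, h3⟩ := h
  obtain ⟨F, hF, hd⟩ := h3.rename hxy hy (fun h' => hyxs (hus h')) fun h' => hyxs (h1 h')
  refine ⟨F, hF ▸ List.map_subset _ h1, ?_, hd⟩
  rw [hF, ← List.map_append]
  exact List.map_subset _ h2

end Triangular

/-! ### Local independence as a semantic property, and its invariance under structural congruence -/

section Independence

variable {L : FirstOrder.Language.{u, v}} {V : Type} {C : Type w} {N : Type r} [DecidableEq V]
  [ConstraintSystem L V C]

namespace Proc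

theorem calls_rename (x y : V) (P : Proc L V C N) : (P.rename x y).calls = P.calls := by
  induction P with
  | abs xs c E P ih => simp only [rename]; split_ifs <;> simp only [calls, ih]
  | loc xs P ih => simp only [rename]; split_ifs <;> simp only [calls, ih]
  | _ => simp_all only [rename, calls]

theorem noUnless_rename (x y : V) (P : Proc L V C N) :
    (P.rename x y).NoUnless ↔ P.NoUnless := by
  induction P with
  | abs xs c E P ih => simp only [rename]; split_ifs <;> simp only [NoUnless, ih]
  | loc xs P ih => simp only [rename]; split_ifs <;> simp only [NoUnless, ih]
  | _ => simp_all only [rename, NoUnless]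

theorem Congr.calls_eq {P Q : Proc L V C N} (h : P.Congr Q) : P.calls = Q.calls := by
  induction h with
  | symm _ ih => exact ih.symm
  | trans _ _ ih1 ih2 => exact ih1.trans ih2
  | alpha_loc => simp only [calls, calls_rename]
  | alpha_abs => simp only [calls, calls_rename]
  | par_skip P => simp [calls]
  | par_comm P Q => simp [calls, Set.union_comm]
  | par_assoc P Q R => simp [calls, Set.union_assoc]
  | _ => simp_all only [calls]

theorem Congr.noUnless_iff {P Q : Proc L V C N} (h : P.Congr Q) : P.NoUnless ↔ Q.NoUnless := by
  induction h with
  | symm _ ih => exact ih.symm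
  | trans _ _ ih1 ih2 => exact ih1.trans ih2
  | alpha_loc => simp only [NoUnless, noUnless_rename]
  | alpha_abs => simp only [NoUnless, noUnless_rename]
  | par_skip P => simp [NoUnless]
  | par_comm P Q => simp [NoUnless, and_comm]
  | par_assoc P Q R => simp [NoUnless, and_assoc]
  | _ => simp_all only [NoUnless]

theorem Congr.now_eq {P Q : Proc L V C N} (h : P.Congr Q) : P.now = Q.now := by
  induction h with
  | symm _ ih => exact ih.symm
  | trans _ _ ih1 ih2 => exact ih1.trans ih2
  | par_skip P => simp [now]
  | par_comm P Q => simp [now, sup_comm]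
  | par_assoc P Q R => simp [now, sup_assoc]
  | _ => simp_all only [now]

theorem Congr.always_eq {P Q : Proc L V C N} (h : P.Congr Q) : P.always = Q.always := by
  induction h with
  | symm _ ih => exact ih.symm
  | trans _ _ ih1 ih2 => exact ih1.trans ih2
  | par_skip P => simp [always]
  | par_comm P Q => simp [always, sup_comm]
  | par_assoc P Q R => simp [always, sup_assoc]
  | bang h _ => exact h.now_eq
  | _ => simp_all only [always]

theorem Congr.later_eq {P Q : Proc L V C N} (h : P.Congr Q) : P.later = Q.later := by
  induction h with
  | symm _ ih => exact ih.symm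
  | trans _ _ ih1 ih2 => exact ih1.trans ih2
  | par_skip P => simp [later]
  | par_comm P Q => simp [later, sup_comm]
  | par_assoc P Q R => simp [later, sup_assoc]
  | nxt h _ => exact h.always_eq
  | _ => simp_all only [later]

theorem image_vrename_diff_map {x y : V} {s : Set V} {xs : List V} (hx : x ∈ xs) (hy : y ∉ xs)
    (hs : y ∉ s) : (vrename x y '' s) \ {z | z ∈ xs.map (vrename x y)} = s \ {z | z ∈ xs} := by
  ext z
  constructor
  · rintro ⟨⟨a, ha, rfl⟩, h⟩
    have : a ∉ xs := fun h' => h (List.mem_map_of_mem h')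
    rw [vrename_of_ne (ne_of_mem_of_not_mem hx this).symm]
    exact ⟨ha, this⟩
  · rintro ⟨hz, h⟩
    have hzx : z ≠ x := fun e => h (e ▸ hx)
    refine ⟨⟨z, hz, vrename_of_ne hzx⟩, fun hm => ?_⟩
    rcases mem_of_mem_map_vrename hm with rfl | hm
    · exact hs hz
    · exact h hm

theorem Congr.pfv_eq {P Q : Proc L V C N} (h : P.Congr Q) : P.pfv = Q.pfv := by
  induction h with
  | symm _ ih => exact ih.symm
  | trans _ _ ih1 ih2 => exact ih1.trans ih2
  | @alpha_loc xs x y P hx hyx hy =>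
    have hxy : x ≠ y := fun e => hyx (e ▸ hx)
    simp only [pfv]
    rw [pfv_rename hxy hy, image_vrename_diff_map hx hyx fun h' => hy (P.pfv_subset_occ h')]
  | @alpha_abs xs x y c E P hx hy =>
    simp only [Proc.occ, Set.mem_union, not_or] at hy
    have hxy : x ≠ y := fun e => hy.1.1.1 (e ▸ hx)
    simp only [pfv]
    rw [pfv_rename hxy hy.2, cfv_crename hxy hy.1.1.2, ← Set.image_union,
      image_vrename_diff_map hx hy.1.1.1]
    exact fun h' => h'.elim hy.1.1.2 fun h' => hy.2 (P.pfv_subset_occ h')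
  | par_skip P => simp [pfv]
  | par_comm P Q => simp [pfv, Set.union_comm]
  | par_assoc P Q R => simp [pfv, Set.union_assoc]
  | _ => simp_all only [pfv]

theorem occ_rename_finite_iff {x y : V} (h : x ≠ y) {P : Proc L V C N} (hy : y ∉ P.occ) :
    (P.rename x y).occ.Finite ↔ P.occ.Finite := by
  obtain ⟨h1, h2⟩ := occ_rename_subset h P hy
  exact ⟨fun hf => (hf.union (Set.finite_singleton _)).subset h2,
    fun hf => (hf.union (Set.finite_singleton _)).subset h1⟩

theorem Congr.occ_finite_iff {P Q : Proc L V C N} (h : P.Congr Q) :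
    P.occ.Finite ↔ Q.occ.Finite := by
  induction h with
  | symm _ ih => exact ih.symm
  | trans _ _ ih1 ih2 => exact ih1.trans ih2
  | @alpha_loc xs x y P hx hyx hy =>
    have hxy : x ≠ y := fun e => hyx (e ▸ hx)
    simp only [occ, Set.finite_union, occ_rename_finite_iff hxy hy]
    exact and_congr_left fun _ => iff_of_true (List.finite_toSet _) (List.finite_toSet _)
  | @alpha_abs xs x y c E P hx hy =>
    simp only [Proc.occ, Set.mem_union, not_or] at hy
    have hxy : x ≠ y := fun e => hy.1.1.1 (e ▸ hx)
    have hc : (cfv (crename x y c)).Finite ↔ (cfv c).Finite := by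
      rw [cfv_crename hxy hy.1.1.2]
      refine Set.finite_image_iff fun a ha b hb e => vrename_inj ?_ ?_ e
      · exact ne_of_mem_of_not_mem ha hy.1.1.2
      · exact ne_of_mem_of_not_mem hb hy.1.1.2
    simp only [occ, Set.finite_union, occ_rename_finite_iff hxy hy.2, hc]
    have h1 : {z | z ∈ xs}.Finite ↔ {z | z ∈ xs.map (vrename x y)}.Finite :=
      iff_of_true (List.finite_toSet _) (List.finite_toSet _)
    rw [h1]
  | par_skip P => simp [occ]
  | par_comm P Q => simp [occ, Set.union_comm]
  | par_assoc P Q R => simp [occ, Set.union_assoc]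
  | _ => simp_all only [occ, Set.finite_union]

/-- The parameters of each parametric ask are pairwise distinct. -/
def Proper : Proc L V C N → Prop
  | abs xs _ _ P => xs.Nodup ∧ P.Proper
  | par P Q => P.Proper ∧ Q.Proper
  | loc _ P => P.Proper
  | nxt P => P.Proper
  | unl _ P => P.Proper
  | bang P => P.Proper
  | _ => True

theorem WellFormed.proper {P : Proc L V C N} (h : P.WellFormed) : P.Proper := by
  induction P with
  | abs xs c E P ih => exact ⟨h.1, ih h.2.2⟩
  | par P Q ihP ihQ => exact ⟨ihP h.1, ihQ h.2⟩
  | loc xs P ih => exact ih h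
  | nxt P ih => exact ih h
  | unl c P ih => exact ih h
  | bang P ih => exact ih h
  | _ => trivial

theorem proper_rename (x y : V) (P : Proc L V C N) : (P.rename x y).Proper ↔ P.Proper := by
  induction P with
  | abs xs c E P ih => simp only [rename]; split_ifs <;> simp only [Proper, ih]
  | loc xs P ih => simp only [rename]; split_ifs <;> simp only [Proper, ih]
  | _ => simp_all only [rename, Proper]

theorem Congr.proper_iff {P Q : Proc L V C N} (h : P.Congr Q) : P.Proper ↔ Q.Proper := by
  induction h with
  | symm _ ih => exact ih.symm
  | trans _ _ ih1 ih2 => exact ih1.trans ih2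
  | alpha_loc => simp only [Proper, proper_rename]
  | @alpha_abs xs x y c E P hx hy =>
    simp only [Proc.occ, Set.mem_union, not_or] at hy
    simp only [Proper, proper_rename, nodup_map_vrename_iff hy.1.1.1]
  | par_skip P => simp [Proper]
  | par_comm P Q => simp [Proper, and_comm]
  | par_assoc P Q R => simp [Proper, and_assoc]
  | _ => simp_all only [Proper]

end Proc

theorem unlessFree_of_calls {D : N → Decl L V C N} {P Q : Proc L V C N} (h : UnlessFree D P)
    (hn : Q.NoUnless) (hc : ∀ p ∈ Q.calls, Reaches D P p) : UnlessFree D Q :=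
  ⟨hn, fun p hp => h.2 p (by
    induction hp with
    | call hp => exact hc _ hp
    | step _ hq ih => exact ih.step hq)⟩

theorem unlessFree_of_calls_subset {D : N → Decl L V C N} {P Q : Proc L V C N}
    (h : UnlessFree D P) (hn : Q.NoUnless) (hc : Q.calls ⊆ P.calls) : UnlessFree D Q :=
  unlessFree_of_calls h hn fun _ hp => .call (hc hp)

theorem unlessFree_congr {D : N → Decl L V C N} {P Q : Proc L V C N} (hn : P.NoUnless ↔ Q.NoUnless)
    (hc : P.calls = Q.calls) : UnlessFree D P ↔ UnlessFree D Q :=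
  ⟨fun h => unlessFree_of_calls_subset h (hn.1 h.1) hc.ge,
    fun h => unlessFree_of_calls_subset h (hn.2 h.1) hc.le⟩

namespace Proc

/-- The top-level components of the process that contain or call `unless` do not depend on `us`. -/
def Separated (D : N → Decl L V C N) (us : List V) : Proc L V C N → Prop
  | par P Q => P.Separated D us ∧ Q.Separated D us
  | P => UnlessFree D P ∨ ∀ u ∈ us, u ∉ P.pfv

theorem separated_of_or {D : N → Decl L V C N} {us : List V} {P : Proc L V C N}
    (h : UnlessFree D P ∨ ∀ u ∈ us, u ∉ P.pfv) : P.Separated D us := by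
  induction P with
  | par P Q ihP ihQ =>
    rcases h with h | h
    · exact ⟨ihP (Or.inl (unlessFree_of_calls_subset h h.1.1 Set.subset_union_left)),
        ihQ (Or.inl (unlessFree_of_calls_subset h h.1.2 Set.subset_union_right))⟩
    · exact ⟨ihP (Or.inr fun u hu h' => h u hu (Or.inl h')),
        ihQ (Or.inr fun u hu h' => h u hu (Or.inr h'))⟩
  | _ => exact h

theorem Separated.append {D : N → Decl L V C N} {us vs : List V} {P : Proc L V C N}
    (h : P.Separated D us) (h' : P.Separated D vs) : P.Separated D (us ++ vs) := by
  induction P with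
  | par P Q ihP ihQ => exact ⟨ihP h.1 h'.1, ihQ h.2 h'.2⟩
  | _ =>
    rcases h with h | h
    · exact Or.inl h
    rcases h' with h' | h'
    · exact Or.inl h'
    exact Or.inr fun u hu => (List.mem_append.1 hu).elim (h u) (h' u)

theorem separated_rename_iff {D : N → Decl L V C N} {us : List V} {P : Proc L V C N} {x y : V}
    (h : x ≠ y) (hy : y ∉ P.occ) (hyus : y ∉ us) :
    (P.rename x y).Separated D (us.map (vrename x y)) ↔ P.Separated D us := by
  have key : ∀ Q : Proc L V C N, y ∉ Q.occ →
      ((UnlessFree D (Q.rename x y) ∨ ∀ u ∈ us.map (vrename x y), u ∉ (Q.rename x y).pfv) ↔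
        (UnlessFree D Q ∨ ∀ u ∈ us, u ∉ Q.pfv)) := by
    intro Q hQ
    refine or_congr (unlessFree_congr (noUnless_rename x y Q) (calls_rename x y Q)) ?_
    rw [pfv_rename h hQ, List.forall_mem_map]
    refine forall₂_congr fun u hu => not_congr ⟨?_, fun hm => ⟨u, hm, rfl⟩⟩
    rintro ⟨a, ha, hau⟩
    exact vrename_inj (ne_of_mem_of_not_mem ha fun h' => hQ (Q.pfv_subset_occ h'))
      (ne_of_mem_of_not_mem hu hyus) hau ▸ ha
  induction P with
  | par P Q ihP ihQ =>
    simp only [Proc.occ, Set.mem_union, not_or] at hy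
    exact and_congr (ihP hy.1) (ihQ hy.2)
  | abs xs c E P =>
    have := key _ hy
    simp only [rename] at this ⊢
    split_ifs at this ⊢ <;> exact this
  | loc xs P =>
    have := key _ hy
    simp only [rename] at this ⊢
    split_ifs at this ⊢ <;> exact this
  | _ => exact key _ hy

theorem Congr.separated_iff {D : N → Decl L V C N} {us : List V} {P Q : Proc L V C N}
    (h : P.Congr Q) : P.Separated D us ↔ Q.Separated D us := by
  have key : ∀ P Q : Proc L V C N, P.Congr Q → ((UnlessFree D P ∨ ∀ u ∈ us, u ∉ P.pfv) ↔
      (UnlessFree D Q ∨ ∀ u ∈ us, u ∉ Q.pfv)) := fun P Q h => by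
    rw [unlessFree_congr h.noUnless_iff h.calls_eq, h.pfv_eq]
  induction h with
  | refl => rfl
  | symm _ ih => exact ih.symm
  | trans _ _ ih1 ih2 => exact ih1.trans ih2
  | par _ _ ih1 ih2 => exact and_congr ih1 ih2
  | par_skip P => exact and_iff_left (Or.inr fun _ _ h => h)
  | par_comm P Q => exact and_comm
  | par_assoc P Q R => exact and_assoc.symm
  | abs h => exact key _ _ (.abs h)
  | loc h => exact key _ _ (.loc h)
  | nxt h => exact key _ _ (.nxt h)
  | unl h => exact key _ _ (.unl h)
  | bang h => exact key _ _ (.bang h)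
  | alpha_loc h1 h2 h3 => exact key _ _ (.alpha_loc h1 h2 h3)
  | alpha_abs h1 h2 => exact key _ _ (.alpha_abs h1 h2)

/-- Apart from variables on which `unless` does not depend, the variables `xs` are determined by
the equations that are told for ever. -/
def Splits (D : N → Decl L V C N) (xs : List V) (P : Proc L V C N) : Prop :=
  ∃ us, us ⊆ xs ∧ P.Separated D us ∧ Determined P.always xs us

theorem splits_rename_iff [Infinite V] {D : N → Decl L V C N} {xs : List V} {P : Proc L V C N}
    {x y : V} (h : x ≠ y) (hy : y ∉ P.occ) (hyxs : y ∉ xs) :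
    (P.rename x y).Splits D (xs.map (vrename x y)) ↔ P.Splits D xs := by
  have hya : y ∉ cfv P.always := fun h' => hy (P.pfv_subset_occ (P.cfv_always_subset h'))
  constructor
  · rintro ⟨us, h1, h2, h3⟩
    have hx := notMem_map_vrename h xs
    have hyus : y ∉ us.map (vrename y x) := notMem_map_vrename h.symm us
    have hus : (us.map (vrename y x)).map (vrename x y) = us :=
      map_vrename_vrename fun h' => hx (h1 h')
    refine ⟨us.map (vrename y x), ?_, ?_, ?_⟩
    · have := List.map_subset (vrename y x) h1
      rwa [map_vrename_vrename hyxs] at this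
    · rwa [← separated_rename_iff h hy hyus, hus]
    · have h4 : x ∉ cfv (P.rename x y).always := by
        rw [always_rename h hy]; exact notMem_cfv_crename _ _ _
      have := h3.rename h1 h.symm h4 hx
      rwa [always_rename h hy, crename_crename h hya, map_vrename_vrename hyxs] at this
  · rintro ⟨us, h1, h2, h3⟩
    refine ⟨us.map (vrename x y), List.map_subset _ h1,
      (separated_rename_iff h hy fun h' => hyxs (h1 h')).2 h2, ?_⟩
    rw [always_rename h hy]
    exact h3.rename h1 h hya hyxs

theorem Congr.splits_iff {D : N → Decl L V C N} {xs : List V} {P Q : Proc L V C N}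
    (h : P.Congr Q) : P.Splits D xs ↔ Q.Splits D xs := by
  simp only [Splits, h.separated_iff, h.always_eq]

/-- A semantic form of local independence that is preserved by execution. -/
def Independent (D : N → Decl L V C N) : Proc L V C N → Prop
  | abs _ _ _ P => P.Independent D
  | par P Q => P.Independent D ∧ Q.Independent D
  | loc xs P => P.Independent D ∧ P.Splits D xs
  | nxt P => P.Independent D
  | unl _ P => P.Independent D
  | bang P => P.Independent D
  | _ => True

/-- One extreme: no component contains or calls `unless`, so all of `xs` may stay undetermined and
no equations are needed. -/
theorem splits_of_unlessFree {D : N → Decl L V C N} (xs : List V) {P : Proc L V C N}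
    (h : UnlessFree D P) : P.Splits D xs :=
  ⟨xs, List.Subset.refl _, separated_of_or (Or.inl h), [], by simp, by simp, .nil _ _⟩

theorem independent_of_localsUnlessFree {D : N → Decl L V C N} {P : Proc L V C N}
    (h : LocalsUnlessFree D P) : P.Independent D := by
  induction P with
  | abs xs c E P ih => exact ih h
  | par P Q ihP ihQ => exact ⟨ihP h.1, ihQ h.2⟩
  | loc xs P ih => exact ⟨ih h.2, splits_of_unlessFree xs h.1⟩
  | nxt P ih => exact ih h
  | unl c P ih => exact ih h
  | bang P ih => exact ih h
  | _ => trivial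

theorem independent_rename_iff [Infinite V] {D : N → Decl L V C N} {P : Proc L V C N} {x y : V}
    (h : x ≠ y) (hy : y ∉ P.occ) : (P.rename x y).Independent D ↔ P.Independent D := by
  induction P with
  | abs xs c E P ih =>
    simp only [Proc.occ, Set.mem_union, not_or] at hy
    simp only [rename]; split_ifs <;> simp only [Independent, ih hy.2]
  | par P Q ihP ihQ =>
    simp only [Proc.occ, Set.mem_union, not_or] at hy
    exact and_congr (ihP hy.1) (ihQ hy.2)
  | loc xs P ih =>
    simp only [Proc.occ, Set.mem_union, not_or] at hy
    simp only [rename]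
    split_ifs with hx
    · rfl
    · have := splits_rename_iff (D := D) h hy.2 hy.1
      rw [map_vrename_of_notMem hx] at this
      simp only [Independent, ih hy.2, this]
  | nxt P ih => exact ih hy
  | unl c P ih =>
    simp only [Proc.occ, Set.mem_union, not_or] at hy
    exact ih hy.2
  | bang P ih => exact ih hy
  | _ => rfl

theorem Congr.independent_iff [Infinite V] {D : N → Decl L V C N} {P Q : Proc L V C N}
    (h : P.Congr Q) : P.Independent D ↔ Q.Independent D := by
  induction h with
  | symm _ ih => exact ih.symm
  | trans _ _ ih1 ih2 => exact ih1.trans ih2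
  | loc h ih => simp only [Independent, ih, h.splits_iff]
  | alpha_loc hx hyx hy =>
    have h := ne_of_mem_of_not_mem hx hyx
    simp only [Independent, independent_rename_iff h hy, splits_rename_iff h hy hyx]
  | alpha_abs hx hy =>
    simp only [Proc.occ, Set.mem_union, not_or] at hy
    have h := ne_of_mem_of_not_mem hx hy.1.1.1
    simp only [Independent, independent_rename_iff h hy.2]
  | par_skip P => simp [Independent]
  | par_comm P Q => simp [Independent, and_comm]
  | par_assoc P Q R => simp [Independent, and_assoc]
  | _ => simp_all only [Independent]

/-- The other extreme: the body may contain `unless`, but every local variable is determined by the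
replicated equations `xs = ts`. -/
theorem independent_subst {D : N → Decl L V C N} {P : Proc L V C N} (hP : P.Independent D)
    {xs : List V} {ts : List (L.Term V)} (h : Adm xs ts) : (P.subst xs ts).Independent D := by
  refine ⟨⟨trivial, hP⟩, [], by simp, separated_of_or (Or.inr (by simp)), xs.zip ts, ?_, ?_,
    h.defines ?_⟩
  · rw [List.map_fst_zip h.1.le]; exact List.Subset.refl _
  · rw [List.map_fst_zip h.1.le]; exact List.Subset.refl _
  · exact le_sup_left

end Proc

end Independence

section Restless

variable {L : FirstOrder.Language.{u, v}} {V : Type} {C : Type w} {N : Type r} [DecidableEq V]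
  [ConstraintSystem L V C]

/-! ### Basic properties of the internal transition -/

/-- The constraints that are told in the current time unit. -/
def Proc.live (P : Proc L V C N) : C := P.now ⊔ P.always

/-- The constraints that are told from the next time unit on. -/
def Proc.persistent (P : Proc L V C N) : C := P.always ⊔ P.later

theorem Proc.Congr.live_eq {P Q : Proc L V C N} (h : P.Congr Q) : P.live = Q.live := by
  rw [live, live, h.now_eq, h.always_eq]

theorem Proc.Congr.persistent_eq {P Q : Proc L V C N} (h : P.Congr Q) :
    P.persistent = Q.persistent := by
  rw [persistent, persistent, h.always_eq, h.later_eq]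

theorem Proc.live_par (P Q : Proc L V C N) : (par P Q).live = P.live ⊔ Q.live :=
  sup_sup_sup_comm _ _ _ _

theorem Proc.persistent_par (P Q : Proc L V C N) :
    (par P Q).persistent = P.persistent ⊔ Q.persistent :=
  sup_sup_sup_comm _ _ _ _

theorem Proc.cfv_persistent_subset (P : Proc L V C N) : cfv P.persistent ⊆ P.pfv := by
  intro z hz
  by_contra h
  exact notMem_cfv_sup (fun h' => h (P.cfv_always_subset h'))
    (fun h' => h (P.cfv_later_subset h')) hz

/-- A tell moves its constraint from `live` into the store. Unfolding a replication moves what it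
tells from `always` into both `now` and `later`, so neither the store joined with `live` nor
`persistent` loses anything. -/
theorem Step.basic {D : N → Decl L V C N} {γ γ' : Config L V C N} (h : Step D γ γ') :
    ∃ ys, γ'.vars = γ.vars ++ ys ∧ ys.Disjoint γ.vars ∧
      γ.store.val ≤ exs ys γ'.store.val ∧
      γ.store.val ⊔ γ.proc.live ≤ γ'.store.val ⊔ γ'.proc.live ∧
      γ.proc.persistent ≤ γ'.proc.persistent ∧ ∀ y ∈ ys, y ∉ cfv γ.proc.persistent := by
  induction h with
  | tell xs c d =>
    refine ⟨[], by simp, by simp, le_sup_left, ?_, le_rfl, by simp⟩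
    simp [Proc.live, Proc.now, Proc.always, Con.val]
  | @par xs ys P P' Q c d _ hy ih =>
    obtain ⟨zs, h1, h2, h3, h4, h5, h6⟩ := ih
    obtain rfl := List.append_cancel_left h1
    refine ⟨ys, rfl, h2, h3, ?_, ?_, fun y hyy => ?_⟩
    · simp only [Proc.live_par, ← sup_assoc]
      exact sup_le_sup_right h4 _
    · simp only [Proc.persistent_par]
      exact sup_le_sup_right h5 _
    · rw [Proc.persistent_par]
      exact notMem_cfv_sup (h6 y hyy)
        fun h => hy y hyy (Q.pfv_subset_fv (Q.cfv_persistent_subset h))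
  | @loc xs ys P d h1 h2 =>
    refine ⟨ys, rfl, h1, (exs_of_notMem h2).ge, ?_, ?_, fun y _ h => ?_⟩
    · simp [Proc.live, Proc.now, Proc.always]
    · simp [Proc.persistent, Proc.later, Proc.always]
    · simp [Proc.persistent, Proc.later, Proc.always] at h
      exact notMem_cfv_bot y h
  | abs =>
    refine ⟨[], by simp, by simp, le_rfl, ?_, ?_, by simp⟩
    · simp [Proc.live, Proc.now, Proc.always]
    · simp [Proc.persistent, Proc.later, Proc.always]
  | @structVar xs ys P c d ho _ h1 h2 =>
    have he := ho.val_eq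
    refine ⟨ys, rfl, h1, he.le, sup_le_sup_right (he.trans_le (exs_le _ _)) _, le_rfl,
      fun y hy h => h2 y hy (P.pfv_subset_fv (P.cfv_persistent_subset h))⟩
  | struct h1 _ h2 ih =>
    simp only [h1.live_eq, h1.persistent_eq, ← h2.live_eq, ← h2.persistent_eq]
    exact ih
  | call =>
    refine ⟨[], by simp, by simp, le_rfl, ?_, ?_, by simp⟩
    · simp [Proc.live, Proc.now, Proc.always]
    · simp [Proc.persistent, Proc.later, Proc.always]
  | unl =>
    refine ⟨[], by simp, by simp, le_rfl, ?_, ?_, by simp⟩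
    · simp [Proc.live, Proc.now, Proc.always]
    · simp [Proc.persistent, Proc.later, Proc.always]
  | bang xs P d =>
    refine ⟨[], by simp, by simp, le_rfl, ?_, ?_, by simp⟩
    · simp only [Proc.live, Proc.now, Proc.always]
      refine sup_le_sup_left (sup_le bot_le (le_sup_left.trans le_sup_left)) _
    · simp only [Proc.persistent, Proc.later, Proc.always]
      exact sup_le (le_sup_right.trans le_sup_right) bot_le

theorem Proc.eq_bot_of_future {P F : Proc L V C N} (h : P.future = some F) :
    P.now = ⊥ ∧ P.always = ⊥ := by
  induction P generalizing F with
  | par P Q ihP ihQ =>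
    simp only [future, Option.bind_eq_some_iff, Option.map_eq_some_iff] at h
    obtain ⟨P', hP, Q', hQ, -⟩ := h
    simp [now, always, ihP hP, ihQ hQ]
  | tell => simp [future] at h
  | bang => simp [future] at h
  | _ => exact ⟨rfl, rfl⟩

/-! ### Parametric asks that have been executed do not come to rest -/

/-- At the top level there is a parametric ask with `m` parameters, the guard of which is entailed
by `h g` when it is instantiated with fresh variables `g`, and which has not been executed with
the variables `zs`. -/
def Proc.Asks (h : List V → C) (m : ℕ) (zs : List V) : Proc L V C N → Prop
  | abs ys c E _ => ys.length = m ∧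
      (∃ G : Set V, G.Finite ∧ ∀ g, Fresh G m g → csubst c ys (g.map Term.var) ≤ h g) ∧
      ∀ z ∈ zs, ∀ us ∈ E, z ∉ termVars us
  | par P Q => P.Asks h m zs ∨ Q.Asks h m zs
  | _ => False

/-- At the top level there is a process with `m` local variables to which the guard `h` applies,
given `k`. -/
def Proc.Offers (h : List V → C) (m : ℕ) (k : C) : Proc L V C N → Prop
  | loc zs P => zs.length = m ∧ (cfv P.always).Finite ∧
      ∃ G : Set V, G.Finite ∧ ∀ g, Fresh G m g →
        h g ≤ k ⊔ exs zs (P.always ⊔ eqns zs (g.map Term.var))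
  | par P Q => P.Offers h m k ∨ Q.Offers h m k
  | _ => False

/-- The guard `h` applies to the variables `zs`, given `k`. -/
def Applies (h : List V → C) (m : ℕ) (k : C) (zs : List V) : Prop :=
  zs.length = m ∧ ∃ G : Set V, G.Finite ∧ ∀ g, Fresh G m g →
    h g ≤ k ⊔ eqns zs (g.map Term.var)

/-- A parametric ask of the process can be executed, perhaps after opening some local variables. -/
def Proc.Restless (P : Proc L V C N) (d : C) : Prop :=
  ∃ (h : List V → C) (m : ℕ) (k : C), 0 < m ∧ (cfv k).Finite ∧
    ((P.Asks h m [] ∧ P.Offers h m k ∧ k ≤ d) ∨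
      ∃ zs, P.Asks h m zs ∧ Applies h m k zs ∧ k ≤ d ⊔ P.live)

theorem exs_map_crename_sup_eqns {x y : V} {xs g : List V} {c : C} (hx : x ∈ xs) (hy : y ∉ xs)
    (hc : y ∉ cfv c) (hgx : x ∉ g) (hgy : y ∉ g) :
    exs (xs.map (vrename x y))
      (crename x y c ⊔ eqns (xs.map (vrename x y)) (g.map Term.var)) =
      exs xs (c ⊔ eqns xs (g.map Term.var)) := by
  have h := ne_of_mem_of_not_mem hx hy
  have hyg : y ∉ termVars (g.map (Term.var : V → L.Term V)) := fun h' =>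
    hgy (mem_termVars_map_var.1 h')
  have hxg : x ∉ termVars (g.map (Term.var : V → L.Term V)) := fun h' =>
    hgx (mem_termVars_map_var.1 h')
  rw [← exs_map_crename hx hy (notMem_cfv_sup hc (notMem_cfv_eqns hy hyg)), crename_sup h,
    crename_eqns h hy hyg fun _ => hxg, trename_map_var_of_notMem hgx]

theorem Proc.Congr.asks_iff {h : List V → C} {m : ℕ} {zs : List V} {P Q : Proc L V C N}
    (hc : P.Congr Q) : P.Asks h m zs ↔ Q.Asks h m zs := by
  induction hc with
  | symm _ ih => exact ih.symm
  | trans _ _ ih1 ih2 => exact ih1.trans ih2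
  | par _ _ ih1 ih2 => exact or_congr ih1 ih2
  | par_skip P => simp [Asks]
  | par_comm P Q => exact or_comm
  | par_assoc P Q R => exact or_assoc.symm
  | @alpha_abs xs x y c E P hx hy =>
    simp only [Proc.occ, Set.mem_union, not_or] at hy
    simp only [Asks, List.length_map]
    refine and_congr_right fun _ => and_congr_left fun _ =>
      exists_fresh_imp_iff (F := {x, y}) (by simp) fun g hg => ?_
    rw [csubst, csubst, exs_map_crename_sup_eqns hx hy.1.1.1 hy.1.1.2
      (fun h' => hg.2.2 x h' (by simp)) fun h' => hg.2.2 y h' (by simp)]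
  | _ => rfl

theorem Proc.Congr.offers_iff {h : List V → C} {m : ℕ} {k : C} {P Q : Proc L V C N}
    (hc : P.Congr Q) : P.Offers h m k ↔ Q.Offers h m k := by
  induction hc with
  | symm _ ih => exact ih.symm
  | trans _ _ ih1 ih2 => exact ih1.trans ih2
  | par _ _ ih1 ih2 => exact or_congr ih1 ih2
  | par_skip P => simp [Offers]
  | par_comm P Q => exact or_comm
  | par_assoc P Q R => exact or_assoc.symm
  | loc h _ => simp only [Offers, h.always_eq]
  | @alpha_loc xs x y P hx hyx hy =>
    have hxy := ne_of_mem_of_not_mem hx hyx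
    have hya : y ∉ cfv P.always := fun h' => hy (P.pfv_subset_occ (P.cfv_always_subset h'))
    have hf : (cfv (crename x y P.always)).Finite ↔ (cfv P.always).Finite := by
      rw [cfv_crename hxy hya]
      exact Set.finite_image_iff fun a ha b hb e => vrename_inj (ne_of_mem_of_not_mem ha hya)
        (ne_of_mem_of_not_mem hb hya) e
    simp only [Offers, List.length_map, always_rename hxy hy, hf]
    refine and_congr_right fun _ => and_congr_right fun _ =>
      exists_fresh_imp_iff (F := {x, y}) (by simp) fun g hg => ?_
    rw [exs_map_crename_sup_eqns hx hyx hya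
      (fun h' => hg.2.2 x h' (by simp)) fun h' => hg.2.2 y h' (by simp)]
  | _ => rfl

theorem Proc.Congr.restless_iff {d : C} {P Q : Proc L V C N} (h : P.Congr Q) :
    P.Restless d ↔ Q.Restless d := by
  simp only [Restless, h.asks_iff, h.offers_iff, h.live_eq]

/-- The tuples already used count among the variables in `fv`, though not in `pfv`; freshness with
respect to `fv` is what makes newly opened variables an unused tuple. -/
theorem Proc.Asks.of_notMem_fv {h : List V → C} {m : ℕ} {P : Proc L V C N} (hP : P.Asks h m [])
    {zs : List V} (hz : ∀ z ∈ zs, z ∉ P.fv) : P.Asks h m zs := by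
  induction P with
  | abs ys c E P => exact ⟨hP.1, hP.2.1, fun z hzz us hus h' => hz z hzz (Or.inr ⟨us, hus, h'⟩)⟩
  | par P Q ihP ihQ =>
    exact hP.imp (fun h => ihP h fun z hzz h' => hz z hzz (Or.inl h'))
      fun h => ihQ h fun z hzz h' => hz z hzz (Or.inr h')
  | _ => exact hP

theorem Proc.Restless.par {d : C} {P : Proc L V C N} (h : P.Restless d) (Q : Proc L V C N) :
    (Proc.par P Q).Restless d := by
  obtain ⟨h, m, k, hm, hk, ⟨h1, h2, h3⟩ | ⟨zs, h1, h2, h3⟩⟩ := h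
  · exact ⟨h, m, k, hm, hk, Or.inl ⟨Or.inl h1, Or.inl h2, h3⟩⟩
  · exact ⟨h, m, k, hm, hk, Or.inr ⟨zs, Or.inl h1, h2, h3.trans (by
      rw [Proc.live_par]; exact sup_le_sup_left le_sup_left _)⟩⟩

theorem cfv_csubst_finite {c : C} (hc : (cfv c).Finite) (ys : List V) (ts : List (L.Term V)) :
    (cfv (csubst c ys ts)).Finite := by
  refine (hc.union ((List.finite_toSet ys).union (termVars_finite ts))).subset fun z hz => ?_
  by_contra h
  simp only [Set.mem_union, not_or] at h
  exact notMem_cfv_exs _ (notMem_cfv_sup h.1 (notMem_cfv_eqns h.2.1 h.2.2)) hz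

theorem Proc.finite_cfv_always {P : Proc L V C N} (h : P.occ.Finite) : (cfv P.always).Finite :=
  h.subset (P.cfv_always_subset.trans P.pfv_subset_occ)

/-- The guard is abstracted to `h g = c[g/ys]`, and `k` is the instance `c[ts/ys]` in the store.
Together with the replicated `ys = ts`, `k` entails `c` itself, so the new local variables `ys`
satisfy the guard once they are opened. -/
theorem Proc.restless_of_exec {ys : List V} {c : C} {E : List (List (L.Term V))}
    {P : Proc L V C N} {ts : List (L.Term V)} {d : C} (hne : ys ≠ []) (hf : (abs ys c E P).occ.Finite)
    (hd : csubst c ys ts ≤ d) (ha : Adm ys ts) :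
    (par (P.subst ys ts) (abs ys c (ts :: E) P)).Restless d := by
  simp only [occ, Set.finite_union] at hf
  refine ⟨fun g => csubst c ys (g.map Term.var), ys.length, csubst c ys ts,
    List.length_pos_iff.2 hne, cfv_csubst_finite hf.1.1.2 _ _, Or.inl ⟨Or.inr ⟨rfl,
    ⟨∅, Set.finite_empty, fun _ _ => le_rfl⟩, by simp⟩, Or.inl ⟨rfl, ?_, ∅, Set.finite_empty,
    fun g _ => ?_⟩, hd⟩⟩
  · apply finite_cfv_always
    simp only [occ, Con.occ, Set.finite_union]
    exact ⟨((List.finite_toSet ys).union (termVars_finite ts)).subset (cfv_eqns_subset _ _), hf.2⟩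
  · change exs ys (c ⊔ eqns ys (g.map Term.var)) ≤ exs ys (c ⊔ eqns ys ts) ⊔
      exs ys (eqns ys ts ⊔ P.always ⊔ eqns ys (g.map Term.var))
    rw [← exs_sup_of_notMem' _ fun x hx => notMem_cfv_exs_of_mem _ hx]
    refine exs_mono _ (sup_le ?_ (le_sup_right.trans le_sup_right))
    refine le_sup_left.trans ((le_eqns_sup_exs ha (le_sup_right (a := c))).trans ?_)
    exact sup_le (le_sup_left.trans (le_sup_left.trans le_sup_right)) le_sup_left

/-- The ask and the local process that offers a tuple to it may lie in different parallel
components. The fate of each is therefore recorded separately, besides that of the pair. -/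
theorem Step.restless_aux {D : N → Decl L V C N} {γ γ' : Config L V C N} (hs : Step D γ γ')
    (hf : γ.proc.occ.Finite) :
    ∃ ys, γ'.vars = γ.vars ++ ys ∧
      (∀ h m zs, 0 < m → γ.proc.Asks h m zs →
        γ'.proc.Asks h m zs ∨ γ'.proc.Restless γ'.store.val) ∧
      (∀ h m k, 0 < m → (cfv k).Finite → γ.proc.Offers h m k → γ'.proc.Offers h m k ∨
        ∃ k', (cfv k').Finite ∧ k' ≤ k ⊔ γ'.proc.live ∧ Applies h m k' ys) ∧
      (∀ h m k, 0 < m → (cfv k).Finite → k ≤ γ.store.val → γ.proc.Asks h m [] →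
        γ.proc.Offers h m k → γ'.proc.Restless γ'.store.val) := by
  induction hs with
  | tell | call | unl | bang =>
    exact ⟨[], by simp, fun _ _ _ _ h => h.elim, fun _ _ _ _ _ h => h.elim,
      fun _ _ _ _ _ _ h => h.elim⟩
  | @par xs ys P P' Q c d hst hy ih =>
    simp only [Proc.occ, Set.finite_union] at hf
    obtain ⟨zs, h1, ha, hb, hc⟩ := ih hf.1
    obtain rfl := List.append_cancel_left h1
    obtain ⟨ws, -, -, hcd, -⟩ := hst.basic
    have hcd : c.val ≤ d.val := hcd.trans (exs_le _ _)
    refine ⟨ys, rfl, fun h m zs hm hA => ?_, fun h m k hm hk hO => ?_,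
      fun h m k hm hk hkc hA hO => ?_⟩
    · rcases hA with hA | hA
      · exact (ha h m zs hm hA).imp Or.inl fun h' => h'.par Q
      · exact Or.inl (Or.inr hA)
    · rcases hO with hO | hO
      · refine (hb h m k hm hk hO).imp Or.inl ?_
        rintro ⟨k', h1, h2, h3⟩
        refine ⟨k', h1, h2.trans ?_, h3⟩
        rw [Proc.live_par]; exact sup_le_sup_left le_sup_left _
      · exact Or.inl (Or.inr hO)
    · rcases hA with hA | hA
      · rcases hO with hO | hO
        · exact (hc h m k hm hk hkc hA hO).par Q
        · rcases ha h m [] hm hA with hA | hR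
          · exact ⟨h, m, k, hm, hk, Or.inl ⟨Or.inl hA, Or.inr hO, hkc.trans hcd⟩⟩
          · exact hR.par Q
      · rcases hO with hO | hO
        · rcases hb h m k hm hk hO with hO | ⟨k', h1, h2, h3⟩
          · exact ⟨h, m, k, hm, hk, Or.inl ⟨Or.inr hA, Or.inl hO, hkc.trans hcd⟩⟩
          -- The offering component has opened its local variables `ys`; the side condition of the
          -- parallel rule keeps them out of the tuples used by the ask in `Q`.
          · refine ⟨h, m, k', hm, h1, Or.inr ⟨ys, Or.inr (hA.of_notMem_fv hy), h3, h2.trans ?_⟩⟩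
            rw [Proc.live_par]
            exact sup_le_sup (hkc.trans hcd) le_sup_left
        · exact ⟨h, m, k, hm, hk, Or.inl ⟨Or.inr hA, Or.inr hO, hkc.trans hcd⟩⟩
  | @loc xs ys P d h1 h2 =>
    refine ⟨ys, rfl, fun _ _ _ _ h => h.elim, fun h m k hm hk hO => Or.inr ?_,
      fun _ _ _ _ _ _ h => h.elim⟩
    obtain ⟨h3, h4, G, hG, h5⟩ := hO
    refine ⟨k ⊔ P.always, (hk.union h4).subset fun z hz => ?_, sup_le_sup_left le_sup_right _,
      h3, G, hG, fun g hg => (h5 g hg).trans ?_⟩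
    · by_contra h
      simp only [Set.mem_union, not_or] at h
      exact notMem_cfv_sup h.1 h.2 hz
    · rw [sup_assoc]; exact sup_le_sup_left (exs_le _ _) _
  | @abs xs ys c E P d ts hd ha hE =>
    refine ⟨[], by simp, fun h m zs hm hA => Or.inr ?_, fun _ _ _ _ _ h => h.elim,
      fun _ _ _ _ _ _ _ h => h.elim⟩
    -- If the ask fires with some other tuple, that execution creates a new offer.
    refine Proc.restless_of_exec (fun e => ?_) hf hd ha
    obtain ⟨hl, -⟩ := hA
    simp [e] at hl
    omega
  | @structVar xs ys P c d ho _ h1 h2 =>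
    have hcd : c.val ≤ d.val := ho.val_eq.trans_le (exs_le _ _)
    exact ⟨ys, rfl, fun _ _ _ _ h => Or.inl h, fun _ _ _ _ _ h => Or.inl h,
      fun h m k hm hk hkc hA hO => ⟨h, m, k, hm, hk, Or.inl ⟨hA, hO, hkc.trans hcd⟩⟩⟩
  | struct h1 _ h2 ih =>
    simp only [h1.asks_iff, h1.offers_iff, ← h2.asks_iff, ← h2.offers_iff, ← h2.restless_iff,
      ← h2.live_eq]
    exact ih (h1.occ_finite_iff.1 hf)

theorem Step.restless {D : N → Decl L V C N} {γ γ' : Config L V C N} (hs : Step D γ γ')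
    (hf : γ.proc.occ.Finite) (hR : γ.proc.Restless γ.store.val) :
    γ'.proc.Restless γ'.store.val := by
  obtain ⟨ys, -, ha, -, hc⟩ := hs.restless_aux hf
  obtain ⟨h, m, k, hm, hk, ⟨h1, h2, h3⟩ | ⟨zs, h1, h2, h3⟩⟩ := hR
  · exact hc h m k hm hk h3 h1 h2
  · obtain ⟨-, -, -, -, h4, -⟩ := hs.basic
    rcases ha h m zs hm h1 with hA | hR
    · exact ⟨h, m, k, hm, hk, Or.inr ⟨zs, hA, h2, h3.trans h4⟩⟩
    · exact hR

theorem eqns_var_symm (f g : List V) :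
    (eqns f (g.map Term.var) : C) = eqns g (f.map Term.var) := by
  induction f generalizing g with
  | nil => exact (eqns_nil_right g).symm
  | cons a f ih =>
    cases g with
    | nil => exact eqns_nil_right _
    | cons b g => rw [List.map_cons, List.map_cons, eqns_cons, eqns_cons, ih, eqn_symm]

/-- For fresh `a`, `b` the equation `a = b` is true, so `x = b` entails `x = a`, that is, `eqn x b`
and `eqn x a` are ordered; quantifying `a` makes `x = b` true. Then `eqn_subst` gives `c ≤ ∃x c`. -/
theorem degenerate_of_eqn_eq_bot [Infinite V] {F : Set V} (hF : F.Finite)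
    (h : ∀ a b, a ∉ F → b ∉ F → a ≠ b → (eqn a (Term.var b) : C) = ⊥) : Degenerate C := by
  intro x c
  obtain ⟨g, hg⟩ := exists_fresh (hF.union (Set.finite_singleton x)) 2
  obtain ⟨a, b, rfl⟩ := List.length_eq_two.1 hg.2.1
  have ha := hg.2.2 a (by simp)
  have hb := hg.2.2 b (by simp)
  simp only [Set.mem_union, Set.mem_singleton_iff, not_or] at ha hb
  have hab : a ≠ b := by have := hg.1; simpa using this
  have h1 : (eqn x (Term.var b) : C) ≤ eqn x (Term.var a) := by
    have := eqn_trans_le (C := C) (x := x) (z := a) (t := Term.var b) ha.2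
      (by simpa [Term.varFinset] using hab)
    rwa [h a b ha.1 hb.1 hab, sup_bot_eq] at this
  have h2 : (eqn x (Term.var b) : C) = ⊥ := by
    have := ex_mono a _ _ h1
    rw [ex_eqn_var' (Ne.symm ha.2), notMem_cfv.1 (notMem_cfv_eqn_var ha.2 hab)] at this
    exact le_bot_iff.1 this
  refine le_antisymm (ex_le _ _) ?_
  have := eqn_subst x (Term.var b) c (by simpa [Term.varFinset] using Ne.symm hb.2)
  rwa [h2, bot_sup_eq, sup_bot_eq] at this

/-- Let `e` be `ys = us`. It entails `y = z` but does not depend on `z`, so it entails `y = a` for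
every `a ≠ z`, and thus `a = b` for all `a`, `b` outside a finite set. Since `∃ys e` is true, these
equations are true. -/
theorem degenerate_of_eqns_le [Infinite V] {ys zs : List V} {us : List (L.Term V)} (hn : ys.Nodup)
    (hne : ys ≠ []) (hl : zs.length = ys.length) (h1 : ∀ y ∈ ys, y ∉ termVars us)
    (h2 : ∀ z ∈ zs, z ∉ termVars us) (h3 : ∀ z ∈ zs, z ∉ ys)
    (h : eqns ys (zs.map Term.var) ≤ (eqns ys us : C)) : Degenerate C := by
  obtain ⟨y, ys', rfl⟩ := List.exists_cons_of_ne_nil hne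
  obtain _ | ⟨z, zs⟩ := zs
  · simp at hl
  set e : C := eqns (y :: ys') us
  have hz : z ∉ cfv e := notMem_cfv_eqns (h3 z List.mem_cons_self) (h2 z List.mem_cons_self)
  have hzy : z ≠ y := fun e => h3 z List.mem_cons_self (e ▸ List.mem_cons_self)
  have hyz : (eqn y (Term.var z) : C) ≤ e := le_sup_left.trans h
  have key : ∀ a, a ≠ z → (eqn y (Term.var a) : C) ≤ e := by
    intro a haz
    have h4 := eqn_trans_le (C := C) (x := y) (z := z) (t := Term.var a) hzy
      (by simpa [Term.varFinset] using haz.symm)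
    have h5 := ex_mono z _ _ (h4.trans (sup_le_sup_right hyz _))
    rwa [notMem_cfv.1 (notMem_cfv_eqn_var hzy haz.symm), sup_comm, ex_sup_of_notMem _ hz,
      ex_eqn_var haz.symm, bot_sup_eq] at h5
  refine degenerate_of_eqn_eq_bot (F := {x | x ∈ z :: y :: ys'}) (List.finite_toSet _) ?_
  intro a b ha hb hab
  simp only [Set.mem_ofPred_eq, List.mem_cons, not_or] at ha hb
  have h4 := eqn_trans_le (C := C) (x := a) (z := y) (t := Term.var b) (Ne.symm ha.2.1)
    (by simpa [Term.varFinset] using Ne.symm hb.2.1)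
  rw [eqn_symm a y] at h4
  have h5 := exs_mono (y :: ys') (h4.trans (sup_le (key a ha.1) (key b hb.1)))
  rw [exs_eqns hn h1, exs_of_notMem] at h5
  · exact le_bot_iff.1 h5
  · intro x hx
    apply notMem_cfv_eqn_var
    · rintro rfl; exact (List.mem_cons.1 hx).elim ha.2.1 ha.2.2
    · rintro rfl; exact (List.mem_cons.1 hx).elim hb.2.1 hb.2.2

theorem Proc.exists_congr_abs [Infinite V] {ys : List V} {c : C} {E : List (List (L.Term V))}
    {P : Proc L V C N} (hf : (abs ys c E P).occ.Finite) {G : Set V} (hG : G.Finite) :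
    ∃ ys' c' P', (abs ys c E P).Congr (abs ys' c' E P') ∧ ∀ y ∈ ys', y ∉ G := by
  induction G, hG using Set.Finite.induction_on with
  | empty => exact ⟨ys, c, P, .refl _, by simp⟩
  | @insert a G _ hG ih =>
    obtain ⟨ys', c', P', h1, h2⟩ := ih
    by_cases ha : a ∈ ys'
    · have hf' := h1.occ_finite_iff.1 hf
      obtain ⟨y, hy⟩ := ((hf'.union hG).infinite_compl).nonempty
      simp only [Set.mem_compl_iff, Set.mem_union, not_or] at hy
      have hya : a ≠ y := fun e => hy.1 (e ▸ Or.inl (Or.inl (Or.inl ha)))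
      refine ⟨_, _, _, h1.trans (.alpha_abs ha hy.1), fun z hz hm => ?_⟩
      rcases hm with rfl | hm
      · exact notMem_map_vrename hya _ hz
      · rcases mem_of_mem_map_vrename hz with rfl | hz
        · exact hy.2 hm
        · exact h2 z hz hm
    · refine ⟨ys', c', P', h1, fun y hy hm => ?_⟩
      rcases hm with rfl | hm
      · exact ha hy
      · exact h2 y hy hm

/-- Asks and offers are compared only at fresh tuples `g`, which makes both conditions insensitive
to bound names. The instance at `zs` is recovered by adding `g = zs` and quantifying `g`. -/
theorem csubst_le_of_applies [Infinite V] {h : List V → C} {m : ℕ} {k c : C} {ys zs : List V}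
    (hl : ys.length = m) (hk : (cfv k).Finite) (hc : (cfv c).Finite) (hzy : ∀ z ∈ zs, z ∉ ys)
    (ha : ∃ G : Set V, G.Finite ∧ ∀ g, Fresh G m g → csubst c ys (g.map Term.var) ≤ h g)
    (hz : Applies h m k zs) : csubst c ys (zs.map Term.var) ≤ k := by
  obtain ⟨G, hG, ha⟩ := ha
  obtain ⟨hzl, H, hH, hz⟩ := hz
  obtain ⟨g, hg⟩ := exists_fresh ((hG.union hH).union ((hk.union hc).union
    ((List.finite_toSet ys).union (List.finite_toSet zs)))) m
  have hg1 : ∀ x ∈ g, x ∉ cfv k := fun x hx h' => hg.2.2 x hx (Or.inr (Or.inl (Or.inl h')))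
  have hg2 : ∀ x ∈ g, x ∉ cfv c := fun x hx h' => hg.2.2 x hx (Or.inr (Or.inl (Or.inr h')))
  have hg3 : ∀ x ∈ g, x ∉ ys := fun x hx h' => hg.2.2 x hx (Or.inr (Or.inr (Or.inl h')))
  have hg4 : ∀ x ∈ g, x ∉ termVars (zs.map (Term.var : V → L.Term V)) := fun x hx h' =>
    hg.2.2 x hx (Or.inr (Or.inr (Or.inr (mem_termVars_map_var.1 h'))))
  have hq := (ha g (hg.mono (Set.subset_union_left.trans Set.subset_union_left))).trans
    (hz g (hg.mono (Set.subset_union_right.trans Set.subset_union_left)))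
  rw [eqns_var_symm] at hq
  have h1 := (eqns_sup_eqns_le (C := C) (f := ys) (g := g) (ts := zs.map Term.var)
    (hg.2.1.trans hl.symm) (by simp [hl, hzl]) hg3 hg4).2
  have h2 : csubst c ys (zs.map Term.var) ≤ k ⊔ eqns g (zs.map Term.var) := by
    refine le_trans ?_ (sup_le hq le_sup_right)
    have h3 : ∀ y ∈ ys, y ∉ cfv (eqns g (zs.map Term.var) : C) := fun y hy =>
      notMem_cfv_eqns (fun h' => hg3 y h' hy) fun h' => hzy y (mem_termVars_map_var.1 h') hy
    rw [csubst, csubst, ← exs_sup_of_notMem _ h3]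
    refine exs_mono _ (sup_le (le_sup_left.trans le_sup_left) (h1.trans ?_))
    exact sup_le le_sup_right (le_sup_right.trans le_sup_left)
  have h4 := exs_mono g h2
  rwa [exs_sup_of_notMem' _ hg1, exs_eqns hg.1 hg4, sup_bot_eq, exs_of_notMem] at h4
  exact fun x hx => notMem_cfv_exs _ (notMem_cfv_sup (hg2 x hx)
    (notMem_cfv_eqns (hg3 x hx) (hg4 x hx)))

theorem Step.par_left {D : N → Decl L V C N} {xs : List V} {P P' : Proc L V C N} {d : Con V C}
    (h : Step D ⟨xs, P, d⟩ ⟨xs, P', d⟩) (Q : Proc L V C N) :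
    Step D ⟨xs, .par P Q, d⟩ ⟨xs, .par P' Q, d⟩ := by
  have := Step.par (ys := []) (Q := Q) (by simpa using h) (by simp)
  simpa using this

theorem Step.par_right {D : N → Decl L V C N} {xs : List V} {Q Q' : Proc L V C N} {d : Con V C}
    (h : Step D ⟨xs, Q, d⟩ ⟨xs, Q', d⟩) (P : Proc L V C N) :
    Step D ⟨xs, .par P Q, d⟩ ⟨xs, .par Q' P, d⟩ :=
  .struct (.par_comm P Q) (h.par_left P) (.refl _)

theorem Proc.Asks.exists_step [Infinite V] (D : N → Decl L V C N) (hnd : ¬ Degenerate C)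
    {Q : Proc L V C N} {h : List V → C} {m : ℕ} {zs : List V} (hA : Q.Asks h m zs) {k : C}
    (hm : 0 < m) (hk : (cfv k).Finite) (hz : Applies h m k zs) {d : Con V C} (hkd : k ≤ d.val)
    (hQ : Q.Proper) (hf : Q.occ.Finite) (xs : List V) :
    ∃ Q', Step D ⟨xs, Q, d⟩ ⟨xs, Q', d⟩ := by
  induction Q with
  | abs ys c E P =>
    -- The parameters are renamed away from `zs`, for admissibility, and from the tuples already
    -- used, as `degenerate_of_eqns_le` requires.
    obtain ⟨ys', c', P', hc, hys'⟩ := exists_congr_abs hf (G := {x | x ∈ zs} ∪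
      ⋃ us ∈ {us | us ∈ E}, termVars us) ((List.finite_toSet zs).union
        ((List.finite_toSet E).biUnion fun us _ => termVars_finite us))
    have hys1 : ∀ z ∈ zs, z ∉ ys' := fun z hz h' => hys' z h' (Or.inl hz)
    have hys2 : ∀ y ∈ ys', ∀ us ∈ E, y ∉ termVars us := fun y hy us hus h' =>
      hys' y hy (Or.inr (Set.mem_biUnion hus h'))
    obtain ⟨h1, h2, h3⟩ := hc.asks_iff.1 hA
    have hf' := hc.occ_finite_iff.1 hf
    simp only [occ, Set.finite_union] at hf'
    have hl : zs.length = ys'.length := hz.1.trans h1.symm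
    refine ⟨_, .struct hc (.abs (ts := zs.map Term.var)
      ((csubst_le_of_applies h1 hk hf'.1.1.2 hys1 h2 hz).trans hkd)
      (adm_map_var hl hys1) fun us hus hle => hnd ?_) (.refl _)⟩
    exact degenerate_of_eqns_le (hc.proper_iff.1 hQ).1
      (List.length_pos_iff.1 (h1 ▸ hm)) hl (fun y hy => hys2 y hy us hus)
      (fun z hz => h3 z hz us hus) hys1 hle
  | par P Q ihP ihQ =>
    simp only [occ, Set.finite_union] at hf
    rcases hA with hA | hA
    · obtain ⟨P', h⟩ := ihP hA hQ.1 hf.1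
      exact ⟨_, h.par_left Q⟩
    · obtain ⟨Q', h⟩ := ihQ hA hQ.2 hf.2
      exact ⟨_, h.par_right P⟩
  | _ => exact hA.elim

theorem Proc.not_offers_of_future {P F : Proc L V C N} (hF : P.future = some F) {h : List V → C}
    {m : ℕ} {k : C} : ¬ P.Offers h m k := by
  induction P generalizing F with
  | par P Q ihP ihQ =>
    simp only [future, Option.bind_eq_some_iff, Option.map_eq_some_iff] at hF
    obtain ⟨P', hP, Q', hQ, -⟩ := hF
    exact not_or.2 ⟨ihP hP, ihQ hQ⟩
  | loc => simp [future] at hF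
  | _ => exact id

theorem Proc.Restless.exists_step [Infinite V] (D : N → Decl L V C N) (hnd : ¬ Degenerate C)
    {Q F : Proc L V C N} {d : Con V C} (hR : Q.Restless d.val) (hF : Q.future = some F)
    (hQ : Q.Proper) (hf : Q.occ.Finite) (xs : List V) :
    ∃ Q', Step D ⟨xs, Q, d⟩ ⟨xs, Q', d⟩ := by
  obtain ⟨h, m, k, hm, hk, ⟨h1, h2, h3⟩ | ⟨zs, h1, h2, h3⟩⟩ := hR
  · exact (not_offers_of_future hF h2).elim
  · obtain ⟨e1, e2⟩ := eq_bot_of_future hF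
    rw [live, e1, e2, sup_bot_eq, sup_bot_eq] at h3
    exact h1.exists_step D hnd hm hk h2 h3 hQ hf xs

end Restless

/-! ### Soundness of a single internal transition -/

section Soundness

variable {L : FirstOrder.Language.{u, v}} {V : Type} {C : Type w} {N : Type r} [DecidableEq V]
  [ConstraintSystem L V C]

/-- The static properties of processes that are preserved by execution. -/
structure Proc.Good (D : N → Decl L V C N) (P : Proc L V C N) : Prop where
  proper : P.Proper
  finite : P.occ.Finite
  independent : P.Independent D

/-- The corresponding properties of declarations. -/
structure Decl.Good (D : N → Decl L V C N) (δ : Decl L V C N) : Prop where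
  closed : δ.Closed
  good : δ.body.Good D

theorem Proc.Congr.good_iff [Infinite V] {D : N → Decl L V C N} {P Q : Proc L V C N}
    (h : P.Congr Q) : P.Good D ↔ Q.Good D :=
  ⟨fun hP => ⟨h.proper_iff.1 hP.1, h.occ_finite_iff.1 hP.2, h.independent_iff.1 hP.3⟩,
    fun hQ => ⟨h.proper_iff.2 hQ.1, h.occ_finite_iff.2 hQ.2, h.independent_iff.2 hQ.3⟩⟩

theorem Proc.good_par_iff {D : N → Decl L V C N} {P Q : Proc L V C N} :
    (par P Q).Good D ↔ P.Good D ∧ Q.Good D :=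
  ⟨fun h => ⟨⟨h.1.1, (Set.finite_union.1 h.2).1, h.3.1⟩, ⟨h.1.2, (Set.finite_union.1 h.2).2, h.3.2⟩⟩,
    fun h => ⟨⟨h.1.1, h.2.1⟩, h.1.2.union h.2.2, ⟨h.1.3, h.2.3⟩⟩⟩

theorem Proc.Good.subst {D : N → Decl L V C N} {P : Proc L V C N} (h : P.Good D) {xs : List V}
    {ts : List (L.Term V)} (ha : Adm xs ts) : (P.subst xs ts).Good D where
  proper := ⟨trivial, h.proper⟩
  finite := (List.finite_toSet xs).union
    ((((List.finite_toSet xs).union (termVars_finite ts)).subset (cfv_eqns_subset _ _)).union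
      h.finite)
  independent := independent_subst h.independent ha

theorem Decl.Alpha.good [Infinite V] {D : N → Decl L V C N} {δ ε : Decl L V C N}
    (hε : δ.Alpha ε) (h : δ.Good D) : ε.Good D := by
  refine ⟨hε.closed h.closed, ?_⟩
  induction hε with
  | refl => exact h.good
  | step _ hx hyf hy ih =>
    have hxy := ne_of_mem_of_not_mem hx hyf
    exact ⟨(Proc.proper_rename _ _ _).2 ih.proper, (Proc.occ_rename_finite_iff hxy hy).2 ih.finite,
      (Proc.independent_rename_iff hxy hy).2 ih.independent⟩

theorem Decl.Alpha.calls_eq {δ ε : Decl L V C N} (hε : δ.Alpha ε) :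
    ε.body.calls = δ.body.calls := by
  induction hε with
  | refl => rfl
  | step _ _ _ _ ih => exact (Proc.calls_rename _ _ _).trans ih

theorem Decl.Alpha.noUnless_iff {δ ε : Decl L V C N} (hε : δ.Alpha ε) :
    ε.body.NoUnless ↔ δ.body.NoUnless := by
  induction hε with
  | refl => rfl
  | step _ _ _ _ ih => exact (Proc.noUnless_rename _ _ _).trans ih

theorem Step.good [Infinite V] {D : N → Decl L V C N} (hD : ∀ p, (D p).Good D)
    {γ γ' : Config L V C N} (h : Step D γ γ') (hG : γ.proc.Good D) : γ'.proc.Good D := by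
  induction h with
  | tell | unl => exact ⟨trivial, Set.finite_empty, trivial⟩
  | par _ _ ih =>
    have h := Proc.good_par_iff.1 hG
    exact Proc.good_par_iff.2 ⟨ih h.1, h.2⟩
  | loc => exact ⟨hG.1, (Set.finite_union.1 hG.2).2, hG.3.1⟩
  | @abs xs ys c E P d ts _ ha _ =>
    obtain ⟨h1, h2, h3⟩ := hG
    simp only [Proc.occ, Set.finite_union] at h2
    refine Proc.good_par_iff.2 ⟨Proc.Good.subst ⟨h1.2, h2.2, h3⟩ ha, h1, ?_, h3⟩
    simp only [Proc.occ, Set.finite_union]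
    refine ⟨⟨h2.1.1, ((termVars_finite ts).union h2.1.2).subset ?_⟩, h2.2⟩
    rintro z ⟨us, hus, hz⟩
    rcases List.mem_cons.1 hus with rfl | hus
    · exact Or.inl hz
    · exact Or.inr ⟨us, hus, hz⟩
  | structVar => exact hG
  | struct h1 _ h2 ih => exact h2.good_iff.1 (ih (h1.good_iff.1 hG))
  | call hε ha => exact (hε.good (hD _)).good.subst ha
  | bang => exact Proc.good_par_iff.2 ⟨⟨hG.1, hG.2, hG.3⟩, ⟨hG.1, hG.2, hG.3⟩⟩

/-- The effect on accepted sequences of an internal transition that introduces the local variables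
`ys`, where `us` are the variables on which `unless` does not depend. -/
def SoundStep (D : N → Decl L V C N) (us ys : List V) (P : Proc L V C N) (c : C)
    (P' : Proc L V C N) (d : C) : Prop :=
  ∃ (vs : List V) (E : List (V × L.Term V)), vs ⊆ ys ∧ E.map Prod.fst ⊆ ys ∧
    ys ⊆ vs ++ E.map Prod.fst ∧ P'.Separated D (us ++ vs) ∧
    Defines P'.persistent (us ++ vs) E ∧
    ∀ n, ∀ s ∈ weakDen (approx D (n + 1)) P, c ≤ s 0 → ∃ s' ∈ weakDen (approx D n) P',
      Variant ys s s' ∧ d ≤ s' 0 ∧ exs (us ++ vs) (s' 0) ≤ exs us (s 0) ⊔ (d ⊔ P'.live)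

theorem soundStep_nil {D : N → Decl L V C N} {us : List V} {P P' : Proc L V C N} {c d : C}
    (h1 : P'.Separated D us) (h2 : ∀ n, ∀ s ∈ weakDen (approx D (n + 1)) P, c ≤ s 0 →
      s ∈ weakDen (approx D n) P' ∧ d ≤ s 0) : SoundStep D us [] P c P' d := by
  refine ⟨[], [], by simp, by simp, by simp, by simpa using h1, .nil _ _, fun n s hs hc => ?_⟩
  obtain ⟨h3, h4⟩ := h2 n s hs hc
  refine ⟨s, h3, fun _ => rfl, h4, ?_⟩
  rw [List.append_nil]
  exact le_sup_left

theorem SoundStep.congr {D : N → Decl L V C N} (hD : ∀ p, (D p).Closed) {us ys : List V}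
    {P Q P' Q' : Proc L V C N} {c d : C} (h : SoundStep D us ys Q c Q' d) (hP : P.Congr Q)
    (hQ : Q'.Congr P') : SoundStep D us ys P c P' d := by
  simpa only [SoundStep, hP.weakDen_eq (approx_tame hD _), ← hQ.weakDen_eq (approx_tame hD _),
    ← hQ.separated_iff, ← hQ.persistent_eq, ← hQ.live_eq] using h

theorem SoundStep.par {D : N → Decl L V C N} (hD : ∀ p, (D p).Closed) {us ys : List V}
    {P P' Q : Proc L V C N} {c d : C} (h : SoundStep D us ys P c P' d) (hQ : Q.Separated D us)
    (hy : ∀ y ∈ ys, y ∉ Q.pfv) : SoundStep D us ys (.par P Q) c (.par P' Q) d := by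
  obtain ⟨vs, E, h1, h2, h3, h4, h5, h6⟩ := h
  refine ⟨vs, E, h1, h2, h3, ⟨h4, hQ.append (Proc.separated_of_or
    (Or.inr fun u hu => hy u (h1 hu)))⟩, h5.mono ?_, fun n s hs hc => ?_⟩
  · rw [Proc.persistent_par]; exact le_sup_left
  · obtain ⟨s', h7, h8, h9, h10⟩ := h6 n s hs.1 hc
    refine ⟨s', ⟨h7, ?_⟩, h8, h9, h10.trans ?_⟩
    · rw [← mem_weakDen_of_variant (approx_tame hD n) hy h8]
      exact weakDen_mono (approx_succ_le D n) Q hs.2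
    · rw [Proc.live_par]
      exact sup_le_sup_left (sup_le_sup_left le_sup_left _) _

theorem always_le_of_mem_weakDen {I : Interp L V C N} {P : Proc L V C N} {s : ℕ → C}
    (h : s ∈ weakDen I P) : P.now ≤ s 0 ∧ P.always ≤ s 0 := by
  induction P generalizing s with
  | tell c => exact ⟨h, bot_le⟩
  | par P Q ihP ihQ =>
    exact ⟨sup_le (ihP h.1).1 (ihQ h.2).1, sup_le (ihP h.1).2 (ihQ h.2).2⟩
  | bang P ih => exact ⟨bot_le, (ih (h 0)).1⟩
  | _ => exact ⟨bot_le, bot_le⟩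

/-- If the process is free of `unless`, all new variables join `us`. Otherwise it does not depend on
`us`, and its own splitting of `ys` is used; the bound then follows because `always` determines the
remaining variables. -/
theorem soundStep_loc [Infinite V] {D : N → Decl L V C N} {us ys : List V} {P : Proc L V C N}
    {d : C} (hi : (Proc.loc ys P).Independent D) (hs : (Proc.loc ys P).Separated D us)
    (hus : us.Disjoint ys) (hd : ∀ y ∈ ys, y ∉ cfv d) : SoundStep D us ys (.loc ys P) d P d := by
  have hst : ∀ s s' : ℕ → C, Variant ys s s' → d ≤ s 0 → d ≤ s' 0 := fun s s' hv h => by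
    have := exs_mono ys h
    rw [exs_of_notMem hd, hv 0] at this
    exact this.trans (exs_le _ _)
  have hden : ∀ n, ∀ s ∈ weakDen (approx D (n + 1)) (.loc ys P), d ≤ s 0 →
      ∃ s' ∈ weakDen (approx D n) P, Variant ys s s' ∧ d ≤ s' 0 := by
    rintro n s ⟨s', hs', hv⟩ h
    exact ⟨s', weakDen_mono (approx_succ_le D n) P hs', hv, hst s s' hv h⟩
  by_cases hu : UnlessFree D (Proc.loc ys P)
  · refine ⟨ys, [], List.Subset.refl _, by simp, by simp, Proc.separated_of_or
      (Or.inl (unlessFree_of_calls_subset hu hu.1 subset_rfl)), .nil _ _, fun n s hs hc => ?_⟩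
    obtain ⟨s', h1, h2, h3⟩ := hden n s hs hc
    refine ⟨s', h1, h2, h3, le_sup_of_le_left ?_⟩
    rw [exs_append, ← h2 0]
    exact exs_mono _ (exs_le _ _)
  · have hs := Or.resolve_left hs hu
    have hpfv : ∀ z ∈ us, z ∉ P.pfv := fun z hz h => hs z hz ⟨h, fun h' => hus hz h'⟩
    have hal : ∀ z ∈ us, z ∉ cfv P.always := fun z hz h => hpfv z hz (P.cfv_always_subset h)
    obtain ⟨-, vs, h1, h2, E, h3, h4, h5⟩ := hi
    obtain ⟨F, hF, hd'⟩ := h5.avoid_list hal fun z hz h => hus hz (h3 h)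
    refine ⟨vs, F, h1, hF ▸ h3, hF ▸ h4, (Proc.separated_of_or (Or.inr hpfv)).append h2,
      hd'.mono le_sup_left, fun n s hs hc => ?_⟩
    obtain ⟨s', h6, h7, h8⟩ := hden n s hs hc
    refine ⟨s', h6, h7, h8, ?_⟩
    have h9 := h5.exs_le (always_le_of_mem_weakDen h6).2
    have h10 : exs (vs ++ E.map Prod.fst) (s' 0) ≤ s 0 := by
      refine (exs_le_exs_of_subset h4 _).trans ?_
      rw [← h7 0]
      exact exs_le _ _
    rw [exs_append]
    refine (exs_mono us (h9.trans (sup_le_sup_left h10 _))).trans ?_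
    rw [exs_sup_of_notMem' _ hal, sup_comm]
    exact sup_le_sup_left (le_sup_of_le_right le_sup_right) _

theorem soundStep_open {D : N → Decl L V C N} (hD : ∀ p, (D p).Closed) {us ys : List V}
    {P : Proc L V C N} {c d : Con V C} (ho : c.Opens ys d) (hs : P.Separated D us)
    (hy : ∀ y ∈ ys, y ∉ P.pfv) : SoundStep D us ys P c.val P d.val := by
  refine ⟨ys, [], List.Subset.refl _, by simp, by simp,
    hs.append (Proc.separated_of_or (Or.inr hy)), .nil _ _, fun n s hs hc => ?_⟩
  -- The store concerns the present time unit only, so only the first element has to be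
  -- strengthened.
  have hv : Variant ys s (Function.update s 0 (d.val ⊔ exs ys (s 0))) := by
    intro n
    by_cases hn : n = 0
    · subst hn
      have h1 : exs ys d.val ≤ exs ys (s 0) := by
        have := exs_mono ys hc
        rwa [ho.val_eq, exs_exs_self] at this
      rw [Function.update_self, exs_sup_of_notMem _ fun y hy => notMem_cfv_exs_of_mem _ hy,
        sup_eq_right.2 h1]
    · rw [Function.update_of_ne hn]
  refine ⟨_, (mem_weakDen_of_variant (approx_tame hD n) hy hv).1
    (weakDen_mono (approx_succ_le D n) P hs), hv, ?_, le_sup_of_le_left ?_⟩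
  · rw [Function.update_self]; exact le_sup_left
  · rw [exs_append, ← hv 0]
    exact exs_mono _ (exs_le _ _)

theorem pfv_subst_subset_of_eqns_eq_bot {P : Proc L V C N} {ys : List V} {ts : List (L.Term V)}
    (h : (eqns ys ts : C) = ⊥) : (P.subst ys ts).pfv ⊆ P.pfv \ {x | x ∈ ys} := by
  rintro z ⟨hz | hz, h'⟩
  · change z ∈ cfv (eqns ys ts : C) at hz
    rw [h] at hz
    exact (notMem_cfv_bot z hz).elim
  · exact ⟨hz, h'⟩

theorem Proc.separated_of_subset {D : N → Decl L V C N} {us : List V} {P Q : Proc L V C N}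
    (h : UnlessFree D P ∨ ∀ u ∈ us, u ∉ P.pfv) (hn : P.NoUnless → Q.NoUnless)
    (hc : Q.calls ⊆ P.calls) (hp : Q.pfv ⊆ P.pfv) : Q.Separated D us :=
  separated_of_or (h.imp (fun h => unlessFree_of_calls_subset h (hn h.1) hc)
    fun h u hu hm => h u hu (hp hm))

theorem soundStep_abs {D : N → Decl L V C N} {us ys : List V} {c : C}
    {E : List (List (L.Term V))} {P : Proc L V C N} {d : C} {ts : List (L.Term V)}
    (hys : ys = [] ∨ Degenerate C) (hn : ys.Nodup) (hd : csubst c ys ts ≤ d) (ha : Adm ys ts)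
    (hs : (Proc.abs ys c E P).Separated D us) :
    SoundStep D us [] (.abs ys c E P) d (.par (P.subst ys ts) (.abs ys c (ts :: E) P)) d := by
  have hid : ∀ c : C, exs ys c = c := by
    rcases hys with rfl | hdeg
    · exact fun _ => rfl
    · exact hdeg.exs_eq ys
  -- Quantification over `ys` is the identity in both cases, so the equations of the instance are
  -- true and `s` serves as its own witness.
  have hbot : (eqns ys ts : C) = ⊥ := by rw [← hid (eqns ys ts), exs_eqns hn ha.2]
  refine soundStep_nil ⟨Proc.separated_of_subset (P := .abs ys c E P) hs (fun h => ⟨trivial, h⟩)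
    ?_ fun u hm => ?_, Proc.separated_of_subset (P := .abs ys c E P) hs id subset_rfl subset_rfl⟩
    fun n s hs hds => ?_
  · rintro p (hp | hp)
    · exact hp.elim
    · exact hp
  · obtain ⟨h1, h2⟩ := pfv_subst_subset_of_eqns_eq_bot hbot hm
    exact ⟨Or.inr h1, h2⟩
  · have hc : c ≤ s 0 := by
      rw [csubst, hid] at hd
      exact (le_sup_left.trans hd).trans hds
    have hP := hs hys hc
    refine ⟨⟨⟨s, ⟨fun k => ?_, weakDen_mono (approx_succ_le D n) P hP⟩, fun _ => rfl⟩,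
      weakDen_mono (approx_succ_le D n) _ hs⟩, hds⟩
    change (eqns ys ts : C) ≤ _
    rw [hbot]; exact bot_le

theorem separated_call {D : N → Decl L V C N} {us : List V} {p : N} {ts : List (L.Term V)}
    {ε : Decl L V C N} (hε : (D p).Alpha ε) (hD : (D p).Closed)
    (hs : (Proc.call p ts : Proc L V C N).Separated D us) :
    (ε.body.subst ε.formals ts).Separated D us := by
  have hr : Reaches D (Proc.call p ts : Proc L V C N) p := .call (Set.mem_singleton p)
  have hu : UnlessFree D (Proc.call p ts : Proc L V C N) ∨
    ∀ u ∈ us, u ∉ (Proc.call p ts : Proc L V C N).pfv := hs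
  refine Proc.separated_of_or (hu.imp (fun h => unlessFree_of_calls h
    ⟨trivial, hε.noUnless_iff.2 (h.2 p hr)⟩ ?_) fun h u hu hm => ?_)
  · rintro q (hq | hq)
    · exact hq.elim
    · exact .step hr (hε.calls_eq ▸ hq)
  · obtain ⟨h1 | h1, h2⟩ := hm
    · rcases cfv_eqns_subset _ _ h1 with h3 | h3
      · exact h2 h3
      · exact h u hu h3
    · exact h2 ((hε.closed hD).pfv_subset h1)

theorem Step.sound [Infinite V] {D : N → Decl L V C N} (hD : ∀ p, (D p).Good D)
    {γ γ' : Config L V C N} (h : Step D γ γ') (hG : γ.proc.Good D) :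
    ∃ ys, γ'.vars = γ.vars ++ ys ∧ ((¬ Degenerate C ∧ γ'.proc.Restless γ'.store.val) ∨
      ∀ us, us ⊆ γ.vars → γ.proc.Separated D us →
        SoundStep D us ys γ.proc γ.store.val γ'.proc γ'.store.val) := by
  have hD' := fun p => (hD p).closed
  induction h with
  | tell xs c d =>
    exact ⟨[], by simp, Or.inr fun us _ hs => soundStep_nil
      (Proc.separated_of_or (Or.inr fun _ _ h => h)) fun n s h1 h2 => ⟨trivial, sup_le h2 h1⟩⟩
  | @par xs ys P P' Q c d _ hy ih =>
    obtain ⟨zs, h1, h2⟩ := ih (Proc.good_par_iff.1 hG).1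
    obtain rfl := List.append_cancel_left h1
    refine ⟨ys, rfl, h2.imp (fun h => ⟨h.1, h.2.par Q⟩) fun h us hus hs =>
      (h us hus hs.1).par hD' hs.2 fun y hyy h' => hy y hyy (Q.pfv_subset_fv h')⟩
  | loc h1 h2 =>
    exact ⟨_, rfl, Or.inr fun us hus hs => soundStep_loc hG.independent hs
      (fun x hx hy => h1 hy (hus hx)) h2⟩
  | @abs xs ys c E P d ts hd ha _ =>
    refine ⟨[], by simp, ?_⟩
    by_cases hys : ys = [] ∨ Degenerate C
    · exact Or.inr fun us _ hs => soundStep_abs hys hG.proper.1 hd ha hs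
    · rw [not_or] at hys
      exact Or.inl ⟨hys.2, Proc.restless_of_exec hys.1 hG.finite hd ha⟩
  | @structVar xs ys P c d ho _ _ h2 =>
    exact ⟨ys, rfl, Or.inr fun us _ hs => soundStep_open hD' ho hs
      fun y hy h => h2 y hy (P.pfv_subset_fv h)⟩
  | struct h1 _ h2 ih =>
    obtain ⟨ys, h3, h4⟩ := ih (h1.good_iff.1 hG)
    exact ⟨ys, h3, h4.imp (fun h => ⟨h.1, h2.restless_iff.1 h.2⟩) fun h us hus hs =>
      (h us hus (h1.separated_iff.1 hs)).congr hD' h1 h2⟩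
  | @call xs p ts d ε hε ha =>
    exact ⟨[], by simp, Or.inr fun us _ hs => soundStep_nil (separated_call hε (hD' p) hs)
      fun n s h1 h2 => ⟨(hε.mem_callDen_iff (approx_tame hD' n) (hD' p) ha s).1 h1, h2⟩⟩
  | unl =>
    exact ⟨[], by simp, Or.inr fun us _ hs => soundStep_nil
      (Proc.separated_of_or (Or.inr fun _ _ h => h)) fun n s h1 h2 => ⟨trivial, h2⟩⟩
  | bang xs P d =>
    refine ⟨[], by simp, Or.inr fun us _ hs => soundStep_nil
      ⟨Proc.separated_of_subset (P := .bang P) hs id subset_rfl subset_rfl,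
        Proc.separated_of_subset (P := .bang P) hs id subset_rfl subset_rfl⟩
      fun n s h1 h2 => ⟨⟨?_, fun k => ?_⟩, h2⟩⟩
    · exact weakDen_mono (approx_succ_le D n) P (h1 0)
    · exact weakDen_mono (approx_succ_le D n) P (h1 (k + 1))

/-! ### Time units and runs -/

/-- The invariant of the execution in one time unit of a process that accepts `w`. -/
structure Accepting (D : N → Decl L V C N) (w : ℕ → C) (γ : Config L V C N) : Prop where
  le_exs : w 0 ≤ exs γ.vars γ.store.val
  sound : ∃ (us : List V) (E : List (V × L.Term V)), us ⊆ γ.vars ∧ E.map Prod.fst ⊆ γ.vars ∧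
    γ.vars ⊆ us ++ E.map Prod.fst ∧ γ.proc.Separated D us ∧ Defines γ.proc.persistent us E ∧
    ∀ n, ∃ s ∈ weakDen (approx D n) γ.proc, Variant γ.vars w s ∧ γ.store.val ≤ s 0 ∧
      exs us (s 0) ≤ γ.store.val ⊔ γ.proc.live

theorem Accepting.step [Infinite V] {D : N → Decl L V C N} (hD : ∀ p, (D p).Good D) {w : ℕ → C}
    {γ γ' : Config L V C N} (h : Accepting D w γ) (hG : γ.proc.Good D) (hs : Step D γ γ') :
    Accepting D w γ' ∨ (¬ Degenerate C ∧ γ'.proc.Restless γ'.store.val) := by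
  obtain ⟨ys, hv, hR | hS⟩ := hs.sound hD hG
  · exact Or.inr hR
  obtain ⟨zs, hv', hdis, hst, hlive, hper, hfr⟩ := hs.basic
  obtain rfl : ys = zs := List.append_cancel_left (hv.symm.trans hv')
  obtain ⟨us, E, h1, h2, h3, h4, h5, h6⟩ := h.sound
  obtain ⟨vs, F, k1, k2, k3, k4, k5, k6⟩ := hS us h1 h4
  have hzs : ∀ z ∈ vs ++ F.map Prod.fst, z ∈ ys := fun z hz =>
    (List.mem_append.1 hz).elim (fun h => k1 h) fun h => k2 h
  -- The earlier equations may mention the new local variables in their terms. As `persistent` does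
  -- not depend on these, the equations can be rewritten without them, and the joint system is again
  -- triangular.
  obtain ⟨E', hE', hd⟩ := h5.avoid_list (fun z hz => hfr z (hzs z hz))
    fun z hz hm => hdis (hzs z hz) (h2 hm)
  refine Or.inl ⟨?_, us ++ vs, E' ++ F, ?_, ?_, ?_, k4, ?_, fun n => ?_⟩
  · rw [hv, exs_append]
    exact h.le_exs.trans (exs_mono _ hst)
  · rw [hv]
    exact List.append_subset.2 ⟨List.subset_append_of_subset_left _ h1,
      List.subset_append_of_subset_right _ k1⟩
  · rw [hv, List.map_append, hE']
    exact List.append_subset.2 ⟨List.subset_append_of_subset_left _ h2,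
      List.subset_append_of_subset_right _ k2⟩
  · rw [hv, List.map_append, hE']
    intro z hz
    simp only [List.mem_append] at hz ⊢
    rcases hz with hz | hz
    · have := List.mem_append.1 (h3 hz); tauto
    · have := List.mem_append.1 (k3 hz); tauto
  · refine Defines.append ((hd.subset ?_).mono hper) k5
    intro z hz
    simp only [List.mem_append] at hz ⊢
    tauto
  -- The transition costs one level of approximation.
  · obtain ⟨s, i1, i2, i3, i4⟩ := h6 (n + 1)
    obtain ⟨s', j1, j2, j3, j4⟩ := k6 n s i1 i3
    refine ⟨s', j1, fun n => ?_, j3, j4.trans (sup_le (i4.trans hlive) le_rfl)⟩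
    rw [hv, exs_append, exs_append, ← j2 n, exs_comm, exs_comm _ ys, i2 n]

theorem Accepting.reflTransGen [Infinite V] {D : N → Decl L V C N} (hD : ∀ p, (D p).Good D)
    {w : ℕ → C} {γ γ' : Config L V C N} (h : Accepting D w γ) (hG : γ.proc.Good D)
    (hs : Relation.ReflTransGen (Step D) γ γ') :
    γ'.proc.Good D ∧
      (Accepting D w γ' ∨ (¬ Degenerate C ∧ γ'.proc.Restless γ'.store.val)) := by
  induction hs with
  | refl => exact ⟨hG, Or.inl h⟩
  | tail _ hst ih =>
    refine ⟨hst.good hD ih.1, ?_⟩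
    rcases ih.2 with ha | hr
    · exact ha.step hD ih.1 hst
    · exact Or.inr ⟨hr.1, hst.restless ih.1.finite hr.2⟩

theorem Proc.future_par {P Q F : Proc L V C N} (h : (par P Q).future = some F) :
    ∃ P' Q', P.future = some P' ∧ Q.future = some Q' ∧ F = par P' Q' := by
  simp only [future, Option.bind_eq_some_iff, Option.map_eq_some_iff] at h
  obtain ⟨P', hP, Q', hQ, rfl⟩ := h
  exact ⟨P', Q', hP, hQ, rfl⟩

theorem Proc.Good.future {D : N → Decl L V C N} {Q F : Proc L V C N} (hQ : Q.Good D)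
    (hF : Q.future = some F) : F.Good D := by
  induction Q generalizing F with
  | par P Q ihP ihQ =>
    obtain ⟨P', Q', h1, h2, rfl⟩ := future_par hF
    have h := good_par_iff.1 hQ
    exact good_par_iff.2 ⟨ihP h.1 h1, ihQ h.2 h2⟩
  | skip | abs => cases hF; exact ⟨trivial, Set.finite_empty, trivial⟩
  | nxt P => cases hF; exact ⟨hQ.1, hQ.2, hQ.3⟩
  | unl c P => cases hF; exact ⟨hQ.1, (Set.finite_union.1 hQ.2).2, hQ.3⟩
  | _ => simp [Proc.future] at hF

theorem Proc.Separated.future {D : N → Decl L V C N} {us : List V} {Q F : Proc L V C N}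
    (hQ : Q.Separated D us) (hF : Q.future = some F) : F.Separated D us := by
  induction Q generalizing F with
  | par P Q ihP ihQ =>
    obtain ⟨P', Q', h1, h2, rfl⟩ := future_par hF
    exact ⟨ihP hQ.1 h1, ihQ hQ.2 h2⟩
  | skip | abs => cases hF; exact separated_of_or (Or.inr fun _ _ h => h)
  | nxt P =>
    cases hF
    exact separated_of_subset (P := .nxt P) hQ id subset_rfl subset_rfl
  | unl c P =>
    cases hF
    exact separated_of_or (Or.inr fun u hu h =>
      hQ.elim (fun h' => h'.1.elim) fun h' => h' u hu (Or.inr h))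
  | _ => simp [Proc.future] at hF

theorem Proc.later_le_always_future {Q F : Proc L V C N} (hF : Q.future = some F) :
    Q.later ≤ F.always := by
  induction Q generalizing F with
  | par P Q ihP ihQ =>
    obtain ⟨P', Q', h1, h2, rfl⟩ := future_par hF
    exact sup_le_sup (ihP h1) (ihQ h2)
  | nxt P => cases hF; exact le_rfl
  | _ => exact bot_le

/-- The only difficulty is an `unless` whose guard is entailed by `s 0`. The guard does not depend
on `us`, so the store entails it as well, and the `unless` could still step, contrary to rest. -/
theorem tail_mem_weakDen_future {D : N → Decl L V C N} {I : Interp L V C N} {us xs : List V}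
    {Q F : Proc L V C N} {d : Con V C} {s : ℕ → C} (hQ : Q.Separated D us)
    (hF : Q.future = some F) (hr : ∀ Q', ¬ Step D ⟨xs, Q, d⟩ ⟨xs, Q', d⟩)
    (hd : exs us (s 0) ≤ d.val) (hs : s ∈ weakDen I Q) :
    (fun n => s (n + 1)) ∈ weakDen I F := by
  induction Q generalizing F with
  | par P Q ihP ihQ =>
    obtain ⟨P', Q', h1, h2, rfl⟩ := Proc.future_par hF
    exact ⟨ihP hQ.1 h1 (fun _ h => hr _ (h.par_left Q)) hs.1,
      ihQ hQ.2 h2 (fun _ h => hr _ (h.par_right P)) hs.2⟩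
  | skip | abs => cases hF; trivial
  | nxt P => cases hF; exact hs
  | unl c P =>
    cases hF
    refine hs.elim (fun h => h.2) fun hc => (hr _ (.unl ?_)).elim
    have h : ∀ u ∈ us, u ∉ cfv c := fun u hu hm =>
      hQ.elim (fun h => h.1.elim) fun h => h u hu (Or.inl hm)
    rw [← exs_of_notMem h]
    exact (exs_mono us hc).trans hd
  | _ => simp [Proc.future] at hF

theorem Observable.sound [Infinite V] {D : N → Decl L V C N} (hD : ∀ p, (D p).Good D)
    {P R : Proc L V C N} {c c' : Con V C} (h : Observable D P c c' R) (hP : P.Good D) {w : ℕ → C}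
    (hw : ∀ n, w ∈ weakDen (approx D n) P) (hc : c.val = w 0) :
    c'.val = w 0 ∧ R.Good D ∧ ∀ n, (fun i => w (i + 1)) ∈ weakDen (approx D n) R := by
  obtain ⟨xs, Q, F, d, hred, hrest, hF, rfl, rfl⟩ := h
  have h0 : Accepting D w ⟨[], P, c⟩ := by
    refine ⟨hc.ge, [], [], by simp, by simp, by simp, Proc.separated_of_or (Or.inr (by simp)),
      .nil _ _, fun n => ⟨w, hw n, fun _ => rfl, hc.le, ?_⟩⟩
    exact hc.ge.trans le_sup_left
  obtain ⟨hQ, hacc⟩ := h0.reflTransGen hD hP hred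
  have hacc := hacc.resolve_right fun hR => hrest (by
    obtain ⟨Q', h⟩ := hR.2.exists_step D hR.1 hF hQ.proper hQ.finite xs
    exact ⟨_, h⟩)
  obtain ⟨us, E, h1, h2, h3, h4, h5, h6⟩ := hacc.sound
  obtain ⟨e1, e2⟩ := Proc.eq_bot_of_future hF
  have hFg := hQ.future hF
  -- The splitting reached at rest is the one required of `(local xs) F`: what was told from the
  -- next time unit on is now told by replications of `F`.
  refine ⟨?_, ⟨hFg.proper, (List.finite_toSet xs).union hFg.finite, hFg.independent, us, h1,
    h4.future hF, E, h2, h3, h5.mono ?_⟩, fun n => ?_⟩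
  -- For the output any level will do; for the residual process a witness is needed at each one.
  · obtain ⟨s, -, hv, hds, -⟩ := h6 0
    rw [Con.val_exs]
    refine le_antisymm ((exs_mono xs hds).trans ?_) hacc.le_exs
    exact (hv 0).ge.trans (exs_le _ _)
  · change Q.always ⊔ Q.later ≤ _
    rw [e2, bot_sup_eq]
    exact Proc.later_le_always_future hF
  · obtain ⟨s, hs, hv, -, hus⟩ := h6 n
    refine ⟨fun i => s (i + 1), tail_mem_weakDen_future h4 hF (fun Q' h => hrest ⟨_, h⟩) ?_ hs,
      fun i => hv (i + 1)⟩
    simpa [Proc.live, e1, e2] using hus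

theorem FinRun.sound [Infinite V] {D : N → Decl L V C N} (hD : ∀ p, (D p).Good D)
    {P : Proc L V C N} {s s' : List (Con V C)} (h : FinRun D P s s') (hP : P.Good D) {w : ℕ → C}
    (hw : ∀ n, w ∈ weakDen (approx D n) P) {k : ℕ} (hs : s.map Con.val = (List.range k).map w) :
    s'.map Con.val = (List.range k).map w := by
  induction h generalizing w k with
  | nil => exact hs
  | cons ho _ ih =>
    cases k with
    | zero => simp at hs
    | succ k =>
      rw [List.range_succ_eq_map, List.map_cons, List.map_cons, List.map_map,
        List.cons.injEq] at hs ⊢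
      obtain ⟨h1, h2, h3⟩ := ho.sound hD hP hw hs.1
      exact ⟨h1, ih h2 h3 hs.2⟩

theorem InfRun.sound [Infinite V] {D : N → Decl L V C N} (hD : ∀ p, (D p).Good D)
    {P : Proc L V C N} {a a' : ℕ → Con V C} (h : InfRun D P a a') (hP : P.Good D) {w : ℕ → C}
    (hw : ∀ n, w ∈ weakDen (approx D n) P) (ha : ∀ n, (a n).val = w n) (n : ℕ) :
    (a' n).val = w n := by
  obtain ⟨Q, rfl, hQ⟩ := h
  have key : ∀ n, (Q n).Good D ∧ ∀ m, (fun i => w (i + n)) ∈ weakDen (approx D m) (Q n) := by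
    intro n
    induction n with
    | zero => exact ⟨hP, hw⟩
    | succ n ih =>
      have := (hQ n).sound hD ih.1 ih.2 (by simpa using ha n)
      refine ⟨this.2.1, fun m => ?_⟩
      convert this.2.2 m using 3 with i
      omega
  have := ((hQ n).sound hD (key n).1 (key n).2 (by simpa using ha n)).1
  simpa using this

theorem IsProgram.good {D : N → Decl L V C N} {P : Proc L V C N} (h : IsProgram D P)
    (hLI : LocallyIndependent D P) : P.Good D ∧ ∀ p, (D p).Good D :=
  ⟨⟨h.1.1.proper, h.1.2, Proc.independent_of_localsUnlessFree hLI.1⟩, fun p =>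
    ⟨⟨(h.2 p).1, (Proc.pfv_subset_fv _).trans (h.2 p).2.2.2⟩,
      (h.2 p).2.1.proper, (h.2 p).2.2.1, Proc.independent_of_localsUnlessFree (hLI.2 p)⟩⟩

end Soundness

end UTCC

theorem mainTheorem2 {L : FirstOrder.Language.{u, v}} {V : Type} {C : Type w}
    {N : Type r} [DecidableEq V] [Infinite V]
    [Countable V] [ConstraintSystem L V C] (D : N → UTCC.Decl L V C N) (P : UTCC.Proc L V C N)
    (hprog : UTCC.IsProgram D P) (hLI : UTCC.LocallyIndependent D P)
    (w : ℕ → C) (hw : w ∈ UTCC.semantics D P) :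
    (∀ (k : ℕ) (s s' : List (UTCC.Con V C)),
      s.map UTCC.Con.val = (List.range k).map w → UTCC.FinRun D P s s' →
        s'.map UTCC.Con.val = s.map UTCC.Con.val ∧ (List.range k).map w ∈ UTCC.spFin D P) ∧
    (∀ a a' : ℕ → UTCC.Con V C, (∀ n, (a n).val = w n) → UTCC.InfRun D P a a' →
        (∀ n, (a' n).val = (a n).val) ∧ w ∈ UTCC.spInf D P) := by
  obtain ⟨hP, hD⟩ := hprog.good hLI
  have hw' := fun n => UTCC.semantics_subset_weakDen (fun p => (hD p).closed) n P hw
  refine ⟨fun k s s' hs hrun => ?_, fun a a' ha hrun => ?_⟩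
  · have h := hrun.sound hD hP hw' hs
    exact ⟨h.trans hs.symm, s, s', hrun, hs, h⟩
  · have h := hrun.sound hD hP hw' ha
    exact ⟨fun n => (h n).trans (ha n).symm, a, a', hrun, ha, h⟩
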